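/- Let $T$ be a rooted infinite triangulation with finite boundary. That is, $T$ is a planar embedding of an infinite, simple, locally finite, one-ended, $2$-connected graph in which one distinguished face, the exterior face, is bounded by a finite number $m\ge 3$ of edges and every other face is bounded by exactly $3$ edges. The root edge $(v_r,v_y)$ is a directed edge of the boundary with the exterior face on its right. Vertices on the boundary of the exterior face are boundary vertices, and all others are interior. A Schnyder wood of $T$ is an orientation of the edges of $T$ together with a colouring of the edges in blue, red and yellow such that: (i) at every interior vertex there are exactly three outgoing edges, coloured blue, red, yellow in anticlockwise cyclic order, and every incoming edge enters between the outgoing edges of the two other colours; (ii) at every boundary vertex other than $v_r,v_y$, the incident edges are, in anticlockwise order starting from the boundary: incoming yellow edges, exactly one outgoing red edge, incoming blue edges, exactly one outgoing yellow edge, incoming red edges; (iii) $v_r$ has exactly one outgoing edge, $v_y$ has none, and all edges directed into $v_r$ (respectively $v_y$) are red (respectively yellow). It is maximal if it contains neither an anticlockwise directed cycle (one with the exterior face on its right) nor a right-directed path (a two-ended infinite directed path with the exterior face on its right). Consider the maximal Schnyder wood of $T$. For a vertex $v$ and a colour $c\in\{b,r,y\}$ (blue, red, yellow), let $P^{c}_v$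 be the unique directed path of colour $c$ that starts at $v$ and is continued as long as there is an outgoing edge of colour $c$. Then for every vertex $v$ of $T$: 1. if $v\notin\{v_r,v_y\}$, then every vertex on $P^{b}_v$ has an outgoing red edge to a vertex of $P^{r}_v$; 2. if $v\ne v_y$, then every vertex on $P^{r}_v$ has an outgoing yellow edge to a vertex of $P^{y}_v$; 3. every vertex on $P^{y}_v$ is either a boundary vertex of $T$ or has an outgoing blue edge to a vertex of $P^{b}_v$. -/

import Mathlib

/-- A simple graph `graph` on `V` with a rotation system: `rot d` is the dart (directed edge) that
comes directly after `d` in the anticlockwise order around the tail of `d`. This is the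
combinatorial description of an embedding of the graph in an oriented surface, up to
orientation-preserving homeomorphism. -/
structure EmbeddedGraph (V : Type*) where
  graph : SimpleGraph V
  rot : Equiv.Perm graph.Dart
  rot_fst : ∀ d, (rot d).fst = d.fst
  rot_sameCycle : ∀ d e : graph.Dart, d.fst = e.fst → rot.SameCycle d e

namespace EmbeddedGraph

variable {V : Type*} (M : EmbeddedGraph V)

/-- The dart that follows `d` along the face to the left of `d`: at the head of `d`, take the first
dart clockwise from the reverse of `d`. -/
def faceNext (d : M.graph.Dart) : M.graph.Dart := M.rot.symm d.symm

/-- One traversal step along the face to the left of a dart. -/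
def FaceStep (d e : M.graph.Dart) : Prop := e = M.faceNext d

/-- The face to the left of the dart `d`, given as the set of the darts that have it on their left.
The face to the right of `d` is `M.face d.symm`. -/
def face (d : M.graph.Dart) : Set M.graph.Dart := {e | Relation.EqvGen M.FaceStep d e}

/-- Moves inside the complement of a set `F` of edges: a dart stands for the face to its left, and
one may stay in that face, or cross an edge that is not in `F`. -/
def RegionStep (F : Set (Sym2 V)) (d e : M.graph.Dart) : Prop :=
  e = M.faceNext d ∨ (e = d.symm ∧ d.edge ∉ F)

/-- The faces to the left of `d` and to the left of `e` lie in the same region of the complement of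
the edge set `F`. -/
def SameRegion (F : Set (Sym2 V)) : M.graph.Dart → M.graph.Dart → Prop :=
  Relation.EqvGen (M.RegionStep F)

/-- The embedding has genus zero: every cycle of the graph separates the faces to its left from
the faces to its right. -/
def IsPlanar : Prop :=
  ∀ (v : V) (p : M.graph.Walk v v), p.IsCycle →
    ∀ d ∈ p.darts, ¬ M.SameRegion {e | e ∈ p.edges} d d.symm

/-- All darts with the same tail as `d`, in anticlockwise order, starting with `d`. -/
noncomputable def star (d : M.graph.Dart) : List M.graph.Dart :=
  (List.range (M.graph.neighborSet d.fst).ncard).map fun k => (M.rot ^ k) d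

end EmbeddedGraph

/-- A rooted infinite triangulation with finite boundary (an infinite triangulation of an `m`-gon
for some `m ≥ 3`): an embedded infinite, simple, locally finite, one-ended, `2`-connected planar
graph in which the exterior face, which lies to the right of the root edge, is bounded by a finite
number `m ≥ 3` of edges, and every other face is bounded by exactly three edges. -/
structure InfiniteTriangulation (V : Type*) extends EmbeddedGraph V where
  infinite : Infinite V
  locallyFinite : ∀ v, (graph.neighborSet v).Finite
  connected : graph.Connected
  connected_delete : ∀ v : V, (graph.induce {v}ᶜ).Connected
  oneEnded : ∀ K : Set V, K.Finite → ∀ C D : (graph.induce Kᶜ).ConnectedComponent,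
    C.supp.Infinite → D.supp.Infinite → C = D
  planar : toEmbeddedGraph.IsPlanar
  /-- The root edge. -/
  root : graph.Dart
  exterior_finite : (toEmbeddedGraph.face root.symm).Finite
  three_le_exterior : 3 ≤ (toEmbeddedGraph.face root.symm).ncard
  triangular : ∀ d, d ∉ toEmbeddedGraph.face root.symm → (toEmbeddedGraph.face d).ncard = 3

namespace InfiniteTriangulation

variable {V : Type*} (T : InfiniteTriangulation V)

/-- The exterior face, as the set of the darts that have it on their left. -/
def exterior : Set T.graph.Dart := T.face T.root.symm

/-- The boundary vertices. -/
def boundary : Set V := {v | ∃ d ∈ T.exterior, d.fst = v}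

/-- The tail of the root edge. -/
def vr : V := T.root.fst

/-- The head of the root edge. -/
def vy : V := T.root.snd

end InfiniteTriangulation

/-- The three colours. -/
inductive Colour
  | blue
  | red
  | yellow

/-- An orientation of the edges of `G` together with a `3`-colouring of the edges.
`out d = true` says that the edge of the dart `d` is directed from `d.fst` to `d.snd`. -/
structure ColouredOrientation {V : Type*} (G : SimpleGraph V) where
  out : G.Dart → Bool
  colour : G.Dart → Colour
  out_symm : ∀ d, out d.symm = !out d
  colour_symm : ∀ d, colour d.symm = colour d

namespace ColouredOrientation

variable {V : Type*} {G : SimpleGraph V} (S : ColouredOrientation G)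

/-- The label of an edge as seen from the tail of the dart `d`: whether it is outgoing (`true`) or
incoming (`false`) there, and its colour. -/
def label (d : G.Dart) : Bool × Colour := (S.out d, S.colour d)

/-- There is an edge of colour `c` directed from `u` to `w`. -/
def Arc (c : Colour) (u w : V) : Prop :=
  ∃ d : G.Dart, d.fst = u ∧ d.snd = w ∧ S.out d = true ∧ S.colour d = c

/-- The set of vertices on the directed path of colour `c` that starts at `v`, namely the vertices
that are reached from `v` by following edges of colour `c` in their direction. (In a Schnyder wood
every vertex has at most one outgoing edge of each colour, so the path is unique.) -/
def path (c : Colour) (v : V) : Set V := {w | Relation.ReflTransGen (S.Arc c) v w}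

end ColouredOrientation

namespace InfiniteTriangulation

variable {V : Type*} (T : InfiniteTriangulation V)

/-- The Schnyder condition at an interior vertex `v`. In anticlockwise order, the edges at `v` are:
the outgoing blue edge, incoming yellow edges, the outgoing red edge, incoming blue edges,
the outgoing yellow edge, incoming red edges. -/
def SchnyderCondition (S : ColouredOrientation T.graph) (v : V) : Prop :=
  ∃ d : T.graph.Dart, d.fst = v ∧ ∃ i j k : ℕ,
    (T.star d).map S.label =
      [(true, Colour.blue)] ++ List.replicate i (false, Colour.yellow) ++
      [(true, Colour.red)] ++ List.replicate j (false, Colour.blue) ++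
      [(true, Colour.yellow)] ++ List.replicate k (false, Colour.red)

/-- The Schnyder boundary condition at a boundary vertex `v`. In anticlockwise order from the
boundary, that is, from the dart at `v` with the exterior face on its right, the edges at `v` are:
incoming yellow edges, the outgoing red edge, incoming blue edges, the outgoing yellow edge,
incoming red edges. -/
def SchnyderBoundaryCondition (S : ColouredOrientation T.graph) (v : V) : Prop :=
  ∃ d : T.graph.Dart, d.fst = v ∧ d.symm ∈ T.exterior ∧ ∃ i j k : ℕ,
    (T.star d).map S.label =
      List.replicate i (false, Colour.yellow) ++ [(true, Colour.red)] ++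
      List.replicate j (false, Colour.blue) ++ [(true, Colour.yellow)] ++
      List.replicate k (false, Colour.red)

/-- The Schnyder root condition at the two ends of the root edge. -/
def SchnyderRootCondition (S : ColouredOrientation T.graph) : Prop :=
  (∃! d : T.graph.Dart, d.fst = T.vr ∧ S.out d = true) ∧
  (∀ d : T.graph.Dart, d.fst = T.vy → S.out d = false) ∧
  (∀ d : T.graph.Dart, d.snd = T.vr → S.out d = true → S.colour d = Colour.red) ∧
  (∀ d : T.graph.Dart, d.snd = T.vy → S.out d = true → S.colour d = Colour.yellow)

/-- `S` is a Schnyder wood of `T`. -/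
def IsSchnyderWood (S : ColouredOrientation T.graph) : Prop :=
  (∀ v, v ∉ T.boundary → T.SchnyderCondition S v) ∧
  (∀ v ∈ T.boundary, v ≠ T.vr → v ≠ T.vy → T.SchnyderBoundaryCondition S v) ∧
  T.SchnyderRootCondition S

/-- `p` is a directed anticlockwise cycle: the exterior face lies to its right. -/
def IsAnticlockwiseCycle (S : ColouredOrientation T.graph) {v : V} (p : T.graph.Walk v v) : Prop :=
  p.IsCycle ∧ (∀ d ∈ p.darts, S.out d = true) ∧
    ∃ d ∈ p.darts, T.SameRegion {e | e ∈ p.edges} d.symm T.root.symm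

/-- `p` is a right-directed path: a two-ended infinite directed path such that the region of its
complement that contains the exterior face lies to its right. -/
def IsRightDirectedPath (S : ColouredOrientation T.graph) (p : ℤ → T.graph.Dart) : Prop :=
  (∀ i, (p i).snd = (p (i + 1)).fst) ∧ (Function.Injective fun i => (p i).fst) ∧
    (∀ i, S.out (p i) = true) ∧
    ∃ i, T.SameRegion {e | ∃ j, e = (p j).edge} (p i).symm T.root.symm

/-- `S` is a maximal Schnyder wood of `T`: it has neither anticlockwise cycles nor right-directed
paths. -/
def IsMaximalSchnyderWood (S : ColouredOrientation T.graph) : Prop :=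
  T.IsSchnyderWood S ∧
  (∀ (v : V) (p : T.graph.Walk v v), ¬ T.IsAnticlockwiseCycle S p) ∧
  ∀ p : ℤ → T.graph.Dart, ¬ T.IsRightDirectedPath S p

end InfiniteTriangulation

/-! ### Rotations at a vertex: gaps and fans -/

namespace InfiniteTriangulation

variable {V : Type*} (T : InfiniteTriangulation V)

/-! Order the colours cyclically as blue, red, yellow (`Colour.next`). All three claims follow from
one local statement, `mem_path_of_arc`: if `v → u` has colour `c` and `u → x` has the next colour,
then `x` lies on the path of the next colour that starts at `v`. Applied to consecutive vertices of
the path of colour `c`, it shows that the heads of their edges of the next colour all stay on one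
path.

The main tool is a discrete Gauss–Bonnet formula. Boundary vertices receive virtual outgoing edges
in the exterior corner, so that every vertex has out-degree three. The turn from one edge to the
next is one minus the number of outgoing edges on the left; along directed edges it is 1, 0 or −1 as
the colour moves on to the next one, stays, or moves back. Peeling off triangles one at a time shows
that the total turn of a simple cycle is 3 if the exterior face is on its right and −3 if it is on
its left (`cturn_eq`); one-endedness makes one side finite, so that the induction ends. By
maximality every directed cycle has total turn −3 (`directed_cycle`), hence directed paths without
right turns are simple.

Next, paths that always go straight on or always turn left must be finite. Suppose that an infinite
path without right turns makes infinitely many left turns. Late enough, going straight on instead of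
turning left cannot lead back to a finite core around the boundary (`IsCore.ts_le`), so there is a
fork with two infinite branches (`exists_isFork`). The branches form a two-ended path. If only
finitely many vertices on the side of the stem led to a late vertex of the turning branch, then the
inequality `euler_le` would bound the number of left turns (`IsFork.exists_infinite_back`). So
König's lemma yields an infinite backward path, which closes up to an anticlockwise directed cycle
or to a right-directed path, against maximality (`IsRay.eventually_straight`). An infinite
monochromatic path is impossible as well: from each of its late vertices the path that always turns
left returns to the core, after a number of steps bounded by its turns, so infinitely many vertices
would lie in a finite ball (`IsRay.not_monochromatic`).

Finally, suppose that `mem_path_of_arc` fails. The path through `v`, `u`, `x` that always turns left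
and the monochromatic path of the next colour from `v` both end on the boundary. If they met again,
the first one would be trapped inside the cycle so formed (`IsDivergent.disjoint`). If they do not
meet, then suitable parts of them and an arc of the boundary form a cycle with the exterior face on
its right, whose total turn is 3 by the formula but at least 4 by direct computation
(`not_isDivergent`). -/

lemma pow_rot_fst (k : ℕ) (d : T.graph.Dart) : ((T.rot ^ k) d).fst = d.fst := by
  induction k with
  | zero => rfl
  | succ k ih => rw [pow_succ', Equiv.Perm.mul_apply, T.rot_fst, ih]

lemma rot_symm_fst (d : T.graph.Dart) : (T.rot.symm d).fst = d.fst := by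
  have := T.rot_fst (T.rot.symm d)
  rwa [Equiv.apply_symm_apply, eq_comm] at this

lemma dart_ext {d e : T.graph.Dart} (h1 : d.fst = e.fst) (h2 : d.snd = e.snd) : d = e :=
  SimpleGraph.Dart.ext _ _ (Prod.ext h1 h2)

lemma finite_darts_at (v : V) : {d : T.graph.Dart | d.fst = v}.Finite := by
  refine Set.Finite.of_finite_image (f := fun d => d.snd) ((T.locallyFinite v).subset ?_) ?_
  · rintro _ ⟨d, hd, rfl⟩
    have := d.adj
    simp only [Set.mem_ofPred_eq] at hd
    rw [hd] at this
    exact this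
  · intro d hd e he h
    exact T.dart_ext (hd.trans he.symm) h

/-- The darts with tail `v`. -/
noncomputable def dartsAt (v : V) : Finset T.graph.Dart := (T.finite_darts_at v).toFinset

@[simp] lemma mem_dartsAt {v : V} {d : T.graph.Dart} : d ∈ T.dartsAt v ↔ d.fst = v := by
  simp [dartsAt]

/-- `rot_sameCycle` only gives an integer exponent. Finite degree makes the rotation periodic at
`x`, and adding enough periods makes the exponent positive. -/
lemma exists_pow_eq {x y : T.graph.Dart} (h : x.fst = y.fst) :
    ∃ k, 0 < k ∧ (T.rot ^ k) x = y := by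
  obtain ⟨p, hp0, hp⟩ : ∃ p : ℕ, 0 < p ∧ (T.rot ^ p) x = x := by
    obtain ⟨i, -, j, -, hne, hij⟩ := Set.infinite_univ.exists_ne_map_eq_of_mapsTo
      (f := fun k : ℕ => (T.rot ^ k) x) (t := {d | d.fst = x.fst})
      (fun k _ => by simp [pow_rot_fst]) (T.finite_darts_at _)
    wlog hlt : i < j generalizing i j
    · exact this j i hne.symm hij.symm (by omega)
    refine ⟨j - i, by omega, (T.rot ^ i).injective ?_⟩
    rw [← Equiv.Perm.mul_apply, ← pow_add, Nat.add_sub_cancel' hlt.le]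
    exact hij.symm
  have hpz : ∀ n : ℕ, (T.rot ^ (p * n)) x = x := by
    intro n
    induction n with
    | zero => simp
    | succ n ih => rw [Nat.mul_succ, pow_add, Equiv.Perm.mul_apply, hp, ih]
  obtain ⟨z, hz⟩ := T.rot_sameCycle x y h
  refine ⟨(z + p * (z.natAbs + 1)).toNat, ?_, ?_⟩
  · have : (1 : ℤ) ≤ p := by exact_mod_cast hp0
    have : (z.natAbs + 1 : ℤ) ≤ p * (z.natAbs + 1) := by nlinarith [abs_nonneg z]
    have h2 := neg_abs_le z
    omega
  · have : (1 : ℤ) ≤ p := by exact_mod_cast hp0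
    have : (z.natAbs + 1 : ℤ) ≤ p * (z.natAbs + 1) := by nlinarith [abs_nonneg z]
    have h2 := neg_abs_le z
    have h3 : (0 : ℤ) ≤ z + p * (z.natAbs + 1) := by omega
    rw [← zpow_natCast, Int.toNat_of_nonneg h3, zpow_add, Equiv.Perm.mul_apply]
    have := hpz (z.natAbs + 1)
    rw [← zpow_natCast] at this
    push_cast at this
    rw [Nat.cast_natAbs, Int.cast_id] at *
    rw [this, hz]

/-- The least positive number of anticlockwise steps from `x` to `y`. -/
noncomputable def gap (x y : T.graph.Dart) : ℕ := sInf {k | 0 < k ∧ (T.rot ^ k) x = y}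

variable {T}

lemma gap_pos {x y : T.graph.Dart} (h : x.fst = y.fst) : 0 < T.gap x y :=
  (Nat.sInf_mem (T.exists_pow_eq h)).1

lemma pow_gap {x y : T.graph.Dart} (h : x.fst = y.fst) : (T.rot ^ T.gap x y) x = y :=
  (Nat.sInf_mem (T.exists_pow_eq h)).2

lemma gap_le {x y : T.graph.Dart} {k : ℕ} (hk : 0 < k) (h : (T.rot ^ k) x = y) : T.gap x y ≤ k :=
  Nat.sInf_le ⟨hk, h⟩

lemma pow_inj {d : T.graph.Dart} {i j : ℕ} (hi : i < T.gap d d) (hj : j < T.gap d d)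
    (h : (T.rot ^ i) d = (T.rot ^ j) d) : i = j := by
  wlog hlt : i < j generalizing i j
  · rcases Nat.lt_or_ge j i with h' | h'
    · exact (this hj hi h.symm h').symm
    · omega
  exfalso
  have : (T.rot ^ (j - i)) d = d := by
    apply (T.rot ^ i).injective
    rw [← Equiv.Perm.mul_apply, ← pow_add, Nat.add_sub_cancel' hlt.le, h]
  have := gap_le (by omega) this
  omega

lemma pow_mod_gap (d : T.graph.Dart) (k : ℕ) : (T.rot ^ (k % T.gap d d)) d = (T.rot ^ k) d := by
  have hpz : ∀ n : ℕ, (T.rot ^ (T.gap d d * n)) d = d := by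
    intro n
    induction n with
    | zero => simp
    | succ n ih => rw [Nat.mul_succ, pow_add, Equiv.Perm.mul_apply, pow_gap rfl, ih]
  conv_rhs => rw [← Nat.mod_add_div k (T.gap d d), pow_add, Equiv.Perm.mul_apply, hpz]

lemma exists_pow_lt {d z : T.graph.Dart} (h : d.fst = z.fst) :
    ∃ k < T.gap d d, (T.rot ^ k) d = z := by
  obtain ⟨k, -, hk⟩ := T.exists_pow_eq h
  exact ⟨k % T.gap d d, Nat.mod_lt _ (gap_pos rfl), by rw [pow_mod_gap, hk]⟩

lemma gap_pow {d : T.graph.Dart} {p q : ℕ} (hpq : p < q) (hq : q ≤ T.gap d d) :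
    T.gap ((T.rot ^ p) d) ((T.rot ^ q) d) = q - p := by
  apply le_antisymm
  · apply gap_le (by omega)
    rw [← Equiv.Perm.mul_apply, ← pow_add, Nat.sub_add_cancel hpq.le]
  · by_contra hlt
    have hf : ((T.rot ^ p) d).fst = ((T.rot ^ q) d).fst := by simp [pow_rot_fst]
    have h1 := pow_gap hf
    have h0 := gap_pos hf
    set g := T.gap ((T.rot ^ p) d) ((T.rot ^ q) d)
    rw [← Equiv.Perm.mul_apply, ← pow_add] at h1
    rcases hq.eq_or_lt with h | h
    · rw [h, pow_gap rfl] at h1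
      have := gap_le (by omega) h1
      omega
    · have := pow_inj (by omega) h h1
      omega

lemma gap_self_pow (d : T.graph.Dart) (p : ℕ) :
    T.gap ((T.rot ^ p) d) ((T.rot ^ p) d) = T.gap d d := by
  have key : ∀ (x : T.graph.Dart) (k : ℕ), (T.rot ^ k) x = x ↔
      (T.rot ^ k) ((T.rot ^ p) x) = (T.rot ^ p) x := by
    intro x k
    rw [← Equiv.Perm.mul_apply, ← pow_add, add_comm, pow_add, Equiv.Perm.mul_apply]
    exact (T.rot ^ p).injective.eq_iff.symm
  unfold gap
  congr 1
  ext k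
  simp only [Set.mem_ofPred_eq, ← key]

open Classical in
lemma gap_self_eq_ncard (d : T.graph.Dart) : T.gap d d = (T.graph.neighborSet d.fst).ncard := by
  have : T.graph.neighborSet d.fst =
      ((Finset.range (T.gap d d)).image fun k => ((T.rot ^ k) d).snd : Finset V) := by
    ext w
    simp only [SimpleGraph.mem_neighborSet, Finset.coe_image, Finset.coe_range, Set.mem_image,
      Set.mem_Iio]
    constructor
    · intro hw
      obtain ⟨k, hk, h⟩ := exists_pow_lt (d := d) (z := ⟨(d.fst, w), hw⟩) rfl
      exact ⟨k, hk, by rw [h]⟩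
    · rintro ⟨k, -, rfl⟩
      have := ((T.rot ^ k) d).adj
      have h2 := T.pow_rot_fst k d
      rw [h2] at this
      exact this
  rw [this, Set.ncard_coe_finset, Finset.card_image_of_injOn, Finset.card_range]
  intro i hi j hj h
  simp only [Finset.coe_range, Set.mem_Iio] at hi hj
  exact pow_inj hi hj (T.dart_ext (by simp [pow_rot_fst]) h)

open Classical in
variable (T) in
/-- The darts met when turning anticlockwise from `x` (included) to `y` (excluded). -/
noncomputable def fan (x y : T.graph.Dart) : Finset T.graph.Dart :=
  (Finset.range (T.gap x y)).image fun j => (T.rot ^ j) x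

lemma mem_fan {x y z : T.graph.Dart} : z ∈ T.fan x y ↔ ∃ j < T.gap x y, (T.rot ^ j) x = z := by
  simp [fan]

lemma gap_le_self {x y : T.graph.Dart} (h : x.fst = y.fst) : T.gap x y ≤ T.gap x x := by
  obtain ⟨k, hk, rfl⟩ := exists_pow_lt h
  rcases Nat.eq_zero_or_pos k with rfl | h0
  · simp
  · exact (gap_le h0 rfl).trans hk.le

lemma sum_fan {A : Type*} [AddCommMonoid A] (f : T.graph.Dart → A) {x y : T.graph.Dart}
    (h : x.fst = y.fst) :
    ∑ z ∈ T.fan x y, f z = ∑ j ∈ Finset.range (T.gap x y), f ((T.rot ^ j) x) := by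
  classical
  rw [fan, Finset.sum_image]
  intro i hi j hj hij
  have := gap_le_self h
  simp only [Finset.coe_range, Set.mem_Iio] at hi hj
  exact pow_inj (by omega) (by omega) hij

lemma fst_of_mem_fan {x y z : T.graph.Dart} (h : z ∈ T.fan x y) : z.fst = x.fst := by
  obtain ⟨j, -, rfl⟩ := mem_fan.1 h
  exact T.pow_rot_fst j x

lemma left_mem_fan {x y : T.graph.Dart} (h : x.fst = y.fst) : x ∈ T.fan x y :=
  mem_fan.2 ⟨0, gap_pos h, rfl⟩

lemma right_notMem_fan {x y : T.graph.Dart} (h : x.fst = y.fst) (hne : x ≠ y) :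
    y ∉ T.fan x y := by
  intro hy
  obtain ⟨j, hj, hjy⟩ := mem_fan.1 hy
  rcases Nat.eq_zero_or_pos j with rfl | h0
  · exact hne hjy
  · have := gap_le h0 hjy
    omega

lemma rot_symm_mem_fan {x y : T.graph.Dart} (h : x.fst = y.fst) : T.rot.symm y ∈ T.fan x y := by
  have h0 := gap_pos h
  refine mem_fan.2 ⟨T.gap x y - 1, by omega, ?_⟩
  rw [Equiv.eq_symm_apply, ← Equiv.Perm.mul_apply, ← pow_succ', Nat.sub_add_cancel h0, pow_gap h]

lemma fan_induction {x y : T.graph.Dart} {p : T.graph.Dart → Prop} (h : x.fst = y.fst) (hx : p x)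
    (hs : ∀ z ∈ T.fan x y, T.rot z ∈ T.fan x y → T.rot z ≠ x → p z → p (T.rot z)) :
    ∀ z ∈ T.fan x y, p z := by
  intro z hz
  obtain ⟨j, hj, rfl⟩ := mem_fan.1 hz
  clear hz
  induction j with
  | zero => exact hx
  | succ j ih =>
    rw [pow_succ', Equiv.Perm.mul_apply]
    refine hs _ (mem_fan.2 ⟨j, by omega, rfl⟩) (mem_fan.2 ⟨j + 1, hj, ?_⟩) ?_ (ih (by omega))
    · rw [pow_succ', Equiv.Perm.mul_apply]
    · intro h1
      rw [← Equiv.Perm.mul_apply, ← pow_succ'] at h1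
      have := pow_inj (d := x) (i := j + 1) (j := 0) (by have := gap_le_self h; omega)
        (gap_pos rfl) (by simpa using h1)
      omega

lemma mem_fan_self {x z : T.graph.Dart} : z ∈ T.fan x x ↔ z.fst = x.fst := by
  refine ⟨fst_of_mem_fan, fun h => ?_⟩
  obtain ⟨k, hk, rfl⟩ := exists_pow_lt h.symm
  exact mem_fan.2 ⟨k, hk, rfl⟩

/-- Since `gap` admits positive numbers of steps only, the fan from a dart to itself is a full turn
and not empty. This decides what `turn` means when a path turns back on itself. -/
lemma fan_self (x : T.graph.Dart) : T.fan x x = T.dartsAt x.fst := by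
  ext z
  rw [mem_fan_self, mem_dartsAt]

lemma sum_fan_split {A : Type*} [AddCommMonoid A] (f : T.graph.Dart → A) {x y z : T.graph.Dart}
    (h : x.fst = y.fst) (hz : z ∈ T.fan x y) (hne : z ≠ x) :
    ∑ e ∈ T.fan x y, f e = ∑ e ∈ T.fan x z, f e + ∑ e ∈ T.fan z y, f e := by
  obtain ⟨j, hj, rfl⟩ := mem_fan.1 hz
  have hj0 : 0 < j := by
    rcases Nat.eq_zero_or_pos j with rfl | h0
    · exact absurd rfl hne
    · exact h0
  have hle := gap_le_self h
  have h1 : T.gap x ((T.rot ^ j) x) = j := by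
    simpa using gap_pow (d := x) (p := 0) (q := j) hj0 (by omega)
  have h2 : T.gap ((T.rot ^ j) x) y = T.gap x y - j := by
    have := gap_pow (d := x) (p := j) (q := T.gap x y) hj hle
    rwa [pow_gap h] at this
  rw [sum_fan f h, sum_fan f (by simp [pow_rot_fst]), sum_fan f (by simp [pow_rot_fst, h]), h1, h2]
  conv_lhs => rw [← Nat.add_sub_cancel' hj.le, Finset.sum_range_add]
  congr 1
  refine Finset.sum_congr rfl fun i _ => ?_
  rw [add_comm, pow_add, Equiv.Perm.mul_apply]

lemma sum_fan_add_sum_fan {A : Type*} [AddCommMonoid A] (f : T.graph.Dart → A)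
    {x y : T.graph.Dart} (h : x.fst = y.fst) (hne : x ≠ y) :
    ∑ e ∈ T.fan x y, f e + ∑ e ∈ T.fan y x, f e = ∑ e ∈ T.dartsAt x.fst, f e := by
  rw [← fan_self, sum_fan_split f rfl (mem_fan_self.2 h.symm) hne.symm]

/-- The two fans partition the star of the vertex. Membership is obtained from additivity of sums
over fans, applied to the indicator of `z`. -/
lemma mem_fan_or {x y z : T.graph.Dart} (h : x.fst = y.fst) (hne : x ≠ y) (hz : z.fst = x.fst) :
    z ∈ T.fan x y ∨ z ∈ T.fan y x := by
  classical
  by_contra! hc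
  have := sum_fan_add_sum_fan (fun e => if e = z then 1 else 0) h hne
  rw [Finset.sum_ite_eq', Finset.sum_ite_eq', Finset.sum_ite_eq'] at this
  simp [hc.1, hc.2, hz] at this

lemma rot_mem_fan {x y z : T.graph.Dart} (h : x.fst = y.fst) (hz : z ∈ T.fan x y)
    (hne : T.rot z ≠ y) : T.rot z ∈ T.fan x y := by
  obtain ⟨j, hj, rfl⟩ := mem_fan.1 hz
  refine mem_fan.2 ⟨j + 1, ?_, by rw [pow_succ', Equiv.Perm.mul_apply]⟩
  by_contra hlt
  have : j + 1 = T.gap x y := by omega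
  apply hne
  rw [← Equiv.Perm.mul_apply, ← pow_succ', this, pow_gap h]

lemma fan_trans_mem {x y z w : T.graph.Dart} (h : x.fst = y.fst) (hz : z ∈ T.fan x y)
    (hne : z ≠ x) : w ∈ T.fan x y ↔ w ∈ T.fan x z ∨ w ∈ T.fan z y := by
  classical
  have := sum_fan_split (fun e => if e = w then 1 else 0) h hz hne
  rw [Finset.sum_ite_eq', Finset.sum_ite_eq', Finset.sum_ite_eq'] at this
  by_cases h1 : w ∈ T.fan x y <;> by_cases h2 : w ∈ T.fan x z <;> by_cases h3 : w ∈ T.fan z y <;>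
    simp_all

/-! ### Faces and regions -/

variable (T) in
/-- The permutation of the darts whose cycles are the faces. -/
def facePerm : Equiv.Perm T.graph.Dart :=
  (⟨SimpleGraph.Dart.symm, SimpleGraph.Dart.symm, SimpleGraph.Dart.symm_symm,
    SimpleGraph.Dart.symm_symm⟩ : Equiv.Perm T.graph.Dart).trans T.rot.symm

lemma facePerm_apply (d : T.graph.Dart) : T.facePerm d = T.faceNext d := rfl

lemma rot_faceNext (d : T.graph.Dart) : T.rot (T.faceNext d) = d.symm :=
  Equiv.apply_symm_apply _ _

lemma faceNext_symm_rot (d : T.graph.Dart) : T.faceNext (T.rot d).symm = d := by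
  simp [EmbeddedGraph.faceNext]

lemma faceNext_fst (d : T.graph.Dart) : (T.faceNext d).fst = d.snd :=
  T.rot_symm_fst d.symm

lemma faceNext_injective : Function.Injective T.faceNext := T.facePerm.injective

lemma mem_face_iff {d e : T.graph.Dart} : e ∈ T.face d ↔ T.facePerm.SameCycle d e := by
  constructor
  · intro h
    induction h with
    | rel x y h => exact ⟨1, by rw [zpow_one]; exact h.symm⟩
    | refl x => exact Equiv.Perm.SameCycle.refl _ _
    | symm x y _ ih => exact ih.symm
    | trans x y z _ _ h1 h2 => exact h1.trans h2
  · rintro ⟨k, rfl⟩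
    have hn : ∀ n : ℕ, ∀ d, (T.facePerm ^ n) d ∈ T.face d := by
      intro n d
      induction n with
      | zero => exact .refl d
      | succ n ih =>
        exact .trans _ _ _ ih (.rel _ _ (by rw [pow_succ', Equiv.Perm.mul_apply]; rfl))
    obtain ⟨n, rfl | rfl⟩ := k.eq_nat_or_neg
    · simpa using hn n d
    · have := hn n ((T.facePerm ^ (-(n : ℤ))) d)
      rw [zpow_neg, zpow_natCast, ← Equiv.Perm.mul_apply, mul_inv_cancel, Equiv.Perm.one_apply] at this
      rw [zpow_neg, zpow_natCast]
      exact .symm _ _ this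

lemma mem_face_self (d : T.graph.Dart) : d ∈ T.face d := .refl d

lemma faceNext_mem_face {d e : T.graph.Dart} (h : e ∈ T.face d) : T.faceNext e ∈ T.face d :=
  .trans _ _ _ h (.rel _ _ rfl)

lemma face_eq_of_mem {d e : T.graph.Dart} (h : e ∈ T.face d) : T.face e = T.face d := by
  ext z
  exact ⟨fun hz => .trans _ _ _ h hz, fun hz => .trans _ _ _ (.symm _ _ h) hz⟩

lemma faceNext_mem_exterior {d : T.graph.Dart} : T.faceNext d ∈ T.exterior ↔ d ∈ T.exterior := by
  refine ⟨fun h => .trans _ _ _ h (.symm _ _ (.rel _ _ rfl)), faceNext_mem_face⟩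

lemma root_symm_mem_exterior : T.root.symm ∈ T.exterior := mem_face_self _

/-- The face has three darts. No dart is its own successor, because the graph has no loops, and a
2-cycle would leave only two darts; so the first three iterates exhaust the face and the next one
can only be `d`. -/
lemma faceNext_three {d : T.graph.Dart} (h : d ∉ T.exterior) :
    T.faceNext (T.faceNext (T.faceNext d)) = d := by
  have h3 := T.triangular d h
  have hfin : (T.face d).Finite := Set.finite_of_ncard_ne_zero (by omega)
  set f := T.faceNext with hf
  have hne : ∀ x : T.graph.Dart, f x ≠ x := by
    intro x hx
    have := faceNext_fst x
    rw [← hf, hx] at this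
    exact x.adj.ne this
  have h2 : f (f d) ≠ d := by
    intro h2
    have hsub : T.face d ⊆ {d, f d} := by
      intro e he
      rw [mem_face_iff] at he
      obtain ⟨k, rfl⟩ := he
      have hn : ∀ n : ℕ, (T.facePerm ^ n) d = d ∨ (T.facePerm ^ n) d = f d := by
        intro n
        induction n with
        | zero => left; rfl
        | succ n ih =>
          rw [pow_succ', Equiv.Perm.mul_apply]
          rcases ih with ih | ih <;> rw [ih, facePerm_apply]
          · right; rfl
          · left; exact h2
      obtain ⟨n, rfl | rfl⟩ := k.eq_nat_or_neg
      · simpa using hn n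
      · rw [zpow_neg, zpow_natCast]
        have h1 : (T.facePerm ^ n) d = d ∨ (T.facePerm ^ n) (f d) = d := by
          rcases hn n with h | h
          · exact .inl h
          · right
            have : (T.facePerm ^ n) (T.facePerm d) = T.facePerm ((T.facePerm ^ n) d) := by
              rw [← Equiv.Perm.mul_apply, ← pow_succ, pow_succ', Equiv.Perm.mul_apply]
            rw [facePerm_apply] at this
            rw [this, h]
            exact h2
        rcases h1 with h1 | h1
        · left; rw [Equiv.Perm.inv_eq_iff_eq, h1]
        · right; rw [Set.mem_singleton_iff, Equiv.Perm.inv_eq_iff_eq, h1]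
    have := Set.ncard_le_ncard hsub
    have : ({d, f d} : Set T.graph.Dart).ncard ≤ 2 := by
      have := Set.ncard_insert_le d {f d}
      rwa [Set.ncard_singleton] at this
    omega
  have hsub : ({d, f d, f (f d)} : Set T.graph.Dart) ⊆ T.face d := by
    rintro x (rfl | rfl | rfl)
    · exact mem_face_self _
    · exact faceNext_mem_face (mem_face_self _)
    · exact faceNext_mem_face (faceNext_mem_face (mem_face_self _))
  have hc : ({d, f d, f (f d)} : Set T.graph.Dart).ncard = 3 :=
    Set.ncard_eq_three.2 ⟨_, _, _, (hne d).symm, h2.symm, (hne (f d)).symm, rfl⟩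
  have heq := Set.eq_of_subset_of_ncard_le hsub (by omega) hfin
  have hm : f (f (f d)) ∈ T.face d :=
    faceNext_mem_face (faceNext_mem_face (faceNext_mem_face (mem_face_self _)))
  rw [← heq] at hm
  rcases hm with h | h | h
  · exact h
  · exact absurd (faceNext_injective h) h2
  · exact absurd h (hne _)

lemma face_eq_of_notMem_exterior {d : T.graph.Dart} (h : d ∉ T.exterior) :
    T.face d = {d, T.faceNext d, T.faceNext (T.faceNext d)} := by
  have h3 := T.triangular d h
  have hfin : (T.face d).Finite := Set.finite_of_ncard_ne_zero (by omega)
  symm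
  have hne : ∀ x : T.graph.Dart, T.faceNext x ≠ x := by
    intro x hx
    have := faceNext_fst x
    rw [hx] at this
    exact x.adj.ne this
  refine Set.eq_of_subset_of_ncard_le ?_ ?_ hfin
  · rintro x (rfl | rfl | rfl)
    · exact mem_face_self _
    · exact faceNext_mem_face (mem_face_self _)
    · exact faceNext_mem_face (faceNext_mem_face (mem_face_self _))
  · rw [h3, Set.ncard_eq_three.2 ⟨_, _, _, (hne d).symm, ?_, (hne (T.faceNext d)).symm, rfl⟩]
    intro h2
    have := faceNext_three h
    rw [← h2] at this
    exact hne _ this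

variable (T) in
lemma sameRegion_refl (F : Set (Sym2 V)) (d : T.graph.Dart) : T.SameRegion F d d := .refl d

lemma _root_.EmbeddedGraph.SameRegion.symm {M : EmbeddedGraph V} {F : Set (Sym2 V)}
    {d e : M.graph.Dart} (h : M.SameRegion F d e) : M.SameRegion F e d := Relation.EqvGen.symm _ _ h

lemma _root_.EmbeddedGraph.SameRegion.trans {M : EmbeddedGraph V} {F : Set (Sym2 V)}
    {d e f : M.graph.Dart} (h : M.SameRegion F d e) (h' : M.SameRegion F e f) :
    M.SameRegion F d f := Relation.EqvGen.trans _ _ _ h h'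

lemma sameRegion_faceNext (F : Set (Sym2 V)) (d : T.graph.Dart) :
    T.SameRegion F d (T.faceNext d) := .rel _ _ (.inl rfl)

lemma sameRegion_symm {F : Set (Sym2 V)} {d : T.graph.Dart} (h : d.edge ∉ F) :
    T.SameRegion F d d.symm := .rel _ _ (.inr ⟨rfl, h⟩)

/-- `(T.rot d).symm` precedes `d` on the face to the left of `d`. Hence a rotation by one step is a
move inside a face followed by the crossing of an edge. -/
lemma sameRegion_rot_symm (F : Set (Sym2 V)) (d : T.graph.Dart) :
    T.SameRegion F d (T.rot d).symm := by
  have := sameRegion_faceNext F (T.rot d).symm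
  rw [faceNext_symm_rot] at this
  exact this.symm

lemma sameRegion_rot {F : Set (Sym2 V)} {d : T.graph.Dart} (h : (T.rot d).edge ∉ F) :
    T.SameRegion F d (T.rot d) :=
  (sameRegion_rot_symm F d).trans (sameRegion_symm h).symm

lemma sameRegion_of_mem_face (F : Set (Sym2 V)) {d e : T.graph.Dart} (h : e ∈ T.face d) :
    T.SameRegion F d e :=
  Relation.EqvGen.mono (fun _ _ h => Or.inl h) _ _ h

lemma sameRegion_of_exterior (F : Set (Sym2 V)) {d e : T.graph.Dart} (hd : d ∈ T.exterior)
    (he : e ∈ T.exterior) : T.SameRegion F d e :=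
  (sameRegion_of_mem_face F hd).symm.trans (sameRegion_of_mem_face F he)

/-- A set of darts that is closed under region steps contains every region it meets. -/
lemma mem_of_sameRegion {F : Set (Sym2 V)} {A : Set T.graph.Dart}
    (hf : ∀ d, d ∈ A ↔ T.faceNext d ∈ A) (hs : ∀ d, d.edge ∉ F → d ∈ A → d.symm ∈ A)
    {d e : T.graph.Dart} (h : T.SameRegion F d e) : d ∈ A ↔ e ∈ A := by
  induction h with
  | rel x y h =>
    rcases h with rfl | ⟨rfl, h⟩
    · exact hf x
    · refine ⟨hs x h, fun h' => ?_⟩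
      have := hs x.symm (by rwa [SimpleGraph.Dart.edge_symm]) h'
      rwa [SimpleGraph.Dart.symm_symm] at this
  | refl => exact Iff.rfl
  | symm _ _ _ ih => exact ih.symm
  | trans _ _ _ _ _ h1 h2 => exact h1.trans h2

lemma sameRegion_of_mem_fan {F : Set (Sym2 V)} {x y : T.graph.Dart} (h : x.fst = y.fst)
    (hF : ∀ z ∈ T.fan x y, z ≠ x → z.edge ∉ F) : ∀ z ∈ T.fan x y, T.SameRegion F x z :=
  fan_induction h (T.sameRegion_refl F x) fun _ _ h1 h2 hz =>
    hz.trans (sameRegion_rot (hF _ h1 h2))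

lemma sameRegion_fan_symm {F : Set (Sym2 V)} {x y : T.graph.Dart} (h : x.fst = y.fst)
    (hF : ∀ z ∈ T.fan x y, z ≠ x → z.edge ∉ F) : T.SameRegion F x y.symm := by
  have := (sameRegion_of_mem_fan h hF _ (rot_symm_mem_fan h)).trans (sameRegion_rot_symm F _)
  rwa [Equiv.apply_symm_apply] at this

lemma sameRegion_of_fst_eq {F : Set (Sym2 V)} {x y : T.graph.Dart} (h : x.fst = y.fst)
    (hF : ∀ z : T.graph.Dart, z.fst = x.fst → z.edge ∉ F) : T.SameRegion F x y :=
  sameRegion_of_mem_fan rfl (fun z hz _ => hF z (fst_of_mem_fan hz)) y (mem_fan_self.2 h.symm)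

end InfiniteTriangulation

namespace InfiniteTriangulation

variable {V : Type*} {T : InfiniteTriangulation V}

/-! ### Segments and cycles as lists of darts -/

/-- The darts of `l` form a walk from `u` to `v`. -/
def IsSeg {G : SimpleGraph V} : V → List G.Dart → V → Prop
  | u, [], v => u = v
  | u, a :: l, v => a.fst = u ∧ IsSeg a.snd l v

section Seg

variable {G : SimpleGraph V} {u v w : V} {l l' : List G.Dart} {a : G.Dart}

@[simp] lemma isSeg_nil : IsSeg u ([] : List G.Dart) v ↔ u = v := Iff.rfl

@[simp] lemma isSeg_cons : IsSeg u (a :: l) v ↔ a.fst = u ∧ IsSeg a.snd l v := Iff.rfl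

lemma isSeg_append : IsSeg u (l ++ l') v ↔ ∃ w, IsSeg u l w ∧ IsSeg w l' v := by
  induction l generalizing u with
  | nil => simp
  | cons a l ih => simp [ih, and_assoc]

lemma IsSeg.append (h : IsSeg u l v) (h' : IsSeg v l' w) : IsSeg u (l ++ l') w :=
  isSeg_append.2 ⟨v, h, h'⟩

lemma IsSeg.fst_head (h : IsSeg u l v) (hl : l ≠ []) : (l.head hl).fst = u := by
  cases l with
  | nil => exact absurd rfl hl
  | cons a l => exact h.1

lemma IsSeg.snd_getLast (h : IsSeg u l v) (hl : l ≠ []) : (l.getLast hl).snd = v := by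
  induction l generalizing u with
  | nil => exact absurd rfl hl
  | cons a l ih =>
    cases l with
    | nil => exact h.2
    | cons b l => exact ih h.2 (by simp)

lemma IsSeg.snd_mem (h : IsSeg u l v) {z : G.Dart} (hz : z ∈ l) :
    z.snd = v ∨ ∃ y ∈ l, y.fst = z.snd := by
  induction l generalizing u with
  | nil => simp at hz
  | cons a l ih =>
    rcases List.mem_cons.1 hz with rfl | hz
    · cases l with
      | nil => exact .inl h.2
      | cons b l => exact .inr ⟨b, by simp, h.2.1⟩
    · exact (ih h.2 hz).imp id fun ⟨y, hy, h⟩ => ⟨y, by simp [hy], h⟩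

/-- The reversed walk. -/
def rev (l : List G.Dart) : List G.Dart := (l.map SimpleGraph.Dart.symm).reverse

@[simp] lemma mem_rev : a ∈ rev l ↔ a.symm ∈ l := by
  simp only [rev, List.mem_reverse, List.mem_map]
  exact ⟨by rintro ⟨b, hb, rfl⟩; simpa using hb, fun h => ⟨_, h, by simp⟩⟩

@[simp] lemma length_rev : (rev l).length = l.length := by simp [rev]

@[simp] lemma rev_nil : rev ([] : List G.Dart) = [] := rfl

lemma rev_cons : rev (a :: l) = rev l ++ [a.symm] := by simp [rev]

lemma rev_append : rev (l ++ l') = rev l' ++ rev l := by simp [rev]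

lemma map_fst_rev : (rev l).map (fun d => d.fst) = (l.map fun d => d.snd).reverse := by
  simp [rev, Function.comp_def]

lemma IsSeg.rev (h : IsSeg u l v) : IsSeg v (rev l) u := by
  induction l generalizing u with
  | nil => exact h.symm
  | cons a l ih =>
    rw [rev_cons]
    exact (ih h.2).append ⟨rfl, h.1⟩

lemma IsSeg.map_snd_perm (h : IsSeg u l v) :
    (u :: l.map fun d => d.snd) = (l.map fun d => d.fst) ++ [v] := by
  induction l generalizing u with
  | nil => simpa using h
  | cons a l ih =>
    have := ih h.2
    simp only [List.map_cons, List.cons_append]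
    rw [this, h.1]

lemma isSeg_darts {u v : V} (p : G.Walk u v) : IsSeg u p.darts v := by
  induction p with
  | nil => rfl
  | cons h p ih => exact ⟨rfl, ih⟩

lemma IsSeg.isChain (h : IsSeg u l v) : l.IsChain G.DartAdj := by
  induction l generalizing u with
  | nil => exact .nil
  | cons a l ih =>
    cases l with
    | nil => exact .singleton a
    | cons b l => exact .cons_cons h.2.1.symm (ih h.2)

/-- The darts of `l` form a simple cycle. -/
structure IsCyc (l : List G.Dart) : Prop where
  three_le : 3 ≤ l.length
  nodup : (l.map fun d => d.fst).Nodup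
  seg : ∃ u, IsSeg u l u

lemma IsCyc.ne_nil (h : IsCyc l) : l ≠ [] := by
  rintro rfl
  have := h.three_le
  simp at this

lemma IsCyc.rotate (h : IsCyc (l ++ l')) : IsCyc (l' ++ l) := by
  obtain ⟨u, hu⟩ := h.seg
  obtain ⟨w, h1, h2⟩ := isSeg_append.1 hu
  refine ⟨?_, ?_, w, h2.append h1⟩
  · have := h.three_le
    simp only [List.length_append] at *
    omega
  · have := h.nodup
    rw [List.map_append] at *
    exact List.nodup_append_comm.1 this

lemma IsCyc.rev (h : IsCyc l) : IsCyc (rev l) := by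
  obtain ⟨u, hu⟩ := h.seg
  refine ⟨by simpa using h.three_le, ?_, u, hu.rev⟩
  rw [map_fst_rev, List.nodup_reverse]
  have h1 := hu.map_snd_perm
  have h2 : ((l.map fun d => d.fst) ++ [u]).Perm (u :: l.map fun d => d.fst) :=
    List.perm_append_singleton _ _
  rw [← h1] at h2
  exact (List.perm_cons u |>.1 h2).nodup_iff.2 h.nodup

lemma IsCyc.eq_of_fst_eq (h : IsCyc l) {a b : G.Dart} (ha : a ∈ l) (hb : b ∈ l)
    (hab : a.fst = b.fst) : a = b :=
  List.inj_on_of_nodup_map h.nodup ha hb hab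

lemma IsCyc.eq_of_snd_eq (h : IsCyc l) {a b : G.Dart} (ha : a ∈ l) (hb : b ∈ l)
    (hab : a.snd = b.snd) : a = b := by
  have := h.rev.eq_of_fst_eq (a := a.symm) (b := b.symm) (by simpa) (by simpa) hab
  simpa using congrArg SimpleGraph.Dart.symm this

lemma IsCyc.exists_next (h : IsCyc l) (ha : a ∈ l) : ∃ b ∈ l, b.fst = a.snd := by
  obtain ⟨u, hu⟩ := h.seg
  rcases hu.snd_mem ha with h1 | h1
  · exact ⟨l.head h.ne_nil, List.head_mem _, by rw [hu.fst_head, h1]⟩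
  · exact h1

lemma IsCyc.exists_prev (h : IsCyc l) (ha : a ∈ l) : ∃ b ∈ l, b.snd = a.fst := by
  obtain ⟨b, hb, h'⟩ := h.rev.exists_next (a := a.symm) (by simpa)
  exact ⟨b.symm, mem_rev.1 hb, h'⟩

/-- After a rotation of the list `a` comes first, and its reverse, having the right tail, must come
second. A third dart exists and would again start at the tail of `a`. -/
lemma IsCyc.symm_notMem (h : IsCyc l) (ha : a ∈ l) : a.symm ∉ l := by
  intro ha'
  obtain ⟨s, t, rfl⟩ := List.append_of_mem ha
  have h1 := h.rotate
  have hm : a.symm ∈ t ++ s := by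
    simp only [List.mem_append, List.mem_cons] at ha' ⊢
    rcases ha' with h | h | h
    · exact .inr h
    · exact absurd h (a.symm_ne)
    · exact .inl h
  have h2 : a.symm ∈ a :: t ++ s := by
    rw [List.cons_append]
    exact List.mem_cons_of_mem _ hm
  obtain ⟨u, hu⟩ := h1.seg
  rw [List.cons_append, isSeg_cons] at hu
  have h3 := h1.three_le
  obtain ⟨c, r, hr⟩ : ∃ c r, t ++ s = c :: r := List.exists_cons_of_ne_nil (by
    rintro h0; rw [h0] at hm; simp at hm)
  have hc : c = a.symm := h1.eq_of_fst_eq (by simp [hr]) h2 (by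
    have := hu.2; rw [hr] at this; exact this.1)
  rw [List.cons_append, hr, hc] at h1 h3
  obtain ⟨u', hu'⟩ := h1.seg
  obtain ⟨e, r', rfl⟩ : ∃ e r', r = e :: r' := List.exists_cons_of_ne_nil (by
    rintro rfl; simp at h3)
  have he : e.fst = a.fst := hu'.2.2.1
  have := h1.nodup
  simp [he] at this

/-- The edges of a list of darts. -/
def edgesOf (l : List G.Dart) : Set (Sym2 V) := {e | ∃ d ∈ l, d.edge = e}

lemma edge_mem_edgesOf : a.edge ∈ edgesOf l ↔ a ∈ l ∨ a.symm ∈ l := by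
  constructor
  · rintro ⟨d, hd, h⟩
    rcases SimpleGraph.dart_edge_eq_iff d a |>.1 h with rfl | rfl
    · exact .inl hd
    · right; simpa using hd
  · rintro (h | h)
    · exact ⟨a, h, rfl⟩
    · exact ⟨_, h, SimpleGraph.Dart.edge_symm a⟩

lemma edgesOf_rev : edgesOf (rev l) = edgesOf l := by
  ext e
  constructor
  · rintro ⟨d, hd, rfl⟩
    exact ⟨d.symm, mem_rev.1 hd, SimpleGraph.Dart.edge_symm d⟩
  · rintro ⟨d, hd, rfl⟩
    exact ⟨d.symm, by simpa using hd, SimpleGraph.Dart.edge_symm d⟩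

lemma edgesOf_congr (h : ∀ d, d ∈ l ↔ d ∈ l') : edgesOf l = edgesOf l' := by
  simp only [edgesOf, h]

/-- The link to Mathlib's cycles, in terms of which planarity is stated. -/
lemma IsCyc.exists_walk (h : IsCyc l) : ∃ (v : V) (p : G.Walk v v), p.IsCycle ∧ p.darts = l := by
  obtain ⟨u, hu⟩ := h.seg
  have hc := hu.isChain
  have hd := SimpleGraph.Walk.darts_ofDarts h.ne_nil hc
  have e1 : (l.head h.ne_nil).fst = u := hu.fst_head _
  have e2 : (l.getLast h.ne_nil).snd = u := hu.snd_getLast _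
  refine ⟨u, (SimpleGraph.Walk.ofDarts l h.ne_nil hc).copy e1 e2, ?_, by simpa using hd⟩
  rw [SimpleGraph.Walk.isCycle_iff_isPath_tail_and_le_length]
  refine ⟨?_, by simpa using h.three_le⟩
  set p := (SimpleGraph.Walk.ofDarts l h.ne_nil hc).copy e1 e2 with hp
  have hd' : p.darts = l := by simpa [hp] using hd
  have hn : ¬ p.Nil := by
    rw [← SimpleGraph.Walk.darts_eq_nil, hd']
    exact h.ne_nil
  rw [SimpleGraph.Walk.isPath_def, SimpleGraph.Walk.support_tail_of_not_nil _ hn,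
    ← SimpleGraph.Walk.map_snd_darts, hd']
  have := h.rev.nodup
  rwa [map_fst_rev, List.nodup_reverse] at this

lemma edges_eq_edgesOf {u v : V} (p : G.Walk u v) : {e | e ∈ p.edges} = edgesOf p.darts := by
  ext e
  simp [SimpleGraph.Walk.edges, edgesOf]

end Seg

/-! ### The two sides of a cycle -/

variable (T) in
/-- The darts whose left face lies to the left of the cycle `l`. -/
def left (l : List T.graph.Dart) : Set T.graph.Dart :=
  {z | ∃ d ∈ l, T.SameRegion (edgesOf l) d z}

variable (T) in
/-- The darts whose left face lies to the right of the cycle `l`. -/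
def right (l : List T.graph.Dart) : Set T.graph.Dart :=
  {z | ∃ d ∈ l, T.SameRegion (edgesOf l) d.symm z}

variable {l l' : List T.graph.Dart}

lemma left_rev : T.left (rev l) = T.right l := by
  ext z
  constructor
  · rintro ⟨d, hd, h⟩
    rw [edgesOf_rev] at h
    exact ⟨d.symm, mem_rev.1 hd, by simpa using h⟩
  · rintro ⟨d, hd, h⟩
    exact ⟨d.symm, by simpa using hd, by rwa [edgesOf_rev]⟩

lemma left_congr (h : ∀ d, d ∈ l ↔ d ∈ l') : T.left l = T.left l' := by
  simp only [left, edgesOf_congr h, h]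

/-- At a vertex of a simple cycle only two darts carry edges of the cycle. So the two fans between
them are free of crossings, and each lies in one region. -/
lemma IsCyc.notMem_edges_of_mem_fan (h : IsCyc l) {d d' z : T.graph.Dart} (hd : d ∈ l)
    (hd' : d' ∈ l) (hdd : d.snd = d'.fst) (hz : z.fst = d'.fst) (h1 : z ≠ d') (h2 : z ≠ d.symm) :
    z.edge ∉ edgesOf l := by
  rw [edge_mem_edgesOf]
  rintro (h3 | h3)
  · exact h1 (h.eq_of_fst_eq h3 hd' hz)
  · apply h2
    have := h.eq_of_snd_eq h3 hd (by rw [hdd]; exact hz)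
    rw [← this, SimpleGraph.Dart.symm_symm]

lemma IsCyc.ne_symm (h : IsCyc l) {d d' : T.graph.Dart} (hd : d ∈ l) (hd' : d' ∈ l) :
    d' ≠ d.symm := by
  rintro rfl
  exact h.symm_notMem hd hd'

lemma IsCyc.sameRegion_left_fan (h : IsCyc l) {d d' z : T.graph.Dart} (hd : d ∈ l)
    (hd' : d' ∈ l) (hdd : d.snd = d'.fst) (hz : z ∈ T.fan d' d.symm) :
    T.SameRegion (edgesOf l) d' z := by
  have hf : d'.fst = d.symm.fst := hdd.symm
  refine sameRegion_of_mem_fan hf (fun y hy hne => ?_) z hz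
  refine h.notMem_edges_of_mem_fan hd hd' hdd (fst_of_mem_fan hy) hne ?_
  rintro rfl
  exact right_notMem_fan hf (h.ne_symm hd hd') hy

lemma IsCyc.sameRegion_next (h : IsCyc l) {d d' : T.graph.Dart} (hd : d ∈ l)
    (hd' : d' ∈ l) (hdd : d.snd = d'.fst) : T.SameRegion (edgesOf l) d d' := by
  have hf : d'.fst = d.symm.fst := hdd.symm
  have h1 := h.sameRegion_left_fan hd hd' hdd (rot_symm_mem_fan hf)
  have h2 := sameRegion_rot_symm (edgesOf l) (T.rot.symm d.symm)
  rw [Equiv.apply_symm_apply, SimpleGraph.Dart.symm_symm] at h2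
  exact (h1.trans h2).symm

lemma IsSeg.sameRegion {u v : V} {F : Set (Sym2 V)} {m : List T.graph.Dart} (hs : IsSeg u m v)
    (h : ∀ d ∈ m, ∀ d' ∈ m, d.snd = d'.fst → T.SameRegion F d d') (hm : m ≠ []) :
    ∀ d ∈ m, T.SameRegion F (m.head hm) d := by
  induction m generalizing u with
  | nil => exact absurd rfl hm
  | cons a m ih =>
    intro d hd
    rcases List.mem_cons.1 hd with rfl | hd
    · exact T.sameRegion_refl F _
    · have hne : m ≠ [] := List.ne_nil_of_mem hd
      exact (h a (by simp) _ (List.mem_cons_of_mem _ (List.head_mem hne))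
        (hs.2.fst_head hne).symm).trans
        (ih hs.2 (fun d hd d' hd' => h d (by simp [hd]) d' (by simp [hd'])) hne d hd)

lemma IsCyc.sameRegion (h : IsCyc l) {d d' : T.graph.Dart} (hd : d ∈ l) (hd' : d' ∈ l) :
    T.SameRegion (edgesOf l) d d' := by
  obtain ⟨u, hu⟩ := h.seg
  have := hu.sameRegion (fun d hd d' hd' => h.sameRegion_next hd hd') h.ne_nil
  exact (this d hd).symm.trans (this d' hd')

lemma IsCyc.sameRegion_symm (h : IsCyc l) {d d' : T.graph.Dart} (hd : d ∈ l) (hd' : d' ∈ l) :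
    T.SameRegion (edgesOf l) d.symm d'.symm := by
  have := h.rev.sameRegion (d := d.symm) (d' := d'.symm) (by simpa) (by simpa)
  rwa [edgesOf_rev] at this

lemma IsCyc.mem_left_iff (h : IsCyc l) {d z : T.graph.Dart} (hd : d ∈ l) :
    z ∈ T.left l ↔ T.SameRegion (edgesOf l) d z :=
  ⟨fun ⟨_, he, hz⟩ => (h.sameRegion hd he).trans hz, fun hz => ⟨d, hd, hz⟩⟩

lemma IsCyc.mem_right_iff (h : IsCyc l) {d z : T.graph.Dart} (hd : d ∈ l) :
    z ∈ T.right l ↔ T.SameRegion (edgesOf l) d.symm z :=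
  ⟨fun ⟨_, he, hz⟩ => (h.sameRegion_symm hd he).trans hz, fun hz => ⟨d, hd, hz⟩⟩

lemma mem_left {d : T.graph.Dart} (hd : d ∈ l) : d ∈ T.left l := ⟨d, hd, T.sameRegion_refl _ _⟩

lemma symm_mem_right {d : T.graph.Dart} (hd : d ∈ l) : d.symm ∈ T.right l :=
  ⟨d, hd, T.sameRegion_refl _ _⟩

lemma left_of_sameRegion {d e : T.graph.Dart} (hd : d ∈ T.left l)
    (h : T.SameRegion (edgesOf l) d e) : e ∈ T.left l :=
  let ⟨c, hc, h'⟩ := hd; ⟨c, hc, h'.trans h⟩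

lemma right_of_sameRegion {d e : T.graph.Dart} (hd : d ∈ T.right l)
    (h : T.SameRegion (edgesOf l) d e) : e ∈ T.right l :=
  let ⟨c, hc, h'⟩ := hd; ⟨c, hc, h'.trans h⟩

lemma faceNext_mem_left {d : T.graph.Dart} : d ∈ T.left l ↔ T.faceNext d ∈ T.left l :=
  ⟨fun h => left_of_sameRegion h (sameRegion_faceNext _ _),
    fun h => left_of_sameRegion h (sameRegion_faceNext _ _).symm⟩

lemma faceNext_mem_right {d : T.graph.Dart} : d ∈ T.right l ↔ T.faceNext d ∈ T.right l :=
  ⟨fun h => right_of_sameRegion h (sameRegion_faceNext _ _),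
    fun h => right_of_sameRegion h (sameRegion_faceNext _ _).symm⟩

lemma symm_mem_left {d : T.graph.Dart} (h : d ∈ T.left l) (he : d.edge ∉ edgesOf l) :
    d.symm ∈ T.left l := left_of_sameRegion h (sameRegion_symm he)

lemma symm_mem_right_of_notMem {d : T.graph.Dart} (h : d ∈ T.right l) (he : d.edge ∉ edgesOf l) :
    d.symm ∈ T.right l := right_of_sameRegion h (sameRegion_symm he)

/-- This is where planarity enters. -/
lemma IsCyc.disjoint (h : IsCyc l) {z : T.graph.Dart} (h1 : z ∈ T.left l) : z ∉ T.right l := by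
  intro h2
  obtain ⟨v, p, hp, hd⟩ := h.exists_walk
  have hm := List.head_mem h.ne_nil
  have := T.planar v p hp (l.head h.ne_nil) (by rw [hd]; exact hm)
  rw [edges_eq_edgesOf, hd] at this
  exact this (((h.mem_left_iff hm).1 h1).trans ((h.mem_right_iff hm).1 h2).symm)

/-- Any two darts are joined by rotations and reversals because the graph is connected; a rotation
is itself composed of face steps and reversals. -/
lemma all_of_closed {A : Set T.graph.Dart} (hf : ∀ d, d ∈ A ↔ T.faceNext d ∈ A)
    (hs : ∀ d ∈ A, d.symm ∈ A) {a : T.graph.Dart} (ha : a ∈ A) (z : T.graph.Dart) : z ∈ A := by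
  have key : ∀ d e : T.graph.Dart, d.fst = e.fst → d ∈ A → e ∈ A := by
    intro d e h hd
    exact (mem_of_sameRegion hf (F := ∅) (fun d _ h => hs d h)
      (sameRegion_of_fst_eq h (fun _ _ => by simp))).1 hd
  obtain ⟨p⟩ := T.connected.preconnected a.fst z.fst
  have : ∀ (u v : V) (p : T.graph.Walk u v), (∀ d : T.graph.Dart, d.fst = u → d ∈ A) →
      ∀ d : T.graph.Dart, d.fst = v → d ∈ A := by
    intro u v p
    induction p with
    | nil => exact id
    | cons hadj p ih =>
      intro h
      apply ih
      intro d hd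
      exact key _ d hd.symm (hs _ (h ⟨(_, _), hadj⟩ rfl))
  exact this _ _ p (fun d hd => key a d hd.symm ha) z rfl

/-- The union of the two sides is closed under all moves, as crossing an edge of the cycle only
exchanges the sides. -/
lemma IsCyc.left_or_right (h : IsCyc l) (z : T.graph.Dart) : z ∈ T.left l ∨ z ∈ T.right l := by
  refine all_of_closed (A := T.left l ∪ T.right l) (fun d => ?_) (fun d hd => ?_)
    (.inl (mem_left (List.head_mem h.ne_nil))) z
  · exact or_congr faceNext_mem_left faceNext_mem_right
  · by_cases he : d.edge ∈ edgesOf l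
    · rcases edge_mem_edgesOf.1 he with h1 | h1
      · exact .inr (symm_mem_right h1)
      · exact .inl (mem_left h1)
    · exact hd.imp (symm_mem_left · he) (symm_mem_right_of_notMem · he)

lemma IsCyc.notMem_left_iff (h : IsCyc l) {z : T.graph.Dart} : z ∉ T.left l ↔ z ∈ T.right l :=
  ⟨(h.left_or_right z).resolve_left, fun h1 h2 => h.disjoint h2 h1⟩

/-- An induction principle: the left side is a single region, so it is contained in any set that
meets it and is closed under face steps and under crossing edges off the cycle. -/
lemma IsCyc.left_subset (h : IsCyc l) {A : Set T.graph.Dart} (hf : ∀ d, d ∈ A ↔ T.faceNext d ∈ A)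
    (hs : ∀ d, d.edge ∉ edgesOf l → d ∈ A → d.symm ∈ A) {c : T.graph.Dart} (hc : c ∈ l)
    (hcA : c ∈ A) : T.left l ⊆ A := fun _ hz =>
  (mem_of_sameRegion hf hs ((h.mem_left_iff hc).1 hz)).1 hcA

lemma IsCyc.right_subset (h : IsCyc l) {A : Set T.graph.Dart} (hf : ∀ d, d ∈ A ↔ T.faceNext d ∈ A)
    (hs : ∀ d, d.edge ∉ edgesOf l → d ∈ A → d.symm ∈ A) {c : T.graph.Dart} (hc : c ∈ l)
    (hcA : c.symm ∈ A) : T.right l ⊆ A := fun _ hz =>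
  (mem_of_sameRegion hf hs ((h.mem_right_iff hc).1 hz)).1 hcA

lemma edge_notMem_of_fst (h : ∃ u, IsSeg u l u) {z : T.graph.Dart} (hz : ∀ d ∈ l, d.fst ≠ z.fst) :
    z.edge ∉ edgesOf l := by
  rw [edge_mem_edgesOf]
  rintro (h1 | h1)
  · exact hz _ h1 rfl
  · obtain ⟨u, hu⟩ := h
    rcases hu.snd_mem h1 with h2 | ⟨y, hy, h2⟩
    · have hne : l ≠ [] := List.ne_nil_of_mem h1
      exact hz _ (List.head_mem hne) (by rw [hu.fst_head hne]; exact h2.symm)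
    · exact hz y hy h2

lemma sameRegion_of_off (h : ∃ u, IsSeg u l u) {x y : T.graph.Dart} (hxy : x.fst = y.fst)
    (hx : ∀ d ∈ l, d.fst ≠ x.fst) : T.SameRegion (edgesOf l) x y :=
  sameRegion_of_fst_eq hxy fun z hz => edge_notMem_of_fst h fun d hd => by
    rw [hz]; exact hx d hd

/-- A walk whose tails avoid a closed walk `l` stays in one region. -/
lemma IsSeg.sameRegion_of_off (h : ∃ u, IsSeg u l u) {a b : V} {m : List T.graph.Dart}
    (hm : IsSeg a m b) (hoff : ∀ x ∈ m, ∀ d ∈ l, d.fst ≠ x.fst) {z : T.graph.Dart}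
    (hz : z.fst = a) :
    ∀ x ∈ m, T.SameRegion (edgesOf l) z x ∧ T.SameRegion (edgesOf l) z x.symm := by
  induction m generalizing a z with
  | nil => simp
  | cons c m ih =>
    have h1 : T.SameRegion (edgesOf l) z c :=
      (InfiniteTriangulation.sameRegion_of_off h (hm.1.trans hz.symm) (hoff c (by simp))).symm
    have h2 : T.SameRegion (edgesOf l) c c.symm :=
      sameRegion_symm (edge_notMem_of_fst h (hoff c (by simp)))
    intro x hx
    rcases List.mem_cons.1 hx with rfl | hx
    · exact ⟨h1, h1.trans h2⟩
    · have := ih hm.2 (fun x hx => hoff x (by simp [hx])) (z := c.symm) rfl x hx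
      exact ⟨(h1.trans h2).trans this.1, (h1.trans h2).trans this.2⟩

/-- Every boundary vertex is the tail of just one dart with the exterior face on its left. -/
lemma eq_of_mem_exterior {d e : T.graph.Dart} (hd : d ∈ T.exterior) (he : e ∈ T.exterior)
    (h : d.fst = e.fst) : d = e := by
  by_contra hne
  set v := d.fst with hv
  have hrd : (T.rot d).fst = v := T.rot_fst d
  have hre : (T.rot e).fst = v := (T.rot_fst e).trans h.symm
  have hrne : T.rot d ≠ T.rot e := fun h => hne (T.rot.injective h)
  have hp : (T.rot d).snd ∈ ({v}ᶜ : Set V) := fun h' => (T.rot d).adj.ne (hrd.trans h'.symm)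
  have hq : (T.rot e).snd ∈ ({v}ᶜ : Set V) := fun h' => (T.rot e).adj.ne (hre.trans h'.symm)
  obtain ⟨p, hpp⟩ := ((T.connected_delete v).preconnected ⟨_, hp⟩ ⟨_, hq⟩).exists_isPath
  set ι := (SimpleGraph.Embedding.induce ({v}ᶜ : Set V) (G := T.graph)).toHom
  set m := (p.map ι).darts with hm
  have hseg : IsSeg (T.rot d).snd m (T.rot e).snd := isSeg_darts _
  have hmn : (m.map fun d => d.fst).Nodup ∧ (T.rot e).snd ∉ m.map fun d => d.fst := by
    have h1 := (hpp.map (f := ι) Subtype.val_injective).support_nodup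
    rw [← SimpleGraph.Walk.map_fst_darts_append] at h1
    rw [List.nodup_append] at h1
    refine ⟨h1.1, fun hc => h1.2.2 _ hc _ (List.mem_singleton_self _) rfl⟩
  have hmv : ∀ x ∈ m, x.fst ≠ v := by
    intro x hx hxv
    have := SimpleGraph.Walk.dart_fst_mem_support_of_mem_darts _ hx
    rw [SimpleGraph.Walk.support_map, List.mem_map] at this
    obtain ⟨y, -, hy⟩ := this
    exact y.2 (show (y : V) = v from hy.trans hxv)
  have hsne : (T.rot d).snd ≠ (T.rot e).snd := fun h' => hrne (T.dart_ext (hrd.trans hre.symm) h')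
  have hmne : m ≠ [] := by
    intro h0
    rw [h0] at hseg
    exact hsne hseg
  -- The path `m` avoids `v`, as the graph is 2-connected. The cycle through `v` and `m` separates
  -- the two corners at `v` that follow `d` and `e`, although both belong to the exterior face.
  set c := T.rot d :: (m ++ [(T.rot e).symm]) with hc
  have hcyc : IsCyc c := by
    refine ⟨?_, ?_, v, hrd, hseg.append ⟨rfl, hre⟩⟩
    · have := List.length_pos_of_ne_nil hmne
      simp only [hc, List.length_cons, List.length_append, List.length_nil]
      omega
    · simp only [hc, List.map_cons, List.map_append, List.map_nil, List.nodup_cons,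
        List.nodup_append, List.mem_append, List.mem_singleton, List.mem_map]
      refine ⟨?_, hmn.1, by simp, ?_⟩
      · rintro (⟨x, hx, hxv⟩ | h')
        · exact hmv x hx (hxv.trans hrd)
        · exact hq (h'.symm.trans hrd)
      · rintro _ ⟨x, hx, rfl⟩ _ rfl h'
        exact hmn.2 (List.mem_map.2 ⟨x, hx, h'⟩)
  have hdm : T.rot d ∈ c := by simp [hc]
  have hem : (T.rot e).symm ∈ c := by simp [hc]
  have h1 : e ∈ T.left c := by
    refine left_of_sameRegion (mem_left hem) ?_
    have := sameRegion_rot_symm (edgesOf c) e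
    exact this.symm
  have h2 : d ∈ T.right c := by
    refine right_of_sameRegion (symm_mem_right hdm) ?_
    exact (sameRegion_rot_symm (edgesOf c) d).symm
  exact hcyc.disjoint (left_of_sameRegion h1 (sameRegion_of_exterior _ he hd)) h2

end InfiniteTriangulation

/-- The colour that follows in the cyclic order blue, red, yellow. -/
def Colour.next : Colour → Colour
  | .blue => .red
  | .red => .yellow
  | .yellow => .blue

lemma Colour.next_ne (c : Colour) : c.next ≠ c := by cases c <;> simp [Colour.next]

lemma Colour.eq_or (c c' : Colour) : c' = c ∨ c' = c.next ∨ c = c'.next := by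
  cases c <;> cases c' <;> simp [Colour.next]

namespace InfiniteTriangulation

variable {V : Type*} {T : InfiniteTriangulation V}

/-! ### Prefix sums around a vertex -/

lemma sum_fan_pow (f : T.graph.Dart → ℤ) {d : T.graph.Dart} {p q : ℕ} (hpq : p < q)
    (hq : q ≤ T.gap d d) : ∑ z ∈ T.fan ((T.rot ^ p) d) ((T.rot ^ q) d), f z =
      ∑ k ∈ Finset.range q, f ((T.rot ^ k) d) - ∑ k ∈ Finset.range p, f ((T.rot ^ k) d) := by
  rw [sum_fan f (by simp [pow_rot_fst]), gap_pow hpq hq, eq_sub_iff_add_eq, add_comm]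
  conv_rhs => rw [← Nat.add_sub_cancel' hpq.le, Finset.sum_range_add]
  congr 1
  refine Finset.sum_congr rfl fun i _ => ?_
  rw [add_comm p, pow_add, Equiv.Perm.mul_apply]

lemma sum_fan_pow_of_le (f : T.graph.Dart → ℤ) {d : T.graph.Dart} {p q : ℕ} (hqp : q ≤ p)
    (hp : p < T.gap d d) : ∑ z ∈ T.fan ((T.rot ^ p) d) ((T.rot ^ q) d), f z =
      ∑ k ∈ Finset.range (T.gap d d), f ((T.rot ^ k) d) -
        ∑ k ∈ Finset.range p, f ((T.rot ^ k) d) + ∑ k ∈ Finset.range q, f ((T.rot ^ k) d) := by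
  have hpd : (T.rot ^ (T.gap d d)) d = d := pow_gap rfl
  rcases Nat.eq_zero_or_pos q with rfl | h0
  · have := sum_fan_pow f hp le_rfl
    rw [hpd] at this
    simpa using this
  · have hf : ((T.rot ^ p) d).fst = ((T.rot ^ q) d).fst := by simp [pow_rot_fst]
    have h1 := sum_fan_pow f hp le_rfl
    rw [hpd] at h1
    have h2 := sum_fan_pow f h0 (hqp.trans hp.le)
    rw [pow_zero, Equiv.Perm.one_apply] at h2
    rcases hqp.eq_or_lt with rfl | hlt
    · rw [fan_self, pow_rot_fst, ← fan_self, sum_fan f rfl]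
      ring
    · have h3 := sum_fan_pow f hlt hp.le
      have h4 := sum_fan_add_sum_fan f hf (fun h => by
        have := pow_inj hp (hqp.trans_lt hp) h; omega)
      rw [pow_rot_fst, ← fan_self, sum_fan f rfl] at h4
      linarith

variable (T) in
open Classical in
/-- The number of virtual outgoing edges in the exterior corner of a boundary vertex. -/
noncomputable def virt (v : V) : ℤ := if v = T.vr then 2 else if v = T.vy then 3 else 1

variable (S : ColouredOrientation T.graph)

/-- The indicator of the outgoing darts. -/
def outN (z : T.graph.Dart) : ℤ := if S.out z then 1 else 0

open Classical in
/-- The number of outgoing edges, real or virtual, of the dart `z` and the corner that follows. -/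
noncomputable def weight (z : T.graph.Dart) : ℤ :=
  outN S z + if z ∈ T.exterior then T.virt z.fst else 0

/-- The number of outgoing edges, real or virtual, strictly between `x` and `y`. -/
noncomputable def osum (x y : T.graph.Dart) : ℤ := ∑ z ∈ T.fan x y, weight S z - outN S x

/-- The amount by which one turns left when passing from `d` to `d'`. -/
noncomputable def turn (d d' : T.graph.Dart) : ℤ := 1 - osum S d' d.symm

variable {S}

lemma outN_of_true {z : T.graph.Dart} (h : S.out z = true) : outN S z = 1 := by simp [outN, h]

lemma outN_of_false {z : T.graph.Dart} (h : S.out z = false) : outN S z = 0 := by simp [outN, h]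

lemma out_symm_of_true {z : T.graph.Dart} (h : S.out z = true) : S.out z.symm = false := by
  simp [S.out_symm, h]

lemma out_symm_of_false {z : T.graph.Dart} (h : S.out z = false) : S.out z.symm = true := by
  simp [S.out_symm, h]

lemma outN_symm (z : T.graph.Dart) : outN S z.symm = 1 - outN S z := by
  unfold outN
  rw [S.out_symm]
  cases S.out z <;> simp

lemma outN_nonneg (z : T.graph.Dart) : 0 ≤ outN S z := by
  unfold outN; split_ifs <;> simp

lemma outN_le_one (z : T.graph.Dart) : outN S z ≤ 1 := by
  unfold outN; split_ifs <;> simp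

lemma virt_pos (v : V) : 0 < T.virt v := by unfold virt; split_ifs <;> simp

lemma weight_nonneg (z : T.graph.Dart) : 0 ≤ weight S z := by
  have := outN_nonneg (S := S) z
  have := virt_pos (T := T) z.fst
  unfold weight; split_ifs <;> omega

lemma vy_mem_boundary : T.vy ∈ T.boundary := ⟨_, root_symm_mem_exterior, rfl⟩

lemma vr_mem_boundary : T.vr ∈ T.boundary :=
  ⟨_, faceNext_mem_exterior.2 root_symm_mem_exterior, faceNext_fst _⟩

lemma vr_ne_vy : T.vr ≠ T.vy := T.root.adj.ne

/-- There are no leaves: deleting `d.snd` leaves a connected graph with a further vertex, so `d.fst`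
has another neighbour. -/
lemma exists_dart_ne (d : T.graph.Dart) : ∃ e : T.graph.Dart, e.fst = d.fst ∧ e ≠ d := by
  have := T.infinite
  obtain ⟨u, hu⟩ := Set.Finite.exists_notMem (s := {d.fst, d.snd}) (by simp)
  simp only [Set.mem_insert_iff, Set.mem_singleton_iff, not_or] at hu
  obtain ⟨p⟩ := (T.connected_delete d.snd).preconnected ⟨d.fst, fun h => d.adj.ne h⟩
    ⟨u, fun h => hu.2 h⟩
  cases p with
  | nil => exact absurd rfl hu.1
  | @cons _ x _ h p =>
    refine ⟨⟨(d.fst, x), h⟩, rfl, fun he => ?_⟩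
    have : (x : V) = d.snd := congrArg (fun z : T.graph.Dart => z.snd) he
    exact x.2 this

lemma two_le_gap (d : T.graph.Dart) : 2 ≤ T.gap d d := by
  obtain ⟨e, he, hne⟩ := T.exists_dart_ne d
  obtain ⟨k, hk, hke⟩ := exists_pow_lt he.symm
  have : k ≠ 0 := by rintro rfl; exact hne hke.symm
  omega

/-- The positions of the three outgoing edges, real or virtual, at a vertex. -/
structure LocalSpec (S : ColouredOrientation T.graph) (d : T.graph.Dart) (r y : ℕ) : Prop where
  r_pos : 1 ≤ r
  r_le : r ≤ T.gap d d
  y_pos : 1 ≤ y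
  y_le : y ≤ T.gap d d
  sum : ∀ m ≤ T.gap d d, ∑ k ∈ Finset.range m, weight S ((T.rot ^ k) d) =
    (if r ≤ m then 1 else 0) + (if y ≤ m then 1 else 0) + if T.gap d d ≤ m then 1 else 0
  out_red : ∀ m < T.gap d d, S.out ((T.rot ^ m) d) = true → S.colour ((T.rot ^ m) d) = .red →
    m + 1 = r ∧ r < y
  out_yellow : ∀ m < T.gap d d, S.out ((T.rot ^ m) d) = true →
    S.colour ((T.rot ^ m) d) = .yellow → m + 1 = y ∧ r ≠ y
  out_blue : ∀ m < T.gap d d, S.out ((T.rot ^ m) d) = true → S.colour ((T.rot ^ m) d) = .blue →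
    m + 1 = T.gap d d ∧ r < y ∧ y ≤ m
  in_red : ∀ m < T.gap d d, S.out ((T.rot ^ m) d) = false → S.colour ((T.rot ^ m) d) = .red →
    y ≤ m ∧ (r ≤ y ∨ m < r)
  in_blue : ∀ m < T.gap d d, S.out ((T.rot ^ m) d) = false → S.colour ((T.rot ^ m) d) = .blue →
    r ≤ m ∧ m + 1 < y
  in_yellow : ∀ m < T.gap d d, S.out ((T.rot ^ m) d) = false →
    S.colour ((T.rot ^ m) d) = .yellow → m < r ∧ r ≤ y
  boundary : d.fst ∈ T.boundary → d.symm ∈ T.exterior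
  no_blue : d.fst ∈ T.boundary → ∀ m < T.gap d d, S.out ((T.rot ^ m) d) = true →
    S.colour ((T.rot ^ m) d) ≠ .blue
  regular : d.fst ≠ T.vr → r ≤ y
  ordinary : d.fst ≠ T.vr → d.fst ≠ T.vy → r < y
  at_vr : d.fst = T.vr → r = T.gap d d
  at_vy : d.fst = T.vy → r = T.gap d d ∧ y = T.gap d d

/-- `r = i + 1` and `y = i + j + 2` are one more than the indices of the outgoing red and yellow
darts. The blue outgoing edge always comes last: for `ε = 1`, the interior case, it is a real dart,
and for `ε = 0`, the boundary case, it is the virtual edge in the exterior corner. -/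
lemma localSpec_of_labels {d : T.graph.Dart} {i j k ε : ℕ} (hε : ε ≤ 1)
    (hn : T.gap d d = i + j + k + 2 + ε)
    (hl : ∀ m < T.gap d d, S.label ((T.rot ^ m) d) =
      if m < i then (false, .yellow) else if m = i then (true, .red) else
      if m < i + 1 + j then (false, .blue) else if m = i + 1 + j then (true, .yellow) else
      if m < i + j + k + 2 then (false, .red) else (true, .blue))
    (hext : ∀ m < T.gap d d, (T.rot ^ m) d ∈ T.exterior ↔ m + 1 = T.gap d d ∧ ε = 0)
    (hb : d.fst ∈ T.boundary → d.symm ∈ T.exterior ∧ ε = 0) (hvr : d.fst ≠ T.vr)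
    (hvy : d.fst ≠ T.vy) : LocalSpec S d (i + 1) (i + j + 2) := by
  have hout : ∀ m < T.gap d d, S.out ((T.rot ^ m) d) = true ↔
      m = i ∨ m = i + 1 + j ∨ i + j + k + 2 ≤ m := by
    intro m hm
    have := congrArg Prod.fst (hl m hm)
    simp only [ColouredOrientation.label] at this
    rw [this]
    split_ifs <;> simp <;> omega
  have hc : ∀ m < T.gap d d, S.colour ((T.rot ^ m) d) =
      if m < i then .yellow else if m = i then .red else
      if m < i + 1 + j then .blue else if m = i + 1 + j then .yellow else
      if m < i + j + k + 2 then .red else .blue := by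
    intro m hm
    have := congrArg Prod.snd (hl m hm)
    simp only [ColouredOrientation.label] at this
    rw [this]
    split_ifs <;> rfl
  have hfalse : ∀ m < T.gap d d, S.out ((T.rot ^ m) d) = false →
      ¬ (m = i ∨ m = i + 1 + j ∨ i + j + k + 2 ≤ m) := by
    intro m hm h
    rw [← hout m hm, h]
    simp
  refine ⟨by omega, by omega, by omega, by omega, ?_, ?_, ?_, ?_, ?_, ?_, ?_, fun h => (hb h).1,
    ?_, fun _ => by omega, fun _ _ => by omega, fun h => absurd h hvr, fun h => absurd h hvy⟩
  · intro m hm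
    induction m with
    | zero => simp; omega
    | succ m ih =>
      rw [Finset.sum_range_succ, ih (by omega)]
      have h1 := hout m (by omega)
      have h2 := hext m (by omega)
      have h3 : T.virt ((T.rot ^ m) d).fst = 1 := by
        rw [pow_rot_fst]; simp [virt, hvr, hvy]
      rw [weight, h3, outN]
      simp only [h1, h2]
      split_ifs <;> omega
  · intro m hm h1 h2
    rw [hc m hm] at h2
    rw [hout m hm] at h1
    split_ifs at h2 <;> omega
  · intro m hm h1 h2
    rw [hc m hm] at h2
    rw [hout m hm] at h1
    split_ifs at h2 <;> omega
  · intro m hm h1 h2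
    rw [hc m hm] at h2
    rw [hout m hm] at h1
    split_ifs at h2 <;> omega
  · intro m hm h1 h2
    rw [hc m hm] at h2
    have := hfalse m hm h1
    split_ifs at h2 <;> omega
  · intro m hm h1 h2
    rw [hc m hm] at h2
    have := hfalse m hm h1
    split_ifs at h2 <;> omega
  · intro m hm h1 h2
    rw [hc m hm] at h2
    have := hfalse m hm h1
    split_ifs at h2 <;> omega
  · intro hbd m hm h1 h2
    rw [hc m hm] at h2
    rw [hout m hm] at h1
    have := (hb hbd).2
    split_ifs at h2 <;> omega

lemma symm_rot_mem_exterior {e : T.graph.Dart} (h : e ∈ T.exterior) :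
    (T.rot e).symm ∈ T.exterior := by
  rw [← faceNext_mem_exterior, faceNext_symm_rot]; exact h

lemma rot_symm_mem_exterior {d : T.graph.Dart} (h : d.symm ∈ T.exterior) :
    T.rot.symm d ∈ T.exterior := by
  have := faceNext_mem_exterior.2 h
  rwa [EmbeddedGraph.faceNext, SimpleGraph.Dart.symm_symm] at this

lemma pow_mem_exterior_iff {d : T.graph.Dart} (h : d.symm ∈ T.exterior) {m : ℕ}
    (hm : m < T.gap d d) : (T.rot ^ m) d ∈ T.exterior ↔ m + 1 = T.gap d d := by
  have h1 := rot_symm_mem_exterior h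
  have h0 := gap_pos (T := T) (x := d) rfl
  have h2 : (T.rot ^ (T.gap d d - 1)) d = T.rot.symm d := by
    rw [Equiv.eq_symm_apply, ← Equiv.Perm.mul_apply, ← pow_succ', Nat.sub_add_cancel h0,
      pow_gap rfl]
  rw [← h2] at h1
  constructor
  · intro h3
    have := pow_inj hm (by omega) (eq_of_mem_exterior h3 h1 (by simp [pow_rot_fst]))
    omega
  · intro h3
    rwa [show m = T.gap d d - 1 by omega]

lemma label_of_star {d : T.graph.Dart} {L : List (Bool × Colour)}
    (h : (T.star d).map S.label = L) :
    T.gap d d = L.length ∧ ∀ m < T.gap d d, L[m]? = some (S.label ((T.rot ^ m) d)) := by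
  have h1 : T.gap d d = L.length := by
    rw [← h, gap_self_eq_ncard]; simp [EmbeddedGraph.star]
  refine ⟨h1, fun m hm => ?_⟩
  have hm' := hm
  rw [gap_self_eq_ncard] at hm'
  rw [← h]
  simp [EmbeddedGraph.star, hm']

variable (hS : T.IsSchnyderWood S)
include hS

lemma out_root : S.out T.root = true := by
  have := hS.2.2.2.1 T.root.symm rfl
  rw [S.out_symm] at this
  simpa using this

lemma colour_root : S.colour T.root = .yellow := hS.2.2.2.2.2 _ rfl (out_root hS)

lemma out_at_vr {z : T.graph.Dart} (h : z.fst = T.vr) (hz : S.out z = true) : z = T.root :=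
  hS.2.2.1.unique ⟨h, hz⟩ ⟨rfl, out_root hS⟩

lemma in_at_vr {z : T.graph.Dart} (h : z.fst = T.vr) (hz : S.out z = false) :
    S.colour z = .red := by
  rw [← S.colour_symm]
  exact hS.2.2.2.2.1 _ h (out_symm_of_false hz)

lemma in_at_vy {z : T.graph.Dart} (h : z.fst = T.vy) : S.colour z = .yellow := by
  rw [← S.colour_symm]
  exact hS.2.2.2.2.2 _ h (out_symm_of_false (hS.2.2.2.1 z h))

lemma exists_localSpec (v : V) : ∃ d : T.graph.Dart, d.fst = v ∧ ∃ r y, LocalSpec S d r y := by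
  by_cases hb : v ∈ T.boundary
  · by_cases hvr : v = T.vr
    · have hn := two_le_gap T.root
      have hf : ∀ m, ((T.rot ^ m) T.root).fst = T.vr := fun m => T.pow_rot_fst m _
      have hout : ∀ m < T.gap T.root T.root, S.out ((T.rot ^ m) T.root) = true ↔ m = 0 := by
        intro m hm
        constructor
        · intro h
          have := out_at_vr hS (hf m) h
          exact pow_inj hm (by omega) this
        · rintro rfl
          exact out_root hS
      have hfalse : ∀ m < T.gap T.root T.root, S.out ((T.rot ^ m) T.root) = false → m ≠ 0 := by
        intro m hm h h0
        rw [← hout m hm, h] at h0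
        simp at h0
      have hyel : S.colour ((T.rot ^ 0) T.root) = .yellow := colour_root hS
      have hext := fun m hm => pow_mem_exterior_iff (d := T.root) root_symm_mem_exterior (m := m) hm
      -- The root edge is the only real outgoing edge at `v_r`. It is yellow and comes first, so `y
      -- = 1`; the red and the blue edge are virtual and sit in the last corner, so `r` is the
      -- degree.
      refine ⟨T.root, hvr.symm, T.gap T.root T.root, 1, by omega, le_rfl, le_rfl, by omega,
        ?_, ?_, ?_, ?_, ?_, ?_, ?_, fun _ => root_symm_mem_exterior, ?_,
        fun h => absurd rfl h, fun h => absurd rfl h, fun _ => rfl,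
        fun h => absurd h vr_ne_vy⟩
      · intro m hm
        induction m with
        | zero => simp; omega
        | succ m ih =>
          rw [Finset.sum_range_succ, ih (by omega)]
          have h1 := hout m (by omega)
          have h2 := hext m (by omega)
          have h3 : T.virt ((T.rot ^ m) T.root).fst = 2 := by
            rw [hf]; simp [virt]
          rw [weight, h3, outN]
          simp only [h1, h2]
          split_ifs <;> omega
      · intro m hm h1 h2
        rw [hout m hm] at h1
        subst h1
        rw [hyel] at h2
        cases h2
      · intro m hm h1 h2
        rw [hout m hm] at h1
        omega
      · intro m hm h1 h2
        rw [hout m hm] at h1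
        subst h1
        rw [hyel] at h2
        cases h2
      · intro m hm h1 h2
        have := hfalse m hm h1
        omega
      · intro m hm h1 h2
        rw [in_at_vr hS (hf m) h1] at h2
        cases h2
      · intro m hm h1 h2
        rw [in_at_vr hS (hf m) h1] at h2
        cases h2
      · intro _ m hm h1 h2
        rw [hout m hm] at h1
        subst h1
        rw [hyel] at h2
        cases h2
    · by_cases hvy : v = T.vy
      · set d := T.rot T.root.symm with hd
        have hdf : d.fst = T.vy := T.rot_fst _
        have hds : d.symm ∈ T.exterior := symm_rot_mem_exterior root_symm_mem_exterior
        have h0 := gap_pos (T := T) (x := d) rfl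
        have hf : ∀ m, ((T.rot ^ m) d).fst = T.vy := fun m => (T.pow_rot_fst m _).trans hdf
        have hout : ∀ m, S.out ((T.rot ^ m) d) = false := fun m => hS.2.2.2.1 _ (hf m)
        have hcol : ∀ m, S.colour ((T.rot ^ m) d) = .yellow := fun m => in_at_vy hS (hf m)
        -- All three outgoing edges at `v_y` are virtual and sit in the last corner.
        refine ⟨d, hdf.trans hvy.symm, T.gap d d, T.gap d d, h0, le_rfl, h0, le_rfl, ?_, ?_, ?_,
          ?_, ?_, ?_, ?_, fun _ => hds, ?_, fun _ => le_rfl, fun _ h => absurd hdf h,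
          fun h => absurd (h.symm.trans hdf) vr_ne_vy, fun _ => ⟨rfl, rfl⟩⟩
        · intro m hm
          induction m with
          | zero => simp; omega
          | succ m ih =>
            rw [Finset.sum_range_succ, ih (by omega)]
            have h2 := pow_mem_exterior_iff hds (m := m) (by omega)
            have h3 : T.virt ((T.rot ^ m) d).fst = 3 := by
              rw [hf]; simp [virt, vr_ne_vy.symm]
            rw [weight, h3, outN, hout]
            simp only [h2]
            split_ifs <;> simp_all <;> omega
        · intro m _ h1; rw [hout] at h1; cases h1
        · intro m _ h1; rw [hout] at h1; cases h1
        · intro m _ h1; rw [hout] at h1; cases h1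
        · intro m _ _ h1; rw [hcol] at h1; cases h1
        · intro m _ _ h1; rw [hcol] at h1; cases h1
        · intro m hm _ _; exact ⟨hm, le_rfl⟩
        · intro _ m _ h1; rw [hout] at h1; cases h1
      · obtain ⟨d, hdv, hds, i, j, k, h⟩ := hS.2.1 v hb hvr hvy
        obtain ⟨hlen, hlab⟩ := label_of_star h
        simp only [List.length_append, List.length_replicate, List.length_singleton] at hlen
        have hext := fun m hm => pow_mem_exterior_iff hds (m := m) hm
        refine ⟨d, hdv, _, _, localSpec_of_labels (i := i) (j := j) (k := k) (ε := 0) (by omega)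
          (by omega) ?_ (fun m hm => by rw [hext m hm]; simp) (fun _ => ⟨hds, rfl⟩)
          (hdv ▸ hvr) (hdv ▸ hvy)⟩
        intro m hm
        have := hlab m hm
        simp only [List.getElem?_append, List.length_append, List.length_replicate,
          List.length_singleton, List.getElem?_replicate] at this
        apply Option.some_injective
        rw [← this]
        split_ifs <;> first | rfl | omega | rw [List.getElem?_singleton, if_pos (by omega)]
  · obtain ⟨d, hdv, i, j, k, h⟩ := hS.1 v hb
    obtain ⟨hlen, hlab⟩ := label_of_star h
    simp only [List.length_append, List.length_replicate, List.length_singleton] at hlen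
    have hrd : (T.rot d).fst = v := (T.rot_fst d).trans hdv
    have hgap : T.gap (T.rot d) (T.rot d) = T.gap d d := by simpa using gap_self_pow d 1
    have hlast : (T.rot ^ (T.gap d d - 1)) (T.rot d) = d := by
      rw [← Equiv.Perm.mul_apply, ← pow_succ, Nat.sub_add_cancel (gap_pos rfl), pow_gap rfl]
    -- Counting starts one step after the blue dart `d`, so that blue comes last as it does at
    -- boundary vertices.
    refine ⟨T.rot d, hrd, _, _, localSpec_of_labels (i := i) (j := j) (k := k) (ε := 1) (by omega)
      (by omega) ?_ (fun m hm => ?_) (fun h => absurd (hrd ▸ h) hb)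
      (fun h => hb (by rw [← hrd, h]; exact vr_mem_boundary))
      (fun h => hb (by rw [← hrd, h]; exact vy_mem_boundary))⟩
    · intro m hm
      rw [hgap] at hm
      apply Option.some_injective
      by_cases hm' : m + 1 = T.gap d d
      · rw [show m = T.gap d d - 1 by omega, hlast]
        have := hlab 0 (by omega)
        simp only [pow_zero, Equiv.Perm.one_apply] at this
        rw [← this]
        simp
        split_ifs <;> first | rfl | omega
      · have := hlab (m + 1) (by omega)
        rw [pow_succ, Equiv.Perm.mul_apply] at this
        simp only [List.getElem?_append, List.length_append, List.length_replicate,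
          List.length_singleton, List.getElem?_replicate] at this
        rw [← this]
        split_ifs <;> first | rfl | omega | rw [List.getElem?_singleton, if_pos (by omega)]
    · refine ⟨fun h => absurd ⟨_, h, ?_⟩ hb, fun h => absurd h.2 one_ne_zero⟩
      rw [pow_rot_fst]; exact hrd

end InfiniteTriangulation

namespace InfiniteTriangulation

variable {V : Type*} {T : InfiniteTriangulation V} {S : ColouredOrientation T.graph}

/-! ### Local rules of a Schnyder wood -/

lemma LocalSpec.osum_lt {d : T.graph.Dart} {r y : ℕ} (h : LocalSpec S d r y) {p q : ℕ}
    (hpq : p < q) (hq : q ≤ T.gap d d) :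
    osum S ((T.rot ^ p) d) ((T.rot ^ q) d) =
      ((if r ≤ q then 1 else 0) + (if y ≤ q then 1 else 0) + if T.gap d d ≤ q then 1 else 0) -
      ((if r ≤ p then 1 else 0) + (if y ≤ p then 1 else 0) + if T.gap d d ≤ p then 1 else 0) -
      outN S ((T.rot ^ p) d) := by
  rw [osum, sum_fan_pow _ hpq hq, h.sum _ hq, h.sum _ (by omega)]

lemma LocalSpec.osum_ge {d : T.graph.Dart} {r y : ℕ} (h : LocalSpec S d r y) {p q : ℕ}
    (hqp : q ≤ p) (hp : p < T.gap d d) :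
    osum S ((T.rot ^ p) d) ((T.rot ^ q) d) = 3 -
      ((if r ≤ p then 1 else 0) + (if y ≤ p then 1 else 0) + if T.gap d d ≤ p then 1 else 0) +
      ((if r ≤ q then 1 else 0) + (if y ≤ q then 1 else 0) + if T.gap d d ≤ q then 1 else 0) -
      outN S ((T.rot ^ p) d) := by
  have h1 := h.r_le
  have h2 := h.y_le
  rw [osum, sum_fan_pow_of_le _ hqp hp, h.sum _ le_rfl, h.sum _ (by omega), h.sum _ (by omega),
    if_pos h1, if_pos h2, if_pos le_rfl]
  ring

variable (hS : T.IsSchnyderWood S)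
include hS

/-- The numbers `virt` are chosen for this: `v_r` has one real outgoing edge, `v_y` none and every
other boundary vertex two, and the virtual ones make up the total of three. -/
lemma sum_weight (v : V) : ∑ z ∈ T.dartsAt v, weight S z = 3 := by
  obtain ⟨d, rfl, r, y, h⟩ := exists_localSpec hS v
  have h1 := h.r_le
  have h2 := h.y_le
  rw [← fan_self, sum_fan _ rfl, h.sum _ le_rfl, if_pos h1, if_pos h2, if_pos le_rfl]
  rfl

lemma osum_add_osum {x y : T.graph.Dart} (h : x.fst = y.fst) (hne : x ≠ y) :
    osum S x y + osum S y x = 3 - outN S x - outN S y := by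
  have := sum_fan_add_sum_fan (weight S) h hne
  rw [sum_weight hS] at this
  unfold osum
  linarith

omit hS in
lemma osum_nonneg {x y : T.graph.Dart} (h : x.fst = y.fst) : 0 ≤ osum S x y := by
  have h1 := Finset.single_le_sum (f := weight S) (fun z _ => weight_nonneg z) (left_mem_fan h)
  have : outN S x ≤ weight S x := by
    have := virt_pos (T := T) x.fst
    unfold weight; split_ifs <;> omega
  unfold osum
  linarith

/-- Incoming edges lie in the sector opposite to the outgoing edge of their colour. Turning
anticlockwise from the outgoing edge `x` to the incoming edge `y` one thus passes zero, one or two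
other outgoing edges, according to the cyclic difference of the colours. -/
lemma osum_in_out {x y : T.graph.Dart} (hxy : x.fst = y.fst) (hx : S.out x = true)
    (hy : S.out y = false) :
    (S.colour x = (S.colour y).next → osum S x y = 0) ∧
    (S.colour x = S.colour y → osum S x y = 1) ∧
    (S.colour y = (S.colour x).next → osum S x y = 2) := by
  obtain ⟨d, hd, r, s, h⟩ := exists_localSpec hS x.fst
  obtain ⟨q, hq, rfl⟩ := exists_pow_lt hd
  obtain ⟨p, hp, rfl⟩ := exists_pow_lt (d := d) (z := y) (by rw [hd, hxy])
  have hpq : p ≠ q := by rintro rfl; rw [hx] at hy; cases hy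
  have a1 := h.r_pos
  have a2 := h.r_le
  have a3 := h.y_pos
  have a4 := h.y_le
  have b1 := h.out_red q hq hx
  have b2 := h.out_yellow q hq hx
  have b3 := h.out_blue q hq hx
  have c1 := h.in_red p hp hy
  have c2 := h.in_blue p hp hy
  have c3 := h.in_yellow p hp hy
  have o1 := outN_of_true hx
  have key : osum S ((T.rot ^ q) d) ((T.rot ^ p) d) =
      (if p < q then 3 else 0) -
      ((if r ≤ q then 1 else 0) + (if s ≤ q then 1 else 0)) +
      ((if r ≤ p then 1 else 0) + (if s ≤ p then 1 else 0)) - 1 := by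
    rcases Nat.lt_or_ge p q with hlt | hge
    · rw [h.osum_ge hlt.le hq, o1, if_neg (show ¬ T.gap d d ≤ q by omega),
        if_neg (show ¬ T.gap d d ≤ p by omega), if_pos hlt]
      ring
    · rw [h.osum_lt (show q < p by omega) hp.le, o1, if_neg (show ¬ T.gap d d ≤ q by omega),
        if_neg (show ¬ T.gap d d ≤ p by omega), if_neg (show ¬ p < q by omega)]
      ring
  rw [key]
  cases hcx : S.colour ((T.rot ^ q) d) <;> cases hcy : S.colour ((T.rot ^ p) d) <;>
    simp only [Colour.next, reduceCtorEq, IsEmpty.forall_iff, true_and, and_true, forall_const, hcx, hcy] at * <;> split_ifs <;> omega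

lemma osum_out_next {x y : T.graph.Dart} (hxy : x.fst = y.fst) (hx : S.out x = true)
    (hy : S.out y = true) (hc : S.colour y = (S.colour x).next) : osum S x y = 0 := by
  obtain ⟨d, hd, r, s, h⟩ := exists_localSpec hS x.fst
  obtain ⟨q, hq, rfl⟩ := exists_pow_lt hd
  obtain ⟨p, hp, rfl⟩ := exists_pow_lt (d := d) (z := y) (by rw [hd, hxy])
  have hpq : p ≠ q := by rintro rfl; exact (Colour.next_ne _).symm hc
  have a1 := h.r_pos
  have a2 := h.r_le
  have a3 := h.y_pos
  have a4 := h.y_le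
  have b1 := h.out_red q hq hx
  have b2 := h.out_yellow q hq hx
  have b3 := h.out_blue q hq hx
  have c1 := h.out_red p hp hy
  have c2 := h.out_yellow p hp hy
  have c3 := h.out_blue p hp hy
  have o1 := outN_of_true hx
  have key : osum S ((T.rot ^ q) d) ((T.rot ^ p) d) =
      (if p < q then 3 else 0) -
      ((if r ≤ q then 1 else 0) + (if s ≤ q then 1 else 0)) +
      ((if r ≤ p then 1 else 0) + (if s ≤ p then 1 else 0)) - 1 := by
    rcases Nat.lt_or_ge p q with hlt | hge
    · rw [h.osum_ge hlt.le hq, o1, if_neg (show ¬ T.gap d d ≤ q by omega),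
        if_neg (show ¬ T.gap d d ≤ p by omega), if_pos hlt]
      ring
    · rw [h.osum_lt (show q < p by omega) hp.le, o1, if_neg (show ¬ T.gap d d ≤ q by omega),
        if_neg (show ¬ T.gap d d ≤ p by omega), if_neg (show ¬ p < q by omega)]
      ring
  rw [key]
  cases hcx : S.colour ((T.rot ^ q) d) <;> cases hcy : S.colour ((T.rot ^ p) d) <;>
    simp only [Colour.next, reduceCtorEq, IsEmpty.forall_iff, true_and, and_true, forall_const, hcx, hcy] at * <;> split_ifs <;> omega

lemma out_unique {x y : T.graph.Dart} (hxy : x.fst = y.fst) (hx : S.out x = true)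
    (hy : S.out y = true) (hc : S.colour x = S.colour y) : x = y := by
  obtain ⟨d, hd, r, s, h⟩ := exists_localSpec hS x.fst
  obtain ⟨q, hq, rfl⟩ := exists_pow_lt hd
  obtain ⟨p, hp, rfl⟩ := exists_pow_lt (d := d) (z := y) (by rw [hd, hxy])
  have b1 := h.out_red q hq hx
  have b2 := h.out_yellow q hq hx
  have b3 := h.out_blue q hq hx
  have c1 := h.out_red p hp hy
  have c2 := h.out_yellow p hp hy
  have c3 := h.out_blue p hp hy
  suffices q = p by rw [this]
  rw [← hc] at c1 c2 c3
  cases hcx : S.colour ((T.rot ^ q) d) <;> simp only [hcx, true_implies] at b1 b2 b3 c1 c2 c3 <;>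
    omega

lemma no_blue_out {x : T.graph.Dart} (hb : x.fst ∈ T.boundary) (hx : S.out x = true) :
    S.colour x ≠ .blue := by
  obtain ⟨d, hd, r, s, h⟩ := exists_localSpec hS x.fst
  obtain ⟨q, hq, rfl⟩ := exists_pow_lt hd
  exact h.no_blue (hd ▸ hb) q hq hx

omit hS in
lemma LocalSpec.weight_pow {d : T.graph.Dart} {r y : ℕ} (h : LocalSpec S d r y) {m : ℕ}
    (hm : m < T.gap d d) : weight S ((T.rot ^ m) d) =
      (if r = m + 1 then 1 else 0) + (if y = m + 1 then 1 else 0) +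
        if T.gap d d = m + 1 then 1 else 0 := by
  have h1 := h.sum (m + 1) hm
  rw [Finset.sum_range_succ, h.sum m hm.le] at h1
  split_ifs at * <;> omega

omit hS in
lemma mem_exterior_pow {d : T.graph.Dart} {r y : ℕ} (h : LocalSpec S d r y) {m : ℕ}
    (hm : m < T.gap d d) :
    (T.rot ^ m) d ∈ T.exterior ↔ d.fst ∈ T.boundary ∧ m + 1 = T.gap d d := by
  constructor
  · intro h1
    have hb : d.fst ∈ T.boundary := ⟨_, h1, T.pow_rot_fst m d⟩
    exact ⟨hb, (pow_mem_exterior_iff (h.boundary hb) hm).1 h1⟩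
  · rintro ⟨hb, h1⟩
    exact (pow_mem_exterior_iff (h.boundary hb) hm).2 h1

/-- At an interior vertex the last corner is not exterior, so the unit of weight in the last place
must come from a real dart. -/
lemma exists_out_blue {v : V} (hv : v ∉ T.boundary) :
    ∃ x : T.graph.Dart, x.fst = v ∧ S.out x = true ∧ S.colour x = .blue := by
  obtain ⟨d, rfl, r, y, h⟩ := exists_localSpec hS v
  have h0 := gap_pos (T := T) (x := d) rfl
  obtain ⟨m, hm⟩ : ∃ m, m + 1 = T.gap d d := ⟨T.gap d d - 1, by omega⟩
  have h1 := h.weight_pow (m := m) (by omega)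
  have h2 : (T.rot ^ m) d ∉ T.exterior := by
    rw [mem_exterior_pow h (by omega)]; tauto
  rw [weight, if_neg h2, add_zero, if_pos hm.symm] at h1
  have h3 := outN_le_one (S := S) ((T.rot ^ m) d)
  have h4 : S.out ((T.rot ^ m) d) = true := by
    by_contra h4
    rw [outN_of_false (by simpa using h4)] at h1
    split_ifs at h1 <;> omega
  refine ⟨_, T.pow_rot_fst m d, h4, ?_⟩
  have b1 := h.out_red m (by omega) h4
  have b2 := h.out_yellow m (by omega) h4
  cases hc : S.colour ((T.rot ^ m) d)
  · rfl
  · have := b1 hc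
    rw [if_pos (this.1.symm)] at h1
    split_ifs at h1 <;> omega
  · have := b2 hc
    rw [if_pos (this.1.symm)] at h1
    split_ifs at h1 <;> omega

lemma exists_out_red {v : V} (hr : v ≠ T.vr) (hy : v ≠ T.vy) :
    ∃ x : T.graph.Dart, x.fst = v ∧ S.out x = true ∧ S.colour x = .red := by
  obtain ⟨d, rfl, r, y, h⟩ := exists_localSpec hS v
  have h0 := h.ordinary hr hy
  have h1 := h.r_pos
  have h2 := h.y_le
  obtain ⟨m, rfl⟩ : ∃ m, r = m + 1 := ⟨r - 1, by omega⟩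
  have h3 := h.weight_pow (m := m) (by omega)
  have h4 : (T.rot ^ m) d ∉ T.exterior := by
    rw [mem_exterior_pow h (by omega)]; omega
  rw [weight, if_neg h4, add_zero, if_pos rfl] at h3
  have h5 : S.out ((T.rot ^ m) d) = true := by
    by_contra h5
    rw [outN_of_false (by simpa using h5)] at h3
    split_ifs at h3 <;> omega
  refine ⟨_, T.pow_rot_fst m d, h5, ?_⟩
  have b1 := h.out_blue m (by omega) h5
  have b2 := h.out_yellow m (by omega) h5
  cases hc : S.colour ((T.rot ^ m) d)
  · have := b1 hc; omega
  · rfl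
  · have := b2 hc; omega

lemma exists_out_yellow {v : V} (hy : v ≠ T.vy) :
    ∃ x : T.graph.Dart, x.fst = v ∧ S.out x = true ∧ S.colour x = .yellow := by
  by_cases hr : v = T.vr
  · exact ⟨T.root, hr.symm, out_root hS, colour_root hS⟩
  obtain ⟨d, rfl, r, y, h⟩ := exists_localSpec hS v
  have h0 := h.ordinary hr hy
  have h1 := h.r_pos
  have h2 := h.y_le
  obtain ⟨m, rfl⟩ : ∃ m, y = m + 1 := ⟨y - 1, by omega⟩
  have h3 := h.weight_pow (m := m) (by omega)
  have hv : T.virt ((T.rot ^ m) d).fst = 1 := by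
    rw [pow_rot_fst]; simp [virt, hr, hy]
  rw [weight, hv, if_pos rfl] at h3
  by_cases hmn : T.gap d d = m + 1
  · have h5 : S.out ((T.rot ^ m) d) = true := by
      by_contra h5
      rw [outN_of_false (by simpa using h5)] at h3
      split_ifs at h3 <;> omega
    refine ⟨_, T.pow_rot_fst m d, h5, ?_⟩
    have b1 := h.out_blue m (by omega) h5
    have b2 := h.out_red m (by omega) h5
    cases hc : S.colour ((T.rot ^ m) d)
    · have := b1 hc; omega
    · have := b2 hc; omega
    · rfl
  · have h4 : (T.rot ^ m) d ∉ T.exterior := by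
      rw [mem_exterior_pow h (by omega)]; omega
    rw [if_neg h4] at h3
    have h5 : S.out ((T.rot ^ m) d) = true := by
      by_contra h5
      rw [outN_of_false (by simpa using h5)] at h3
      split_ifs at h3 <;> omega
    refine ⟨_, T.pow_rot_fst m d, h5, ?_⟩
    have b1 := h.out_blue m (by omega) h5
    have b2 := h.out_red m (by omega) h5
    cases hc : S.colour ((T.rot ^ m) d)
    · have := b1 hc; omega
    · have := b2 hc; omega
    · rfl

lemma exists_out {v : V} (hv : v ∉ T.boundary) (c : Colour) :
    ∃ x : T.graph.Dart, x.fst = v ∧ S.out x = true ∧ S.colour x = c := by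
  have h1 : v ≠ T.vr := by rintro rfl; exact hv vr_mem_boundary
  have h2 : v ≠ T.vy := by rintro rfl; exact hv vy_mem_boundary
  cases c
  · exact exists_out_blue hS hv
  · exact exists_out_red hS h1 h2
  · exact exists_out_yellow hS h2

/-- The positions at a boundary vertex, with the exterior dart in the last place. -/
lemma exists_boundary_spec {e : T.graph.Dart} (he : e ∈ T.exterior) :
    ∃ r y, LocalSpec S (T.rot e) r y ∧
      ∀ m, m + 1 = T.gap (T.rot e) (T.rot e) → (T.rot ^ m) (T.rot e) = e := by
  obtain ⟨d, hd, r, y, h⟩ := exists_localSpec hS e.fst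
  have hb : d.fst ∈ T.boundary := ⟨e, he, hd.symm⟩
  have h1 : T.rot.symm d = e :=
    eq_of_mem_exterior (rot_symm_mem_exterior (h.boundary hb)) he ((T.rot_symm_fst d).trans hd)
  have h2 : T.rot e = d := by rw [← h1, Equiv.apply_symm_apply]
  rw [h2]
  refine ⟨r, y, h, fun m hm => ?_⟩
  rw [← h1, Equiv.eq_symm_apply, ← Equiv.Perm.mul_apply, ← pow_succ', hm, pow_gap rfl]

/-- Incoming yellow edges come first from the boundary, so nothing outgoing precedes them. This
includes `v_y`, where every edge is an incoming yellow one. -/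
lemma osum_first_in_yellow {e y : T.graph.Dart} (he : e ∈ T.exterior) (hy : y.fst = e.fst)
    (hout : S.out y = false) (hc : S.colour y = .yellow) (hne : y ≠ T.rot e) :
    osum S (T.rot e) y = 0 ∧ S.out (T.rot e) = false := by
  obtain ⟨r, s, h, -⟩ := exists_boundary_spec hS he
  obtain ⟨p, hp, rfl⟩ := exists_pow_lt (d := T.rot e) (z := y) ((T.rot_fst e).trans hy.symm)
  have hp0 : 0 < p := Nat.pos_of_ne_zero (by rintro rfl; exact hne rfl)
  have h1 := h.in_yellow p hp hout hc
  have h2 := h.osum_lt hp0 hp.le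
  have h3 : S.out (T.rot e) = false := by
    by_contra h3
    have h3' : S.out ((T.rot ^ 0) (T.rot e)) = true := by simpa using h3
    have b1 := h.out_blue 0 (by omega) h3'
    have b2 := h.out_red 0 (by omega) h3'
    have b3 := h.out_yellow 0 (by omega) h3'
    cases hc : S.colour ((T.rot ^ 0) (T.rot e))
    · have := b1 hc; omega
    · have := b2 hc; omega
    · have := b3 hc; omega
  refine ⟨?_, h3⟩
  rw [pow_zero, Equiv.Perm.one_apply, outN_of_false h3] at h2
  have a1 := h.r_pos
  have a2 := h.y_pos
  rw [h2]
  split_ifs <;> omega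

/-- Incoming red edges come last before the exterior corner, so only virtual edges can follow them;
those sit in the corner after `e` and are not counted. -/
lemma osum_in_red_last {e y : T.graph.Dart} (he : e ∈ T.exterior) (hy : y.fst = e.fst)
    (hout : S.out y = false) (hc : S.colour y = .red) (hne : y ≠ e) :
    osum S y e = 0 ∧ S.out e = false := by
  obtain ⟨r, s, h, hlast⟩ := exists_boundary_spec hS he
  obtain ⟨p, hp, rfl⟩ := exists_pow_lt (d := T.rot e) (z := y) ((T.rot_fst e).trans hy.symm)
  obtain ⟨m, hm⟩ : ∃ m, m + 1 = T.gap (T.rot e) (T.rot e) := ⟨_, Nat.sub_add_cancel (by omega)⟩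
  have hpm : p ≠ m := by rintro rfl; exact hne (hlast _ hm)
  have h1 := h.in_red p hp hout hc
  have h2 := h.osum_lt (p := p) (q := m) (by omega) (by omega)
  have h3 : S.out e = false := by
    by_contra h3
    have h3' : S.out ((T.rot ^ m) (T.rot e)) = true := by rw [hlast m hm]; simpa using h3
    have b1 := h.no_blue ⟨e, he, (T.rot_fst e).symm⟩ m (by omega) h3'
    have b2 := h.out_red m (by omega) h3'
    have b3 := h.out_yellow m (by omega) h3'
    cases hc : S.colour ((T.rot ^ m) (T.rot e))
    · exact b1 hc
    · have := b2 hc; omega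
    · have := b3 hc; omega
  refine ⟨?_, h3⟩
  rw [hlast m hm, outN_of_false hout] at h2
  have a1 := h.r_le
  have a2 := h.regular
  by_cases hr : (T.rot e).fst = T.vr
  · have := h.at_vr hr
    rw [h2]
    split_ifs <;> omega
  · have := h.regular hr
    rw [h2]
    split_ifs <;> omega

lemma osum_at_vy_last {e y : T.graph.Dart} (he : e ∈ T.exterior) (hy : y.fst = e.fst)
    (hv : e.fst = T.vy) (hne : y ≠ e) : osum S y e = 0 ∧ S.out e = false := by
  obtain ⟨r, s, h, hlast⟩ := exists_boundary_spec hS he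
  obtain ⟨p, hp, rfl⟩ := exists_pow_lt (d := T.rot e) (z := y) ((T.rot_fst e).trans hy.symm)
  obtain ⟨m, hm⟩ : ∃ m, m + 1 = T.gap (T.rot e) (T.rot e) := ⟨_, Nat.sub_add_cancel (by omega)⟩
  have hpm : p ≠ m := by rintro rfl; exact hne (hlast _ hm)
  have h1 := h.at_vy ((T.rot_fst e).trans hv)
  have h2 := h.osum_lt (p := p) (q := m) (by omega) (by omega)
  rw [hlast m hm, outN_of_false (hS.2.2.2.1 _ (hy.trans hv))] at h2
  refine ⟨?_, hS.2.2.2.1 _ hv⟩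
  rw [h2]
  split_ifs <;> omega

/-- Exactly the outgoing yellow edge follows an incoming blue edge at the boundary. It may be the
exterior dart `e` itself, which `osum` leaves out; hence the term `outN S e`. -/
lemma osum_in_blue_last {e y : T.graph.Dart} (he : e ∈ T.exterior) (hy : y.fst = e.fst)
    (hout : S.out y = false) (hc : S.colour y = .blue) : osum S y e + outN S e = 1 := by
  obtain ⟨r, s, h, hlast⟩ := exists_boundary_spec hS he
  obtain ⟨p, hp, rfl⟩ := exists_pow_lt (d := T.rot e) (z := y) ((T.rot_fst e).trans hy.symm)
  obtain ⟨m, hm⟩ : ∃ m, m + 1 = T.gap (T.rot e) (T.rot e) := ⟨_, Nat.sub_add_cancel (by omega)⟩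
  have hfst : ((T.rot ^ p) (T.rot e)).fst = (T.rot e).fst := T.pow_rot_fst _ _
  have hr : (T.rot e).fst ≠ T.vr := fun hr => by
    rw [in_at_vr hS (hfst.trans hr) hout] at hc; cases hc
  have hv : (T.rot e).fst ≠ T.vy := fun hr => by
    rw [in_at_vy hS (hfst.trans hr)] at hc; cases hc
  have h1 := h.in_blue p hp hout hc
  have h4 := h.y_le
  have h2 := h.osum_lt (p := p) (q := m) (by omega) (by omega)
  have h3 := h.weight_pow (m := m) (by omega)
  rw [hlast m hm] at h2 h3
  rw [outN_of_false hout] at h2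
  rw [weight, if_pos he, show T.virt e.fst = 1 by
    rw [← T.rot_fst e]; simp [virt, hr, hv]] at h3
  rw [h2, if_pos h1.1, if_neg (show ¬ s ≤ p by omega), if_neg (show ¬ T.gap _ _ ≤ p by omega),
    if_pos (show r ≤ m by omega), if_neg (show ¬ T.gap _ _ ≤ m by omega)]
  rw [if_neg (show ¬ r = m + 1 by omega), if_pos hm.symm] at h3
  by_cases hs : s = m + 1
  · rw [if_pos hs] at h3
    rw [if_neg (by omega)]
    omega
  · rw [if_neg hs] at h3
    rw [if_pos (by omega)]
    omega

lemma osum_out_yellow_last {e x : T.graph.Dart} (he : e ∈ T.exterior) (hx : x.fst = e.fst)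
    (hout : S.out x = true) (hc : S.colour x = .yellow) (hne : x ≠ e) :
    osum S x e = 0 ∧ S.out e = false := by
  obtain ⟨r, s, h, hlast⟩ := exists_boundary_spec hS he
  obtain ⟨p, hp, rfl⟩ := exists_pow_lt (d := T.rot e) (z := x) ((T.rot_fst e).trans hx.symm)
  obtain ⟨m, hm⟩ : ∃ m, m + 1 = T.gap (T.rot e) (T.rot e) := ⟨_, Nat.sub_add_cancel (by omega)⟩
  have hpm : p ≠ m := by rintro rfl; exact hne (hlast _ hm)
  have h1 := h.out_yellow p hp hout hc
  have h2 := h.osum_lt (p := p) (q := m) (by omega) (by omega)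
  have h3 : S.out e = false := by
    by_contra h3
    have h3' : S.out ((T.rot ^ m) (T.rot e)) = true := by rw [hlast m hm]; simpa using h3
    have b1 := h.no_blue ⟨e, he, (T.rot_fst e).symm⟩ m (by omega) h3'
    have b2 := h.out_red m (by omega) h3'
    have b3 := h.out_yellow m (by omega) h3'
    cases hc : S.colour ((T.rot ^ m) (T.rot e))
    · exact b1 hc
    · have := b2 hc; omega
    · have := b3 hc; omega
  refine ⟨?_, h3⟩
  rw [hlast m hm, outN_of_true hout] at h2
  by_cases hr : (T.rot e).fst = T.vr
  · have := h.at_vr hr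
    rw [h2]
    split_ifs <;> omega
  · have := h.regular hr
    rw [h2]
    split_ifs <;> omega

/-! ### Turns -/

/-- The edge of the next colour is the first outgoing edge on the left, so no outgoing edge remains
between it and the edge of arrival. Moving on to the next colour is therefore a left turn. -/
lemma turn_next {d d' : T.graph.Dart} (hdd : d.snd = d'.fst) (hd : S.out d = true)
    (hd' : S.out d' = true) (hc : S.colour d' = (S.colour d).next) : turn S d d' = 1 := by
  have := (osum_in_out hS (x := d') (y := d.symm) hdd.symm hd' (out_symm_of_true hd)).1
    (by rw [S.colour_symm]; exact hc)
  rw [turn, this, sub_zero]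

lemma turn_same {d d' : T.graph.Dart} (hdd : d.snd = d'.fst) (hd : S.out d = true)
    (hd' : S.out d' = true) (hc : S.colour d' = S.colour d) : turn S d d' = 0 := by
  have := (osum_in_out hS (x := d') (y := d.symm) hdd.symm hd' (out_symm_of_true hd)).2.1
    (by rw [S.colour_symm]; exact hc)
  rw [turn, this, sub_self]

lemma turn_prev {d d' : T.graph.Dart} (hdd : d.snd = d'.fst) (hd : S.out d = true)
    (hd' : S.out d' = true) (hc : S.colour d = (S.colour d').next) : turn S d d' = -1 := by
  have := (osum_in_out hS (x := d') (y := d.symm) hdd.symm hd' (out_symm_of_true hd)).2.2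
    (by rw [S.colour_symm]; exact hc)
  rw [turn, this]
  rfl

lemma neg_one_le_turn {d d' : T.graph.Dart} (hdd : d.snd = d'.fst) (hd : S.out d = true)
    (hd' : S.out d' = true) : -1 ≤ turn S d d' := by
  rcases Colour.eq_or (S.colour d) (S.colour d') with h | h | h
  · rw [turn_same hS hdd hd hd' h]; norm_num
  · rw [turn_next hS hdd hd hd' h]; norm_num
  · rw [turn_prev hS hdd hd hd' h]

omit hS in
lemma turn_le_one {d d' : T.graph.Dart} (hdd : d.snd = d'.fst) : turn S d d' ≤ 1 := by
  have := osum_nonneg (S := S) (x := d') (y := d.symm) hdd.symm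
  unfold turn
  linarith

/-- There are three outgoing edges in all, so at most three lie on the left. For a path that turns
back, the fan is the whole star. -/
lemma neg_two_le_turn {d d' : T.graph.Dart} (hdd : d.snd = d'.fst) : -2 ≤ turn S d d' := by
  have hf : d'.fst = d.symm.fst := hdd.symm
  unfold turn
  by_cases h : d' = d.symm
  · rw [← h, osum, fan_self, sum_weight hS]
    have := outN_nonneg (S := S) d'
    linarith
  · have h1 := osum_add_osum hS hf h
    have h2 := osum_nonneg (S := S) hf.symm
    have := outN_nonneg (S := S) d'
    have := outN_nonneg (S := S) d.symm
    linarith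

/-- The turn along the reversed path. -/
lemma turn_rev {d d' : T.graph.Dart} (hdd : d.snd = d'.fst) (hne : d' ≠ d.symm) :
    turn S d'.symm d.symm = -turn S d d' + outN S d' - outN S d := by
  have h1 := osum_add_osum hS (x := d') (y := d.symm) hdd.symm hne
  unfold turn
  rw [SimpleGraph.Dart.symm_symm]
  rw [outN_symm] at h1
  linarith

end InfiniteTriangulation

namespace InfiniteTriangulation

variable {V : Type*} {T : InfiniteTriangulation V} {S : ColouredOrientation T.graph}

/-! ### Total turns -/

variable (S) in
/-- The sum of the turns along a list of darts. -/
noncomputable def ts : List T.graph.Dart → ℤ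
  | [] => 0
  | [_] => 0
  | a :: b :: l => turn S a b + ts (b :: l)

@[simp] lemma ts_nil : ts S ([] : List T.graph.Dart) = 0 := rfl

@[simp] lemma ts_singleton (a : T.graph.Dart) : ts S [a] = 0 := rfl

@[simp] lemma ts_cons_cons (a b : T.graph.Dart) (l : List T.graph.Dart) :
    ts S (a :: b :: l) = turn S a b + ts S (b :: l) := rfl

lemma ts_cons (a : T.graph.Dart) {l : List T.graph.Dart} (h : l ≠ []) :
    ts S (a :: l) = turn S a (l.head h) + ts S l := by
  cases l with
  | nil => exact absurd rfl h
  | cons b l => rfl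

lemma ts_append {l l' : List T.graph.Dart} (h : l ≠ []) (h' : l' ≠ []) :
    ts S (l ++ l') = ts S l + turn S (l.getLast h) (l'.head h') + ts S l' := by
  induction l with
  | nil => exact absurd rfl h
  | cons a l ih =>
    cases l with
    | nil => simp [ts_cons a h']
    | cons b l =>
      have := ih (by simp)
      simp only [List.cons_append, ts_cons_cons] at this ⊢
      rw [this, List.getLast_cons (List.cons_ne_nil b l)]
      ring

variable (S) in
open Classical in
/-- The sum of the turns around a closed walk. -/
noncomputable def cturn (l : List T.graph.Dart) : ℤ :=
  if h : l = [] then 0 else ts S l + turn S (l.getLast h) (l.head h)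

lemma cturn_eq_ts {l : List T.graph.Dart} (h : l ≠ []) :
    cturn S l = ts S l + turn S (l.getLast h) (l.head h) := dif_neg h

lemma cturn_append {l l' : List T.graph.Dart} (h : l ≠ []) (h' : l' ≠ []) :
    cturn S (l ++ l') = ts S l + turn S (l.getLast h) (l'.head h') + ts S l' +
      turn S (l'.getLast h') (l.head h) := by
  rw [cturn_eq_ts (by simp [h]), ts_append h h', List.getLast_append_of_ne_nil _ h',
    List.head_append_of_ne_nil h]

lemma cturn_rotate (l l' : List T.graph.Dart) : cturn S (l ++ l') = cturn S (l' ++ l) := by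
  rcases eq_or_ne l [] with rfl | h
  · simp
  rcases eq_or_ne l' [] with rfl | h'
  · simp
  rw [cturn_append h h', cturn_append h' h]
  ring

lemma cturn_cons (a : T.graph.Dart) {l : List T.graph.Dart} (h : l ≠ []) :
    cturn S (a :: l) = turn S a (l.head h) + ts S l + turn S (l.getLast h) a := by
  rw [cturn_eq_ts (by simp), ts_cons a h, List.getLast_cons h, List.head_cons]

/-- For walks whose successor is a function of the dart, such as the boundary walk of the exterior
face. -/
lemma ts_eq_sum_map (f : T.graph.Dart → T.graph.Dart) {l : List T.graph.Dart} (h : l ≠ [])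
    (hl : l.IsChain fun a b => b = f a) {x : T.graph.Dart} (hx : x = f (l.getLast h)) :
    ts S l + turn S (l.getLast h) x = (l.map fun z => turn S z (f z)).sum := by
  induction l with
  | nil => exact absurd rfl h
  | cons a l ih =>
    cases l with
    | nil => simp at hx; simp [hx]
    | cons b l =>
      rw [List.isChain_cons_cons] at hl
      have := ih (by simp) hl.2 (by rw [hx, List.getLast_cons (by simp)])
      rw [List.map_cons, List.sum_cons, ← this, ts_cons_cons, ← hl.1,
        List.getLast_cons (by simp)]
      ring

/-! ### Triangles next to a cycle -/

lemma fan_rot (z : T.graph.Dart) : ∑ e ∈ T.fan z (T.rot z), weight S e = weight S z := by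
  have h1 : T.gap z (T.rot z) = 1 := le_antisymm (gap_le one_pos (by simp))
    (gap_pos (T.rot_fst z).symm)
  rw [sum_fan _ (T.rot_fst z).symm, h1]
  simp

lemma rot_ne (z : T.graph.Dart) : T.rot z ≠ z := by
  intro h
  have h1 := two_le_gap z
  have h2 := gap_le one_pos (x := z) (y := z) (by simpa using h)
  omega

lemma weight_of_notMem {z : T.graph.Dart} (h : z ∉ T.exterior) : weight S z = outN S z := by
  simp [weight, h]

lemma osum_rot_left {z y : T.graph.Dart} (hz : z ∉ T.exterior) (h : z.fst = y.fst)
    (hne : T.rot z ≠ y) : osum S z y = osum S (T.rot z) y + outN S (T.rot z) := by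
  have := sum_fan_split (weight S) h (rot_mem_fan h (left_mem_fan h) hne) (rot_ne z)
  rw [fan_rot, weight_of_notMem hz] at this
  unfold osum
  linarith

lemma osum_rot_right {z x : T.graph.Dart} (hz : z ∉ T.exterior) (h : x.fst = z.fst)
    (hne : z ≠ x) : osum S x (T.rot z) = osum S x z + outN S z := by
  have hf : x.fst = (T.rot z).fst := h.trans (T.rot_fst z).symm
  have := sum_fan_split (weight S) hf (z := z) (by simpa using rot_symm_mem_fan hf) hne
  rw [fan_rot, weight_of_notMem hz] at this
  unfold osum
  linarith

/-- A triangular face, with the names of its three darts. -/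
structure IsTri (d d₁ d₂ : T.graph.Dart) : Prop where
  h₀ : d ∉ T.exterior
  h₁ : d₁ ∉ T.exterior
  h₂ : d₂ ∉ T.exterior
  r₀ : T.rot d = d₂.symm
  r₁ : T.rot d₁ = d.symm
  r₂ : T.rot d₂ = d₁.symm
  e₀ : d.snd = d₁.fst
  e₁ : d₁.snd = d₂.fst
  e₂ : d₂.snd = d.fst
  mem : ∀ z, z ∈ T.face d ↔ z = d ∨ z = d₁ ∨ z = d₂

lemma isTri {d : T.graph.Dart} (h : d ∉ T.exterior) :
    IsTri d (T.faceNext d) (T.faceNext (T.faceNext d)) := by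
  have h3 := faceNext_three h
  have h4 := rot_faceNext (T.faceNext (T.faceNext d))
  rw [h3] at h4
  have h5 := faceNext_fst (T.faceNext (T.faceNext d))
  rw [h3] at h5
  refine ⟨h, by rwa [faceNext_mem_exterior], by rwa [faceNext_mem_exterior, faceNext_mem_exterior],
    h4, rot_faceNext _, rot_faceNext _, (faceNext_fst _).symm, (faceNext_fst _).symm, h5.symm,
    fun z => ?_⟩
  rw [face_eq_of_notMem_exterior h]
  rfl

lemma faceNext_mem_face_iff {d z : T.graph.Dart} : z ∈ T.face d ↔ T.faceNext z ∈ T.face d :=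
  ⟨faceNext_mem_face, fun h => .trans _ _ _ h (.symm _ _ (.rel _ _ rfl))⟩

namespace IsTri

variable {d d₁ d₂ : T.graph.Dart} (h : IsTri d d₁ d₂)
include h

lemma rotate : IsTri d₂ d d₁ := by
  refine ⟨h.h₂, h.h₀, h.h₁, h.r₂, h.r₀, h.r₁, h.e₂, h.e₀, h.e₁, fun z => ?_⟩
  rw [face_eq_of_mem ((h.mem d₂).2 (by simp)), h.mem]
  tauto

lemma face_disjoint {z : T.graph.Dart} (hz : z ∈ T.face d) : z ∉ T.exterior := by
  rcases (h.mem z).1 hz with rfl | rfl | rfl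
  exacts [h.h₀, h.h₁, h.h₂]

/-- Passing from one side of the triangle to the others changes the turns at the ends of `d` by the
weight of a single dart, because the corner of a triangular face contains no virtual edge. The same
reason gives `turn_out`. -/
lemma turn_in (p : T.graph.Dart) (hp : p.snd = d.fst) (hne : p ≠ d₂) :
    turn S p d₂.symm = turn S p d + outN S d₂.symm := by
  have := osum_rot_left (S := S) h.h₀ (y := p.symm) hp.symm (by
    rw [h.r₀]
    exact fun h' => hne (SimpleGraph.Dart.symm_involutive.injective h').symm)
  rw [h.r₀] at this
  unfold turn
  linarith

lemma turn_out (s : T.graph.Dart) (hs : s.fst = d.snd) (hne : s ≠ d₁) :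
    turn S d₁.symm s = turn S d s + outN S d₁ := by
  have := osum_rot_right (S := S) h.h₁ (x := s) (hs.trans h.e₀) hne.symm
  rw [h.r₁] at this
  unfold turn
  rw [SimpleGraph.Dart.symm_symm]
  linarith

/-- The corner on the left is that of the triangle, in which nothing lies. So a triangle has total
turn three. -/
lemma turn_tri : turn S d d₁ = 1 := by
  have h1 := fan_rot (S := S) d₁
  rw [weight_of_notMem h.h₁, h.r₁] at h1
  rw [turn, osum, h1]
  ring

lemma turn_back (hS : T.IsSchnyderWood S) :
    turn S d₂.symm d₁.symm = -1 + outN S d₂ - outN S d₁ := by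
  have h1 : turn S d₁ d₂ = 1 := h.rotate.rotate.turn_tri
  have h2 := turn_rev (S := S) hS (d := d₁) (d' := d₂) h.e₁ (by
    rw [← h.r₂]; exact (rot_ne d₂).symm)
  rw [h2, h1]

end IsTri

lemma IsCyc.sameRegion_right_fan {l : List T.graph.Dart} (h : IsCyc l) {d d' z : T.graph.Dart}
    (hd : d ∈ l) (hd' : d' ∈ l) (hdd : d.snd = d'.fst) (hz : z ∈ T.fan d.symm d') :
    T.SameRegion (edgesOf l) d.symm z := by
  have := h.rev.sameRegion_left_fan (d := d'.symm) (d' := d.symm) (z := z) (by simpa) (by simpa)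
    hdd.symm (by simpa using hz)
  rwa [edgesOf_rev] at this

variable {l l' : List T.graph.Dart}

lemma edge_mem_of_mem {z : T.graph.Dart} (h : z ∈ l) : z.edge ∈ edgesOf l :=
  edge_mem_edgesOf.2 (.inl h)

lemma edge_mem_of_symm_mem {z : T.graph.Dart} (h : z.symm ∈ l) : z.edge ∈ edgesOf l :=
  edge_mem_edgesOf.2 (.inr h)

section Exchange

variable {d d₁ d₂ : T.graph.Dart} (h : IsTri d d₁ d₂) (hl : IsCyc l) (hl' : IsCyc l')
include h hl hl'

/-- Replacing the part of a cycle on a triangle to its left by the rest of the triangle removes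
that triangle from the left side. -/
lemma IsTri.exchange (hd : d ∈ l)
    (h1 : ∀ z ∈ l, z ∈ l' ∨ z ∈ T.face d)
    (h2 : ∀ z ∈ T.face d, z ∈ l ∨ z.symm ∈ l')
    (h3 : d₂.symm ∈ l') (h4 : d₂.edge ∉ edgesOf l) :
    T.left l' ⊆ T.left l \ T.face d ∧ T.right l' ⊆ T.right l ∪ T.face d := by
  have hf : ∀ z ∈ T.face d, z ∈ T.left l := fun z hz =>
    left_of_sameRegion (mem_left hd) (sameRegion_of_mem_face _ hz)
  constructor
  · refine hl'.left_subset (fun z => ?_) (fun z hz hzA => ?_) h3 ⟨?_, ?_⟩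
    · exact and_congr faceNext_mem_left (not_congr faceNext_mem_face_iff)
    · have hzl : z.edge ∉ edgesOf l := by
        intro hc
        rcases edge_mem_edgesOf.1 hc with hc | hc
        · exact (h1 z hc).elim (fun h' => hz (edge_mem_of_mem h')) hzA.2
        · exact hl.disjoint hzA.1 (by simpa using symm_mem_right hc)
      refine ⟨symm_mem_left hzA.1 hzl, fun hc => ?_⟩
      rcases h2 _ hc with hc | hc
      · exact hzl (edge_mem_of_symm_mem hc)
      · exact hz (edge_mem_of_mem (by simpa using hc))
    · exact symm_mem_left (hf _ ((h.mem _).2 (by simp))) h4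
    · intro hc
      rcases h2 _ hc with hc | hc
      · exact h4 (edge_mem_of_symm_mem hc)
      · rw [SimpleGraph.Dart.symm_symm] at hc
        exact hl'.symm_notMem hc h3
  · refine hl'.right_subset (fun z => ?_) (fun z hz hzA => ?_) h3
      (.inr (by rw [SimpleGraph.Dart.symm_symm]; exact (h.mem _).2 (by simp)))
    · exact or_congr faceNext_mem_right faceNext_mem_face_iff
    · rcases hzA with hzA | hzA
      · by_cases hzl : z.edge ∈ edgesOf l
        · rcases edge_mem_edgesOf.1 hzl with hc | hc
          · exact absurd hzA (hl.disjoint (mem_left hc))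
          · right
            exact (h1 _ hc).resolve_left fun h' => hz (edge_mem_of_symm_mem h')
        · exact .inl (symm_mem_right_of_notMem hzA hzl)
      · rcases h2 _ hzA with hc | hc
        · exact .inl (symm_mem_right hc)
        · exact absurd (edge_mem_of_symm_mem hc) hz

lemma IsTri.exchange_exterior (hd : d ∈ l)
    (h1 : ∀ z ∈ l, z ∈ l' ∨ z ∈ T.face d)
    (h2 : ∀ z ∈ T.face d, z ∈ l ∨ z.symm ∈ l')
    (h3 : d₂.symm ∈ l') (h4 : d₂.edge ∉ edgesOf l) :
    (T.root.symm ∈ T.left l' ↔ T.root.symm ∈ T.left l) ∧ T.left l' ⊂ T.left l := by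
  obtain ⟨a, b⟩ := h.exchange hl hl' hd h1 h2 h3 h4
  refine ⟨⟨fun h' => (a h').1, fun h' => ?_⟩, ?_⟩
  · rw [← not_not (a := _ ∈ T.left l'), hl'.notMem_left_iff]
    intro hc
    rcases b hc with hc | hc
    · exact hl.disjoint h' hc
    · exact h.face_disjoint hc root_symm_mem_exterior
  · exact ⟨fun z hz => (a hz).1, fun hc => (a (hc (mem_left hd))).2 (mem_face_self d)⟩

end Exchange

end InfiniteTriangulation

/-! ### Cutting a cycle by a triangle whose apex lies on it -/

namespace InfiniteTriangulation

variable {V : Type*} {T : InfiniteTriangulation V} {S : ColouredOrientation T.graph}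

/-- A cycle `d :: (p ++ q)` with a triangle `d d₁ d₂` on its left whose apex is the vertex between
`p` and `q`. -/
structure IsChord (d d₁ d₂ : T.graph.Dart) (p q : List T.graph.Dart) : Prop where
  tri : IsTri d d₁ d₂
  cyc : IsCyc (d :: (p ++ q))
  hp : IsSeg d.snd p d₂.fst
  hq : IsSeg d₂.fst q d.fst
  lp : 2 ≤ p.length
  lq : 2 ≤ q.length

namespace IsChord

variable {d d₁ d₂ : T.graph.Dart} {p q : List T.graph.Dart} (h : IsChord d d₁ d₂ p q)
include h

lemma p_ne : p ≠ [] := by rintro rfl; have := h.lp; simp at this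

lemma q_ne : q ≠ [] := by rintro rfl; have := h.lq; simp at this

lemma nodup : (∀ x ∈ p, x.fst ≠ d.fst) ∧ (∀ x ∈ q, x.fst ≠ d.fst) ∧
    (p.map fun d => d.fst).Nodup ∧ (q.map fun d => d.fst).Nodup ∧
    ∀ x ∈ p, ∀ y ∈ q, x.fst ≠ y.fst := by
  have := h.cyc.nodup
  simp only [List.map_cons, List.map_append, List.nodup_cons, List.nodup_append, List.mem_append,
    List.mem_map, not_or, not_exists, not_and] at this
  refine ⟨this.1.1, this.1.2, this.2.1, this.2.2.1, fun x hx y hy => ?_⟩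
  exact this.2.2.2 _ ⟨x, hx, rfl⟩ _ ⟨y, hy, rfl⟩

/-- Together with `cyc₂`, this is one of the two smaller cycles left when the triangle is removed.
The length bounds in `IsChord` ensure that both have at least three darts. -/
lemma cyc₁ : IsCyc (d₁.symm :: p) := by
  refine ⟨by have := h.lp; simp; omega, ?_, d₂.fst, h.tri.e₁, ?_⟩
  · rw [List.map_cons, List.nodup_cons]
    refine ⟨fun hc => ?_, h.nodup.2.2.1⟩
    obtain ⟨x, hx, hxt⟩ := List.mem_map.1 hc
    refine h.nodup.2.2.2.2 x hx _ (List.head_mem h.q_ne) ?_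
    rw [h.hq.fst_head, hxt]
    exact h.tri.e₁
  · have := h.hp
    rwa [h.tri.e₀] at this

lemma cyc₂ : IsCyc (d₂.symm :: q) := by
  refine ⟨by have := h.lq; simp; omega, ?_, d.fst, h.tri.e₂, h.hq⟩
  rw [List.map_cons, List.nodup_cons]
  refine ⟨fun hc => ?_, h.nodup.2.2.2.1⟩
  obtain ⟨x, hx, hxt⟩ := List.mem_map.1 hc
  exact h.nodup.2.1 x hx (hxt.trans h.tri.e₂)

/-- If a side of the triangle at the apex were on the cycle, then `p` or `q` would consist of that
single dart, which the length bounds exclude. -/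
lemma edge₁ : d₁.edge ∉ edgesOf (d :: (p ++ q)) := by
  obtain ⟨n1, n2, -, -, n5⟩ := h.nodup
  have hpm := List.head_mem h.p_ne
  have hqm := List.head_mem h.q_ne
  have hpf := h.hp.fst_head h.p_ne
  have hqf := h.hq.fst_head h.q_ne
  rw [edge_mem_edgesOf]
  rintro (hc | hc)
  · have he : d₁ = p.head h.p_ne := h.cyc.eq_of_fst_eq hc (by simp)
      (by rw [hpf, h.tri.e₀])
    have hp' := h.hp
    have hl := h.lp
    obtain ⟨a, b, p', rfl⟩ : ∃ a b p', p = a :: b :: p' := by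
      match p, hl with
      | a :: b :: p', _ => exact ⟨a, b, p', rfl⟩
    have h1 : b.fst = a.snd := hp'.2.1
    refine n5 b (by simp) _ hqm ?_
    rw [hqf, h1, ← h.tri.e₁, he]
    rfl
  · have he : d₁.symm = q.head h.q_ne := h.cyc.eq_of_fst_eq hc (by simp)
      (by rw [hqf]; exact h.tri.e₁)
    have hp' := h.hq
    have hl := h.lq
    obtain ⟨a, b, p', rfl⟩ : ∃ a b p', q = a :: b :: p' := by
      match q, hl with
      | a :: b :: p', _ => exact ⟨a, b, p', rfl⟩
    have h1 : b.fst = a.snd := hp'.2.1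
    refine n5 _ hpm b (by simp) ?_
    rw [hpf, h1, h.tri.e₀]
    exact congrArg (fun z : T.graph.Dart => z.snd) he

lemma edge₂ : d₂.edge ∉ edgesOf (d :: (p ++ q)) := by
  obtain ⟨n1, n2, -, -, n5⟩ := h.nodup
  have hpm := List.head_mem h.p_ne
  have hqm := List.head_mem h.q_ne
  have hpf := h.hp.fst_head h.p_ne
  have hqf := h.hq.fst_head h.q_ne
  rw [edge_mem_edgesOf]
  rintro (hc | hc)
  · have he : d₂ = q.head h.q_ne := h.cyc.eq_of_fst_eq hc (by simp) hqf.symm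
    have hp' := h.hq
    have hl := h.lq
    obtain ⟨a, b, p', rfl⟩ : ∃ a b p', q = a :: b :: p' := by
      match q, hl with
      | a :: b :: p', _ => exact ⟨a, b, p', rfl⟩
    have h1 : b.fst = a.snd := hp'.2.1
    refine n2 b (by simp) ?_
    rw [h1, ← h.tri.e₂]
    exact (congrArg (fun z : T.graph.Dart => z.snd) he).symm
  · have he : d₂.symm = d := h.cyc.eq_of_fst_eq hc (by simp) h.tri.e₂
    refine n5 _ hpm _ hqm ?_
    rw [hpf, hqf, ← he]
    rfl

lemma face_right₁ {z : T.graph.Dart} (hz : z ∈ T.face d) : z ∈ T.right (d₁.symm :: p) := by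
  have h1 : d₁ ∈ T.right (d₁.symm :: p) := by
    simpa using symm_mem_right (l := d₁.symm :: p) (d := d₁.symm) (by simp)
  have h2 := sameRegion_of_mem_face (edgesOf (d₁.symm :: p)) ((h.tri.mem d₁).2 (by simp))
  exact right_of_sameRegion h1 (h2.symm.trans (sameRegion_of_mem_face _ hz))

lemma face_right₂ {z : T.graph.Dart} (hz : z ∈ T.face d) : z ∈ T.right (d₂.symm :: q) := by
  have h1 : d₂ ∈ T.right (d₂.symm :: q) := by
    simpa using symm_mem_right (l := d₂.symm :: q) (d := d₂.symm) (by simp)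
  have h2 := sameRegion_of_mem_face (edgesOf (d₂.symm :: q)) ((h.tri.mem d₂).2 (by simp))
  exact right_of_sameRegion h1 (h2.symm.trans (sameRegion_of_mem_face _ hz))

lemma d_right₁ {z : T.graph.Dart} (hz : z.fst = d.fst) : z ∈ T.right (d₁.symm :: p) := by
  refine right_of_sameRegion (h.face_right₁ (mem_face_self d))
    (sameRegion_of_off h.cyc₁.seg hz.symm fun x hx => ?_)
  rcases List.mem_cons.1 hx with rfl | hx
  · intro hc
    refine d₂.adj.ne ?_
    rw [h.tri.e₂, ← hc, ← h.tri.e₁]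
    rfl
  · exact h.nodup.1 x hx

/-- Walking back along `q` from the tail of `d`, which is to the right of the first cycle, one never
meets that cycle before the apex. -/
lemma q_right₁ {z : T.graph.Dart} (hz : z ∈ q) :
    z ∈ T.right (d₁.symm :: p) ∧ z.symm ∈ T.right (d₁.symm :: p) := by
  have hd := h.d_right₁ (z := d) rfl
  have key := h.hq.rev.sameRegion_of_off h.cyc₁.seg (z := d) ?_ rfl z.symm (by simpa)
  · rw [SimpleGraph.Dart.symm_symm] at key
    exact ⟨right_of_sameRegion hd key.2, right_of_sameRegion hd key.1⟩
  · intro x hx y hy hxy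
    rw [mem_rev] at hx
    have hlast := List.getLast_mem h.p_ne
    have hls := h.hp.snd_getLast h.p_ne
    have hnt : x.fst ≠ d₂.fst := by
      intro hc
      have : x.symm = p.getLast h.p_ne :=
        h.cyc.eq_of_snd_eq (by simp [hx]) (by simp) (by rw [hls]; exact hc)
      exact h.nodup.2.2.2.2 _ hlast _ hx (by rw [← this])
    rcases List.mem_cons.1 hy with rfl | hy
    · exact hnt (hxy.symm.trans h.tri.e₁)
    · rcases h.hq.snd_mem hx with h1 | ⟨w, hw, h1⟩
      · exact h.nodup.1 y hy (hxy.trans h1)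
      · exact h.nodup.2.2.2.2 y hy w hw (hxy.trans h1.symm)

lemma p_right₂ {z : T.graph.Dart} (hz : z ∈ p) :
    z ∈ T.right (d₂.symm :: q) ∧ z.symm ∈ T.right (d₂.symm :: q) := by
  have hd := h.face_right₂ (z := d₁) ((h.tri.mem d₁).2 (by simp))
  have key := h.hp.sameRegion_of_off h.cyc₂.seg (z := d₁) ?_ h.tri.e₀.symm z hz
  · exact ⟨right_of_sameRegion hd key.1, right_of_sameRegion hd key.2⟩
  · intro x hx y hy hxy
    rcases List.mem_cons.1 hy with rfl | hy
    · exact h.nodup.1 x hx (hxy.symm.trans h.tri.e₂)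
    · exact h.nodup.2.2.2.2 x hx y hy hxy.symm

lemma left₁ : T.left (d₁.symm :: p) ⊂ T.left (d :: (p ++ q)) := by
  have hd : d ∈ T.left (d :: (p ++ q)) := mem_left (by simp)
  have hsub : T.left (d₁.symm :: p) ⊆ T.left (d :: (p ++ q)) ∩ T.left (d₁.symm :: p) := by
    refine h.cyc₁.left_subset (fun z => and_congr faceNext_mem_left faceNext_mem_left)
      (fun z hz hzA => ⟨symm_mem_left hzA.1 fun hc => ?_, symm_mem_left hzA.2 hz⟩)
      (c := d₁.symm) (by simp) ⟨?_, mem_left (by simp)⟩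
    · rcases edge_mem_edgesOf.1 hc with hc | hc
      · rcases List.mem_cons.1 hc with rfl | hc
        · exact h.cyc₁.disjoint hzA.2 (h.d_right₁ rfl)
        · rcases List.mem_append.1 hc with hc | hc
          · exact hz (edge_mem_of_mem (by simp [hc]))
          · exact h.cyc₁.disjoint hzA.2 (h.q_right₁ hc).1
      · exact h.cyc.disjoint hzA.1 (by simpa using symm_mem_right hc)
    · exact symm_mem_left (left_of_sameRegion hd (sameRegion_of_mem_face _
        ((h.tri.mem d₁).2 (by simp)))) h.edge₁
  exact ⟨fun z hz => (hsub hz).1, fun hc => h.cyc₁.disjoint (hc hd) (h.d_right₁ rfl)⟩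

lemma left₂ : T.left (d₂.symm :: q) ⊂ T.left (d :: (p ++ q)) := by
  have hd : d ∈ T.left (d :: (p ++ q)) := mem_left (by simp)
  have hsub : T.left (d₂.symm :: q) ⊆ T.left (d :: (p ++ q)) ∩ T.left (d₂.symm :: q) := by
    refine h.cyc₂.left_subset (fun z => and_congr faceNext_mem_left faceNext_mem_left)
      (fun z hz hzA => ⟨symm_mem_left hzA.1 fun hc => ?_, symm_mem_left hzA.2 hz⟩)
      (c := d₂.symm) (by simp) ⟨?_, mem_left (by simp)⟩
    · rcases edge_mem_edgesOf.1 hc with hc | hc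
      · rcases List.mem_cons.1 hc with rfl | hc
        · exact h.cyc₂.disjoint hzA.2 (h.face_right₂ (mem_face_self z))
        · rcases List.mem_append.1 hc with hc | hc
          · exact h.cyc₂.disjoint hzA.2 (h.p_right₂ hc).1
          · exact hz (edge_mem_of_mem (by simp [hc]))
      · exact h.cyc.disjoint hzA.1 (by simpa using symm_mem_right hc)
    · exact symm_mem_left (left_of_sameRegion hd (sameRegion_of_mem_face _
        ((h.tri.mem d₂).2 (by simp)))) h.edge₂
  exact ⟨fun z hz => (hsub hz).1,
    fun hc => h.cyc₂.disjoint (hc hd) (h.face_right₂ (mem_face_self d))⟩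

/-- With `left_disjoint`, this splits the left side into the left sides of the two smaller cycles
and the triangle, so the exterior face is to the left of at most one of the two. -/
lemma left_subset : T.left (d :: (p ++ q)) ⊆
    T.left (d₁.symm :: p) ∪ T.left (d₂.symm :: q) ∪ T.face d := by
  refine h.cyc.left_subset (c := d) (fun z => or_congr (or_congr faceNext_mem_left
    faceNext_mem_left) faceNext_mem_face_iff) (fun z hz hzA => ?_) (by simp)
    (.inr (mem_face_self d))
  rcases hzA with (hzA | hzA) | hzA
  · by_cases he : z.edge ∈ edgesOf (d₁.symm :: p)
    · rcases edge_mem_edgesOf.1 he with hc | hc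
      · rcases List.mem_cons.1 hc with rfl | hc
        · right
          rw [SimpleGraph.Dart.symm_symm]
          exact (h.tri.mem d₁).2 (by simp)
        · exact absurd (edge_mem_of_mem (by simp [hc])) hz
      · exact absurd (by simpa using symm_mem_right hc) (h.cyc₁.disjoint hzA)
    · exact .inl (.inl (symm_mem_left hzA he))
  · by_cases he : z.edge ∈ edgesOf (d₂.symm :: q)
    · rcases edge_mem_edgesOf.1 he with hc | hc
      · rcases List.mem_cons.1 hc with rfl | hc
        · right
          rw [SimpleGraph.Dart.symm_symm]
          exact (h.tri.mem d₂).2 (by simp)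
        · exact absurd (edge_mem_of_mem (by simp [hc])) hz
      · exact absurd (by simpa using symm_mem_right hc) (h.cyc₂.disjoint hzA)
    · exact .inl (.inr (symm_mem_left hzA he))
  · rcases (h.tri.mem z).1 hzA with rfl | rfl | rfl
    · exact absurd (edge_mem_of_mem (by simp)) hz
    · exact .inl (.inl (mem_left (by simp)))
    · exact .inl (.inr (mem_left (by simp)))

lemma left_disjoint : T.left (d₂.symm :: q) ⊆ T.right (d₁.symm :: p) := by
  have hsub : T.left (d₂.symm :: q) ⊆ T.right (d₁.symm :: p) ∩ T.left (d₂.symm :: q) := by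
    refine h.cyc₂.left_subset (fun z => and_congr faceNext_mem_right faceNext_mem_left)
      (fun z hz hzA => ⟨symm_mem_right_of_notMem hzA.1 fun hc => ?_, symm_mem_left hzA.2 hz⟩)
      (c := d₂.symm) (by simp) ⟨h.d_right₁ h.tri.e₂, mem_left (by simp)⟩
    rcases edge_mem_edgesOf.1 hc with hc | hc
    · exact h.cyc₁.disjoint (mem_left hc) hzA.1
    · rcases List.mem_cons.1 hc with hc | hc
      · have : z = d₁ := SimpleGraph.Dart.symm_involutive.injective hc
        exact h.cyc₂.disjoint hzA.2 (h.face_right₂ ((h.tri.mem z).2 (by simp [this])))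
      · have := (h.p_right₂ hc).2
        rw [SimpleGraph.Dart.symm_symm] at this
        exact h.cyc₂.disjoint hzA.2 this
  exact fun z hz => (hsub hz).1

/-- At the apex, the fan to the left of the cycle is composed of the corners of the two smaller
cycles and of the triangle; at the ends of `d` the corners change by one dart each. The indicators
of `d₁` and `d₂` cancel and the constants add up to −3, which agrees with 3 = 3 + 3 − 3. -/
lemma cturn_eq : cturn S (d :: (p ++ q)) =
    cturn S (d₁.symm :: p) + cturn S (d₂.symm :: q) - 3 := by
  have hp := h.p_ne
  have hq := h.q_ne
  have hd : d ∈ d :: (p ++ q) := by simp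
  have hph : p.head hp ∈ d :: (p ++ q) := by simp
  have hqh : q.head hq ∈ d :: (p ++ q) := by simp
  have hpl : p.getLast hp ∈ d :: (p ++ q) := by simp
  have hql : q.getLast hq ∈ d :: (p ++ q) := by simp
  have e1 := h.hp.fst_head hp
  have e2 := h.hp.snd_getLast hp
  have e3 := h.hq.fst_head hq
  have e4 := h.hq.snd_getLast hq
  have t1 := h.tri.turn_out (S := S) (p.head hp) e1 (fun hc => h.edge₁ (edge_mem_of_mem
    (by rw [← hc]; exact hph)))
  have t2 := h.tri.turn_in (S := S) (q.getLast hq) e4 (fun hc => h.edge₂ (edge_mem_of_mem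
    (by rw [← hc]; exact hql)))
  set x := q.head hq
  set y := p.getLast hp
  have hxy : x.fst = y.symm.fst := e3.trans e2.symm
  have hne : x ≠ y.symm := h.cyc.ne_symm hpl hqh
  -- The triangle is to the left of the cycle, so at the apex its side `d₂` lies in the left fan.
  have hd2 : d₂ ∈ T.fan x y.symm := by
    refine (mem_fan_or hxy hne e3.symm).resolve_right fun hc => ?_
    have h1 := h.cyc.sameRegion_right_fan hpl hqh (e2.trans e3.symm) hc
    have h2 : d₂ ∈ T.left (d :: (p ++ q)) := left_of_sameRegion (mem_left hd)
      (sameRegion_of_mem_face _ ((h.tri.mem d₂).2 (by simp)))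
    exact h.cyc.disjoint h2 (right_of_sameRegion (symm_mem_right hpl) h1)
  have hd2x : d₂ ≠ x := fun hc => h.edge₂ (edge_mem_of_mem (by rw [hc]; exact hqh))
  have hd1y : d₁.symm ≠ y.symm := by
    intro hc
    have : d₁ = y := SimpleGraph.Dart.symm_involutive.injective hc
    exact h.edge₁ (edge_mem_of_mem (by rw [this]; exact hpl))
  have s1 := sum_fan_split (weight S) hxy hd2 hd2x
  have s2 := osum_rot_left (S := S) h.tri.h₂ (y := y.symm) (by rw [← hxy, e3])
    (by rw [h.tri.r₂]; exact hd1y)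
  rw [h.tri.r₂] at s2
  have t3 : turn S y x = turn S d₂.symm x + turn S y d₁.symm - 1 - outN S d₂ - outN S d₁.symm := by
    have o1 : osum S x y.symm = osum S x d₂ + osum S d₂ y.symm + outN S d₂ := by
      unfold osum
      rw [s1]
      ring
    unfold turn
    rw [o1, s2, SimpleGraph.Dart.symm_symm]
    ring
  rw [cturn_cons _ (by simp [hp]), cturn_cons _ hp, cturn_cons _ hq, ts_append hp hq,
    List.head_append_of_ne_nil hp, List.getLast_append_of_ne_nil _ hq, t1, t2, t3, outN_symm,
    outN_symm]
  ring

end IsChord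

end InfiniteTriangulation

namespace InfiniteTriangulation

variable {V : Type*} {T : InfiniteTriangulation V} {S : ColouredOrientation T.graph}
  {l : List T.graph.Dart}

/-! ### The total turn of a cycle -/

lemma ts_rev (hS : T.IsSchnyderWood S) {u v : V} (hl : IsSeg u l v) (hne : l ≠ [])
    (hb : ∀ a ∈ l, ∀ b ∈ l, b ≠ a.symm) :
    ts S (rev l) = -ts S l + outN S (l.getLast hne) - outN S (l.head hne) := by
  induction l generalizing u with
  | nil => exact absurd rfl hne
  | cons a l ih =>
    cases l with
    | nil => simp [rev]
    | cons b l =>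
      have h1 := ih hl.2 (by simp) (fun a ha b hb' => hb a (by simp [ha]) b (by simp [hb']))
      have h2 := turn_rev (S := S) hS (d := a) (d' := b) hl.2.1.symm (hb a (by simp) b (by simp))
      have h3 : (rev (b :: l)).getLast (by simp [rev]) = b.symm := by simp [rev]
      rw [rev_cons, ts_append (by simp [rev]) (by simp), h1, h3, List.head_singleton, h2,
        List.getLast_cons (List.cons_ne_nil b l)]
      simp only [List.head_cons, ts_singleton, ts_cons_cons]
      ring

lemma cturn_rev (hS : T.IsSchnyderWood S) (h : IsCyc l) : cturn S (rev l) = -cturn S l := by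
  obtain ⟨u, hu⟩ := h.seg
  have hne := h.ne_nil
  have hrne : rev l ≠ [] := h.rev.ne_nil
  have h1 := ts_rev hS hu hne fun a ha b hb => h.ne_symm ha hb
  have h2 := turn_rev (S := S) hS (d := l.getLast hne) (d' := l.head hne)
    ((hu.snd_getLast hne).trans (hu.fst_head hne).symm)
    (h.ne_symm (List.getLast_mem hne) (List.head_mem hne))
  have h3 : (rev l).getLast hrne = (l.head hne).symm := by
    simp [rev, List.getLast_reverse]
  have h4 : (rev l).head hrne = (l.getLast hne).symm := by
    simp [rev, List.head_reverse]
  rw [cturn_eq_ts hrne, cturn_eq_ts hne, h1, h3, h4, h2]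
  ring

open Classical in
lemma virt_sub_one (v : V) : T.virt v - 1 =
    (if v = T.vr then 1 else 0) + if v = T.vy then 2 else 0 := by
  have := vr_ne_vy (T := T)
  unfold virt
  split_ifs <;> simp_all

/-- The turn of the exterior face. -/
lemma cturn_of_subset_exterior (h : IsCyc l) (hext : ∀ z ∈ l, z ∈ T.exterior) :
    cturn S l = -3 := by
  classical
  obtain ⟨u, hu⟩ := h.seg
  have hnext : ∀ a ∈ l, ∀ b ∈ l, a.snd = b.fst → b = T.faceNext a := fun a ha b hb hab =>
    eq_of_mem_exterior (hext b hb) (faceNext_mem_exterior.2 (hext a ha))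
      (by rw [faceNext_fst, hab])
  have hmem : ∀ z, z ∈ l ↔ T.faceNext z ∈ l := by
    intro z
    constructor
    · intro hz
      obtain ⟨b, hb, hzb⟩ := h.exists_next hz
      rw [← hnext z hz b hb hzb.symm]
      exact hb
    · intro hz
      obtain ⟨b, hb, hzb⟩ := h.exists_prev hz
      have := hnext b hb _ hz hzb
      rwa [faceNext_injective this]
  have hall : ∀ z ∈ T.exterior, z ∈ l := by
    intro z hz
    have h0 := List.head_mem h.ne_nil
    exact (mem_of_sameRegion (F := Set.univ) (A := {z | z ∈ l}) hmem
      (fun _ hd => absurd (Set.mem_univ _) hd)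
      (sameRegion_of_exterior _ (hext _ h0) hz)).1 h0
  have hchain : l.IsChain fun a b => b = T.faceNext a := by
    have key : ∀ (m : List T.graph.Dart) (a b : V), IsSeg a m b → (∀ z ∈ m, z ∈ l) →
        m.IsChain fun a b => b = T.faceNext a := by
      intro m
      induction m with
      | nil => intros; exact .nil
      | cons x m ih =>
        intro a b hm hml
        cases m with
        | nil => exact .singleton x
        | cons y m =>
          exact .cons_cons (hnext x (hml x (by simp)) y (hml y (by simp)) hm.2.1.symm)
            (ih _ _ hm.2 fun z hz => hml z (by simp [hz]))
    exact key l u u hu fun z hz => hz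
  have h1 := ts_eq_sum_map (S := S) T.faceNext h.ne_nil hchain (x := l.head h.ne_nil)
    (hnext _ (List.getLast_mem _) _ (List.head_mem _)
      ((hu.snd_getLast h.ne_nil).trans (hu.fst_head h.ne_nil).symm))
  rw [cturn_eq_ts h.ne_nil, h1]
  -- Only the exterior corner lies on the left here, and it holds nothing but the virtual edges.
  have h2 : ∀ z ∈ l, turn S z (T.faceNext z) = -(T.virt z.snd - 1) := by
    intro z hz
    have h3 := fan_rot (S := S) (T.faceNext z)
    rw [rot_faceNext, weight, if_pos (faceNext_mem_exterior.2 (hext z hz)), faceNext_fst] at h3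
    rw [turn, osum, h3]
    ring
  rw [List.map_congr_left h2]
  have h4 : (l.map fun z => -(T.virt z.snd - 1)) = (l.map fun z => z.snd).map
      fun v => -(T.virt v - 1) := by simp
  have hnd : (l.map fun z => z.snd).Nodup := by
    have := h.rev.nodup
    rwa [map_fst_rev, List.nodup_reverse] at this
  rw [h4, ← List.sum_toFinset _ hnd]
  simp only [virt_sub_one, neg_add, Finset.sum_add_distrib, Finset.sum_neg_distrib,
    Finset.sum_ite_eq']
  have hvr : T.vr ∈ (l.map fun z => z.snd) := by
    refine List.mem_map.2 ⟨_, hall _ root_symm_mem_exterior, rfl⟩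
  have hvy : T.vy ∈ (l.map fun z => z.snd) := by
    obtain ⟨b, hb, hzb⟩ := h.exists_prev (hall _ root_symm_mem_exterior)
    exact List.mem_map.2 ⟨b, hb, hzb⟩
  -- The excess of `virt` over one is 1 at `v_r`, 2 at `v_y` and 0 elsewhere; this gives −3.
  rw [if_pos (List.mem_toFinset.2 hvr), if_pos (List.mem_toFinset.2 hvy)]
  norm_num

/-- Replacing two consecutive triangle darts of a cycle by the third. -/
lemma cut_corner {d d₁ d₂ : T.graph.Dart} (h : IsTri d d₁ d₂)
    {q : List T.graph.Dart} (hl : IsCyc (d :: d₁ :: q)) (hq : 2 ≤ q.length) :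
    IsCyc (d₂.symm :: q) ∧ cturn S (d₂.symm :: q) = cturn S (d :: d₁ :: q) ∧
      (T.root.symm ∈ T.left (d₂.symm :: q) ↔ T.root.symm ∈ T.left (d :: d₁ :: q)) ∧
      T.left (d₂.symm :: q) ⊂ T.left (d :: d₁ :: q) := by
  have hne : q ≠ [] := by rintro rfl; simp at hq
  have hnd := hl.nodup
  simp only [List.map_cons, List.nodup_cons, List.mem_cons, List.mem_map, not_or, not_exists,
    not_and] at hnd
  have hq' : IsSeg d₁.snd q d.fst := by
    obtain ⟨u, hu⟩ := hl.seg
    have : u = d.fst := hu.1.symm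
    subst this
    exact hu.2.2
  have hcyc : IsCyc (d₂.symm :: q) := by
    refine ⟨by simp; omega, ?_, d.fst, h.e₂, by rw [h.e₁] at hq'; exact hq'⟩
    rw [List.map_cons, List.nodup_cons]
    refine ⟨fun hc => ?_, hnd.2.2⟩
    obtain ⟨x, hx, hxt⟩ := List.mem_map.1 hc
    exact hnd.1.2 x hx (hxt.trans h.e₂)
  have e1 := hq'.fst_head hne
  have e2 := hq'.snd_getLast hne
  have hdm : d ∈ d :: d₁ :: q := by simp
  have hqh : q.head hne ∈ d :: d₁ :: q := by simp
  have hql : q.getLast hne ∈ d :: d₁ :: q := by simp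
  have hedge : d₂.edge ∉ edgesOf (d :: d₁ :: q) := by
    rw [edge_mem_edgesOf]
    rintro (hc | hc)
    · have he : d₂ = q.head hne := hl.eq_of_fst_eq hc hqh (by rw [e1, h.e₁])
      obtain ⟨a, b, p', rfl⟩ : ∃ a b p', q = a :: b :: p' := by
        match q, hq with
        | a :: b :: p', _ => exact ⟨a, b, p', rfl⟩
      have h1 : b.fst = a.snd := hq'.2.1
      refine hnd.1.2 b (by simp) ?_
      rw [h1, ← h.e₂, he]
      rfl
    · have he : d₂.symm = d := hl.eq_of_fst_eq hc hdm h.e₂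
      have h1 : d.snd = d₂.fst := by rw [← he]; rfl
      refine d₁.adj.ne ?_
      rw [← h.e₀, h1, h.e₁]
  refine ⟨hcyc, ?_, h.exchange_exterior hl hcyc (by simp) ?_ ?_ (by simp) hedge⟩
  · have t1 : turn S d₂.symm (q.head hne) = turn S d₁ (q.head hne) + outN S d₂ :=
      h.rotate.rotate.turn_out (q.head hne) e1
        (fun hc => hedge (edge_mem_of_mem (by rw [← hc]; exact hqh)))
    have t2 := h.turn_in (S := S) (q.getLast hne) e2
      (fun hc => hedge (edge_mem_of_mem (by rw [← hc]; exact hql)))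
    rw [cturn_cons _ hne, cturn_cons _ (by simp), ts_cons _ hne, List.getLast_cons hne,
      List.head_cons, h.turn_tri, t1, t2, outN_symm]
    ring
  · intro z hz
    rcases List.mem_cons.1 hz with rfl | hz
    · exact .inr (mem_face_self _)
    · rcases List.mem_cons.1 hz with rfl | hz
      · exact .inr ((h.mem _).2 (by simp))
      · exact .inl (by simp [hz])
  · intro z hz
    rcases (h.mem z).1 hz with rfl | rfl | rfl <;> simp

/-- Induction on the number of darts on the left. Unless the cycle runs along the exterior face,
some dart has a triangle on its left; removing it gives smaller left sides. If the apex is off the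
cycle, one side is replaced by two; if it is adjacent along the cycle, two sides are replaced by
one; otherwise the cycle splits in two. -/
lemma cturn_of_finite (hS : T.IsSchnyderWood S) (n : ℕ) : ∀ l : List T.graph.Dart, IsCyc l →
    (T.left l).Finite → (T.left l).ncard = n →
    ((T.root.symm ∈ T.left l → cturn S l = -3) ∧ (T.root.symm ∉ T.left l → cturn S l = 3)) := by
  induction n using Nat.strong_induction_on with
  | _ n ih =>
  intro l hl hfin hcard
  have key : ∀ l' l'' : List T.graph.Dart, IsCyc l' → cturn S l' = cturn S l'' →
      T.left l'' = T.left l → (T.root.symm ∈ T.left l' ↔ T.root.symm ∈ T.left l'') →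
      T.left l' ⊂ T.left l'' → cturn S l'' = cturn S l → 
      ((T.root.symm ∈ T.left l → cturn S l = -3) ∧
        (T.root.symm ∉ T.left l → cturn S l = 3)) := by
    intro l' l'' hc ht hll hr hs ht'
    rw [hll] at hr hs
    have := ih _ (by rw [← hcard]; exact Set.ncard_lt_ncard hs hfin) l' hc
      (hfin.subset hs.1) rfl
    rw [hr, ht, ht'] at this
    exact this
  by_cases hext : ∀ z ∈ l, z ∈ T.exterior
  · have h0 := List.head_mem hl.ne_nil
    have : T.root.symm ∈ T.left l := left_of_sameRegion (mem_left h0)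
      (sameRegion_of_exterior _ (hext _ h0) root_symm_mem_exterior)
    exact ⟨fun _ => cturn_of_subset_exterior hl hext, fun h => absurd this h⟩
  push Not at hext
  obtain ⟨d, hd, hde⟩ := hext
  obtain ⟨s₁, s₂, rfl⟩ := List.append_of_mem hd
  have hl' := hl.rotate
  have hleft : T.left (d :: s₂ ++ s₁) = T.left (s₁ ++ d :: s₂) :=
    left_congr fun z => by simp only [List.mem_append]; tauto
  have hturn : cturn S (d :: s₂ ++ s₁) = cturn S (s₁ ++ d :: s₂) := cturn_rotate _ _
  rw [List.cons_append] at hl' hleft hturn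
  set s := s₂ ++ s₁
  clear_value s
  have tri := isTri hde
  set d₁ := T.faceNext d
  set d₂ := T.faceNext d₁
  clear_value d₁ d₂
  have hs : IsSeg d.snd s d.fst := by
    obtain ⟨u, hu⟩ := hl'.seg
    have : u = d.fst := hu.1.symm
    subst this
    exact hu.2
  have hsl : 2 ≤ s.length := by have := hl'.three_le; simp at this; omega
  have hsne : s ≠ [] := by rintro rfl; simp at hsl
  have hnd := hl'.nodup
  rw [List.map_cons, List.nodup_cons] at hnd
  have hsh : s.head hsne ∈ d :: s := by simp
  have hslt : s.getLast hsne ∈ d :: s := by simp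
  have e1 := hs.fst_head hsne
  have e2 := hs.snd_getLast hsne
  by_cases ht : ∃ x ∈ s, x.fst = d₂.fst
  · obtain ⟨x, hx, hxt⟩ := ht
    obtain ⟨p, q', rfl⟩ := List.append_of_mem hx
    set q := x :: q' with hqdef
    obtain ⟨w, hp, hq⟩ := isSeg_append.1 hs
    have hw : w = d₂.fst := by rw [← hxt]; exact hq.1.symm
    subst hw
    have hpne : p ≠ [] := by
      rintro rfl
      exact d₁.adj.ne (by rw [tri.e₁, ← tri.e₀]; exact hp)
    rcases (show p.length = 1 ∨ 2 ≤ p.length by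
      have := List.length_pos_of_ne_nil hpne; omega) with hp1 | hp2
    · obtain ⟨a, rfl⟩ := List.length_eq_one_iff.1 hp1
      have ha : a = d₁ := T.dart_ext (hp.1.trans tri.e₀) (hp.2.trans tri.e₁.symm)
      subst ha
      by_cases hq1 : q.length = 1
      · obtain ⟨b, hb⟩ := List.length_eq_one_iff.1 hq1
        rw [hb] at hq hl' hleft hturn
        have hbd : b = d₂ := T.dart_ext hq.1 (hq.2.trans tri.e₂.symm)
        subst hbd
        -- The cycle is the boundary of the triangle itself.
        have h0 : T.left (d :: ([a] ++ [b])) ⊆ T.face d := by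
          refine hl'.left_subset (c := d) (fun z => faceNext_mem_face_iff)
            (fun z hz hzA => absurd (edge_mem_of_mem ?_) hz) (by simp) (mem_face_self d)
          have := (tri.mem z).1 hzA
          simpa using this
        have h1 : T.root.symm ∉ T.left (s₁ ++ d :: s₂) := by
          rw [← hleft]
          exact fun hc => tri.face_disjoint (h0 hc) root_symm_mem_exterior
        refine ⟨fun h => absurd h h1, fun _ => ?_⟩
        have t1 : turn S d a = 1 := tri.turn_tri
        have t2 : turn S b d = 1 := tri.rotate.turn_tri
        have t3 : turn S a b = 1 := tri.rotate.rotate.turn_tri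
        rw [← hturn, cturn_cons _ (by simp)]
        simp [t1, t2, t3]
      · have hq2 : 2 ≤ q.length := by
          have : 0 < q.length := by simp [hqdef]
          omega
        obtain ⟨c1, c2, c3, c4⟩ := cut_corner tri hl' hq2
        exact key _ _ c1 c2 hleft c3 c4 hturn
    · by_cases hq1 : q.length = 1
      · obtain ⟨b, hb⟩ := List.length_eq_one_iff.1 hq1
        rw [hb] at hq hl' hleft hturn
        have hbd : b = d₂ := T.dart_ext hq.1 (hq.2.trans tri.e₂.symm)
        subst hbd
        have hl'' : IsCyc (b :: d :: p) := by
          have : IsCyc ((d :: p) ++ [b]) := hl'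
          exact this.rotate
        obtain ⟨c1, c2, c3, c4⟩ := cut_corner tri.rotate hl'' hp2
        refine key _ _ c1 c2 ?_ c3 c4 ?_
        · rw [← hleft]
          exact left_congr fun z => by simp only [List.mem_append, List.mem_cons]; tauto
        · rw [← hturn]
          exact cturn_rotate [b] (d :: p)
      · have hq2 : 2 ≤ q.length := by
          have : 0 < q.length := by simp [hqdef]
          omega
        have hc : IsChord d d₁ d₂ p q := ⟨tri, hl', hp, hq, hp2, hq2⟩
        have l1 := hc.left₁
        have l2 := hc.left₂
        have l3 := hc.left_subset
        have l4 := hc.left_disjoint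
        rw [hleft] at l1 l2 l3
        have i1 := ih _ (by rw [← hcard]; exact Set.ncard_lt_ncard l1 hfin) _ hc.cyc₁
          (hfin.subset l1.1) rfl
        have i2 := ih _ (by rw [← hcard]; exact Set.ncard_lt_ncard l2 hfin) _ hc.cyc₂
          (hfin.subset l2.1) rfl
        have ht := hc.cturn_eq (S := S)
        rw [hturn] at ht
        constructor
        · intro hr
          rcases l3 hr with (h1 | h1) | h1
          · have h2 : T.root.symm ∉ T.left (d₂.symm :: q) := fun h2 => hc.cyc₁.disjoint h1 (l4 h2)
            rw [ht, i1.1 h1, i2.2 h2]; norm_num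
          · have h2 : T.root.symm ∉ T.left (d₁.symm :: p) := fun h2 => hc.cyc₁.disjoint h2 (l4 h1)
            rw [ht, i1.2 h2, i2.1 h1]; norm_num
          · exact absurd root_symm_mem_exterior (tri.face_disjoint h1)
        · intro hr
          rw [ht, i1.2 fun h => hr (l1.1 h), i2.2 fun h => hr (l2.1 h)]; norm_num
  · push Not at ht
    -- The apex is off the cycle, so `d` can be replaced by the detour through it; the turn of −1 at
    -- the apex makes up for the changes at the ends of `d`.
    have hcyc : IsCyc (d₂.symm :: d₁.symm :: s) := by
      refine ⟨by simp; omega, ?_, d.fst, tri.e₂, tri.e₁, by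
        rw [tri.e₀] at hs; exact hs⟩
      simp only [List.map_cons, List.nodup_cons, List.mem_cons, List.mem_map, not_or, not_exists,
        not_and]
      refine ⟨⟨?_, fun x hx hxd => ?_⟩, fun x hx hxd => ?_, hnd.2⟩
      · intro hc
        refine d₂.adj.ne ?_
        rw [← tri.e₁]
        exact hc.symm
      · exact hnd.1 (List.mem_map.2 ⟨x, hx, hxd.trans tri.e₂⟩)
      · exact ht x hx (hxd.trans tri.e₁)
    have hoff : ∀ x ∈ d :: s, x.fst ≠ d₂.fst := by
      intro x hx
      rcases List.mem_cons.1 hx with rfl | hx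
      · intro hc
        exact d₂.adj.ne (by rw [tri.e₂, hc])
      · exact ht x hx
    have hed2 : d₂.edge ∉ edgesOf (d :: s) := edge_notMem_of_fst hl'.seg hoff
    have hed1 : d₁.edge ∉ edgesOf (d :: s) := by
      rw [← SimpleGraph.Dart.edge_symm]
      exact edge_notMem_of_fst hl'.seg fun x hx hc => hoff x hx (hc.trans tri.e₁)
    have t1 := tri.turn_out (S := S) (s.head hsne) e1
      (fun hc => hed1 (edge_mem_of_mem (by rw [← hc]; exact hsh)))
    have t2 := tri.turn_in (S := S) (s.getLast hsne) e2
      (fun hc => hed2 (edge_mem_of_mem (by rw [← hc]; exact hslt)))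
    obtain ⟨c3, c4⟩ := tri.exchange_exterior hl' hcyc (by simp)
      (fun z hz => by
        rcases List.mem_cons.1 hz with rfl | hz
        · exact .inr (mem_face_self _)
        · exact .inl (by simp [hz]))
      (fun z hz => by rcases (tri.mem z).1 hz with rfl | rfl | rfl <;> simp) (by simp) hed2
    refine key _ _ hcyc ?_ hleft c3 c4 hturn
    rw [cturn_cons _ (by simp), cturn_cons _ hsne, ts_cons _ hsne, List.getLast_cons hsne,
      List.head_cons, tri.turn_back hS, t1, t2, outN_symm]
    ring

/-! ### One-endedness -/

variable (T) in
lemma exists_dart_at (v : V) : ∃ d : T.graph.Dart, d.fst = v := by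
  have key : ∀ u w : V, T.graph.Walk u w → u ≠ w → ∃ d : T.graph.Dart, d.fst = u := by
    intro u w p hne
    cases p with
    | nil => exact absurd rfl hne
    | cons h p => exact ⟨⟨(_, _), h⟩, rfl⟩
  rcases eq_or_ne v T.vr with rfl | hne
  · exact ⟨T.root, rfl⟩
  · obtain ⟨p⟩ := T.connected.preconnected v T.vr
    exact key _ _ p hne

/-- The graph is connected, so every component of the complement of `K` contains one of the finitely
many neighbours of `K`. The infinite set `A` is a union of components, hence one of them is
infinite. -/
lemma exists_infinite_component {K : Set V} (hK : K.Finite) (hne : K.Nonempty) {A : Set V}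
    (hA : A.Infinite) (hAK : ∀ a ∈ A, a ∉ K)
    (hcl : ∀ a ∈ A, ∀ b, T.graph.Adj a b → b ∉ K → b ∈ A) :
    ∃ C : (T.graph.induce Kᶜ).ConnectedComponent, C.supp.Infinite ∧
      ∀ x ∈ C.supp, (x : V) ∈ A := by
  obtain ⟨k, hk⟩ := hne
  have hAcl : ∀ x y : (Kᶜ : Set V), (T.graph.induce Kᶜ).Reachable x y → (x : V) ∈ A →
      (y : V) ∈ A := by
    rintro x y ⟨p⟩
    induction p with
    | nil => exact id
    | @cons u v w h p ih => exact fun hx => ih (hcl _ hx _ h fun hv => v.2 hv)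
  by_contra! hc
  have hN : {y : (Kᶜ : Set V) | ∃ z ∈ K, T.graph.Adj z y}.Finite := by
    refine Set.Finite.of_finite_image (f := Subtype.val) ?_ Subtype.val_injective.injOn
    refine (hK.biUnion fun z _ => T.locallyFinite z).subset ?_
    rintro _ ⟨y, ⟨z, hz, hzy⟩, rfl⟩
    exact Set.mem_biUnion hz hzy
  have hreach : ∀ a, ∀ p : T.graph.Walk a k, ∀ ha : a ∉ K,
      ∃ y : (Kᶜ : Set V), (∃ z ∈ K, T.graph.Adj z y) ∧
        (T.graph.induce Kᶜ).Reachable ⟨a, ha⟩ y := by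
    intro a p
    induction p with
    | nil => exact fun ha => absurd hk ha
    | @cons u v w h p ih =>
      intro ha
      by_cases hv : v ∈ K
      · exact ⟨⟨u, ha⟩, ⟨v, hv, h.symm⟩, .refl _⟩
      · obtain ⟨y, hy, hr⟩ := ih hk hv
        refine ⟨y, hy, .trans (SimpleGraph.Adj.reachable ?_) hr⟩
        exact h
  apply hA
  refine (((hN.inter_of_left {y | (y : V) ∈ A}).biUnion (t := fun y =>
    Subtype.val '' ((T.graph.induce Kᶜ).connectedComponentMk y).supp) ?_)).subset ?_
  · rintro y ⟨-, hy⟩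
    refine Set.Finite.image _ (Set.not_infinite.1 fun hi => ?_)
    obtain ⟨x, hx, hxA⟩ := hc _ hi
    have : (T.graph.induce Kᶜ).Reachable y x := (SimpleGraph.ConnectedComponent.exact hx).symm
    exact hxA (hAcl y x this hy)
  · intro a ha
    obtain ⟨p⟩ := T.connected.preconnected a k
    obtain ⟨y, hy, hr⟩ := hreach a p (hAK a ha)
    refine Set.mem_biUnion ⟨hy, hAcl _ y hr ha⟩ ⟨⟨a, hAK a ha⟩, ?_, rfl⟩
    exact SimpleGraph.ConnectedComponent.sound hr

/-- If both sides had infinitely many darts, the complement of the finite vertex set of the cycle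
would have an infinite component on each side, against one-endedness. -/
lemma IsCyc.left_finite_or (h : IsCyc l) : (T.left l).Finite ∨ (T.right l).Finite := by
  by_contra! hc
  set K : Set V := {v | ∃ d ∈ l, d.fst = v} with hKdef
  have hK : K.Finite := by
    have : K = ((fun d : T.graph.Dart => d.fst) '' {d | d ∈ l}) := by
      ext v; simp [hKdef]
    rw [this]
    exact (List.finite_toSet l).image _
  have hne : K.Nonempty := ⟨_, _, List.head_mem h.ne_nil, rfl⟩
  have key : ∀ B : Set T.graph.Dart, B.Infinite →
      (∀ d e, T.SameRegion (edgesOf l) d e → d ∈ B → e ∈ B) →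
      ∃ C : (T.graph.induce Kᶜ).ConnectedComponent, C.supp.Infinite ∧
      ∀ x ∈ C.supp, ∀ d : T.graph.Dart, d.fst = x → d ∈ B := by
    intro B hB hcl
    have hoff : ∀ d e : T.graph.Dart, d.fst ∉ K → d.fst = e.fst → d ∈ B → e ∈ B := by
      intro d e hd hde hdB
      exact hcl _ _ (sameRegion_of_off h.seg hde fun x hx hxd => hd ⟨x, hx, hxd⟩) hdB
    have hinf : {v | v ∉ K ∧ ∃ d ∈ B, d.fst = v}.Infinite := by
      intro hfin
      apply hB
      refine ((hK.union hfin).biUnion fun v _ => T.finite_darts_at v).subset ?_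
      intro d hd
      refine Set.mem_biUnion (x := d.fst) ?_ rfl
      by_cases hdK : d.fst ∈ K
      · exact .inl hdK
      · exact .inr ⟨hdK, d, hd, rfl⟩
    obtain ⟨C, hC, hCA⟩ := exists_infinite_component (T := T) hK hne hinf (fun a ha => ha.1) (by
      rintro a ⟨haK, d, hd, rfl⟩ b hab hbK
      refine ⟨hbK, ⟨(b, d.fst), hab.symm⟩, ?_, rfl⟩
      have h1 := hoff d ⟨(d.fst, b), hab⟩ haK rfl hd
      refine hcl _ _ (InfiniteTriangulation.sameRegion_symm ?_) h1
      exact edge_notMem_of_fst h.seg fun x hx hxd => haK ⟨x, hx, hxd⟩)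
    refine ⟨C, hC, fun x hx d hd => ?_⟩
    obtain ⟨h1, e, he, hex⟩ := hCA x hx
    exact hoff e d (hex ▸ h1) (hex.trans hd.symm) he
  obtain ⟨C, hC, hCl⟩ := key (T.left l) hc.1 fun d e hde hd => left_of_sameRegion hd hde
  obtain ⟨D, hD, hDr⟩ := key (T.right l) hc.2 fun d e hde hd => right_of_sameRegion hd hde
  have := T.oneEnded K hK C D hC hD
  subst this
  obtain ⟨x, hx⟩ := hC.nonempty
  obtain ⟨d, hd⟩ := T.exists_dart_at x
  exact h.disjoint (hCl x hx d hd) (hDr x hx d hd)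

/-- The total turn of a cycle is three or minus three, as the exterior face is on its right or on
its left. -/
theorem cturn_eq (hS : T.IsSchnyderWood S) (h : IsCyc l) :
    (T.root.symm ∈ T.left l → cturn S l = -3) ∧ (T.root.symm ∉ T.left l → cturn S l = 3) := by
  rcases h.left_finite_or with hf | hf
  · exact cturn_of_finite hS _ l h hf rfl
  · rw [← left_rev] at hf
    have := cturn_of_finite hS _ _ h.rev hf rfl
    rw [cturn_rev hS h, left_rev] at this
    refine ⟨fun h1 => ?_, fun h1 => ?_⟩
    · have := this.2 (h.disjoint h1)
      linarith
    · have := this.1 (h.notMem_left_iff.1 h1)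
      linarith

end InfiniteTriangulation

namespace InfiniteTriangulation

variable {V : Type*} {T : InfiniteTriangulation V} {S : ColouredOrientation T.graph}
  {l : List T.graph.Dart}

/-! ### First repetitions -/

/-- Reading the walk from its end, the first repeated vertex closes up a simple cycle. The
hypothesis on reverses rules out closed walks of length two. -/
lemma IsSeg.nodup_or {u v : V} (hs : IsSeg u l v) (hb : ∀ x ∈ l, x.symm ∉ l) :
    ((l.map fun d => d.fst) ++ [v]).Nodup ∨ ∃ l₁ c l₂, l = l₁ ++ (c ++ l₂) ∧ IsCyc c := by
  induction l generalizing u with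
  | nil => simp
  | cons a l ih =>
    rcases ih hs.2 (fun x hx hx' => hb x (by simp [hx]) (by simp [hx'])) with h | ⟨l₁, c, l₂, rfl, h⟩
    swap
    · exact .inr ⟨a :: l₁, c, l₂, rfl, h⟩
    by_cases hm : a.fst ∈ (l.map fun d => d.fst) ++ [v]
    swap
    · left
      rw [List.map_cons, List.cons_append, List.nodup_cons]
      exact ⟨hm, h⟩
    right
    obtain ⟨m, l₂, rfl, hseg, hnot⟩ : ∃ m l₂, l = m ++ l₂ ∧ IsSeg a.snd m a.fst ∧
        (a.fst ∉ m.map fun d => d.fst) := by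
      rw [List.nodup_append] at h
      rcases List.mem_append.1 hm with hm | hm
      · obtain ⟨y, hy, hya⟩ := List.mem_map.1 hm
        obtain ⟨m, l₂, rfl⟩ := List.append_of_mem hy
        obtain ⟨w, h1, h2⟩ := isSeg_append.1 hs.2
        have hw : w = a.fst := by rw [← hya]; exact h2.1.symm
        subst hw
        refine ⟨m, y :: l₂, rfl, h1, fun hc => ?_⟩
        have h3 := h.1
        rw [List.map_append, List.nodup_append] at h3
        exact h3.2.2 _ hc _ (by simp) hya.symm
      · rw [List.mem_singleton] at hm
        refine ⟨l, [], by simp, by rw [hm]; exact hs.2, fun hc => ?_⟩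
        exact h.2.2 _ hc v (by simp) hm
    refine ⟨[], a :: m, l₂, rfl, ?_, ?_, a.fst, rfl, hseg⟩
    · match m, hseg with
      | [], hseg => exact absurd hseg.symm a.adj.ne
      | [b], hseg =>
        refine absurd (?_ : a.symm ∈ _) (hb a (by simp))
        have : a.symm = b := T.dart_ext hseg.1.symm hseg.2.symm
        simp [this]
      | b :: c :: m, _ => simp
    · rw [List.nodup_append, List.map_append, List.nodup_append] at h
      rw [List.map_cons, List.nodup_cons]
      exact ⟨hnot, h.1.1⟩

lemma symm_notMem_of_out (hout : ∀ x ∈ l, S.out x = true) : ∀ x ∈ l, x.symm ∉ l := by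
  intro x hx hx'
  have := out_symm_of_true (hout x hx)
  rw [hout _ hx'] at this
  cases this

/-- In a maximal Schnyder wood every directed cycle has the exterior face on its left. -/
lemma directed_cycle (hS : T.IsMaximalSchnyderWood S) (hl : IsCyc l)
    (hout : ∀ x ∈ l, S.out x = true) : T.root.symm ∈ T.left l ∧ cturn S l = -3 := by
  have h1 : T.root.symm ∈ T.left l := by
    by_contra hc
    rw [hl.notMem_left_iff] at hc
    obtain ⟨v, p, hp, hd⟩ := hl.exists_walk
    have h0 := List.head_mem hl.ne_nil
    refine hS.2.1 v p ⟨hp, fun d hdp => hout d (hd ▸ hdp), l.head hl.ne_nil, by rw [hd]; exact h0,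
      ?_⟩
    rw [edges_eq_edgesOf, hd]
    exact (hl.mem_right_iff h0).1 hc
  exact ⟨h1, (cturn_eq hS.1 hl).1 h1⟩

/-- A directed path without right turns: the colour stays or moves on to the next one. -/
def NoRight (S : ColouredOrientation T.graph) (a b : T.graph.Dart) : Prop :=
  S.colour b = S.colour a ∨ S.colour b = (S.colour a).next

lemma ts_nonneg (hS : T.IsSchnyderWood S) {u v : V} (hs : IsSeg u l v)
    (hout : ∀ x ∈ l, S.out x = true) (hc : l.IsChain (NoRight S)) : 0 ≤ ts S l := by
  induction l generalizing u with
  | nil => simp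
  | cons a l ih =>
    cases l with
    | nil => simp
    | cons b l =>
      rw [List.isChain_cons_cons] at hc
      have h1 := ih hs.2 (fun x hx => hout x (by simp [hx])) hc.2
      have h2 : 0 ≤ turn S a b := by
        rcases hc.1 with h | h
        · rw [turn_same hS hs.2.1.symm (hout a (by simp)) (hout b (by simp)) h]
        · rw [turn_next hS hs.2.1.symm (hout a (by simp)) (hout b (by simp)) h]; norm_num
      rw [ts_cons_cons]
      linarith

/-- Directed paths without right turns are simple. -/
lemma nodup_of_noRight (hS : T.IsMaximalSchnyderWood S) {u v : V} (hs : IsSeg u l v)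
    (hout : ∀ x ∈ l, S.out x = true) (hc : l.IsChain (NoRight S)) :
    ((l.map fun d => d.fst) ++ [v]).Nodup := by
  refine (hs.nodup_or (symm_notMem_of_out hout)).resolve_right ?_
  rintro ⟨l₁, c, l₂, rfl, hcyc⟩
  have hout' : ∀ x ∈ c, S.out x = true := fun x hx => hout x (by simp [hx])
  have h1 := (directed_cycle hS hcyc hout').2
  obtain ⟨w, hw⟩ := hcyc.seg
  have h2 := ts_nonneg hS.1 hw hout' hc.right_of_append.left_of_append
  -- The closing turn is the only one that may be a right turn, so the total is at least −1 and
  -- cannot be −3.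
  have h3 := neg_one_le_turn (S := S) hS.1
    ((hw.snd_getLast hcyc.ne_nil).trans (hw.fst_head hcyc.ne_nil).symm)
    (hout' _ (List.getLast_mem _)) (hout' _ (List.head_mem _))
  rw [cturn_eq_ts hcyc.ne_nil] at h1
  linarith

lemma neg_le_ts (hS : T.IsSchnyderWood S) {u v : V} (hs : IsSeg u l v) :
    -2 * (l.length : ℤ) ≤ ts S l := by
  induction l generalizing u with
  | nil => simp
  | cons a l ih =>
    cases l with
    | nil => simp
    | cons b l =>
      have h1 := ih hs.2
      have h2 := neg_two_le_turn (S := S) hS (d := a) (d' := b) hs.2.1.symm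
      rw [ts_cons_cons, List.length_cons]
      push_cast at *
      linarith

/-! ### Finite connected sets around the boundary -/

variable (T) in
/-- A finite connected set of vertices that contains the boundary. -/
structure IsCore (P : Finset V) : Prop where
  boundary : ∀ v ∈ T.boundary, v ∈ P
  conn : ∀ x ∈ P, ∃ p : T.graph.Walk x T.vr, ∀ z ∈ p.support, z ∈ P

variable (T) in
lemma boundary_finite : T.boundary.Finite := by
  have : T.boundary = (fun d : T.graph.Dart => d.fst) '' T.exterior := rfl
  rw [this]
  exact T.exterior_finite.image _

variable (T) in
-- The union of walks from the boundary and from `B` to `v_r`.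
lemma exists_core (B : Set V) (hB : B.Finite) : ∃ P : Finset V, T.IsCore P ∧ ∀ b ∈ B, b ∈ P := by
  classical
  have hw : ∀ v, Nonempty (T.graph.Walk v T.vr) := fun v => T.connected.preconnected v T.vr
  let w : ∀ v, T.graph.Walk v T.vr := fun v => (hw v).some
  set B' := (hB.union T.boundary_finite).toFinset with hB'
  refine ⟨B'.biUnion fun v => (w v).support.toFinset, ⟨fun v hv => ?_, fun x hx => ?_⟩,
    fun v hv => ?_⟩
  · simp only [Finset.mem_biUnion, List.mem_toFinset]
    exact ⟨v, by simp [hB', hv], (w v).start_mem_support⟩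
  · simp only [Finset.mem_biUnion, List.mem_toFinset] at hx
    obtain ⟨v, hv, hx⟩ := hx
    refine ⟨(w v).dropUntil x hx, fun z hz => ?_⟩
    simp only [Finset.mem_biUnion, List.mem_toFinset]
    exact ⟨v, hv, (w v).support_dropUntil_subset_support hx hz⟩
  · simp only [Finset.mem_biUnion, List.mem_toFinset]
    exact ⟨v, by simp [hB', hv], (w v).start_mem_support⟩

lemma IsCore.exists_path {P : Finset V} (hP : T.IsCore P) {x y : V} (hx : x ∈ P) (hy : y ∈ P) :
    ∃ m : List T.graph.Dart, IsSeg x m y ∧ ((m.map fun d => d.fst) ++ [y]).Nodup ∧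
      ∀ d ∈ m, d.fst ∈ P := by
  classical
  obtain ⟨p, hp⟩ := hP.conn x hx
  obtain ⟨q, hq⟩ := hP.conn y hy
  set r := (p.append q.reverse).bypass with hr
  refine ⟨r.darts, isSeg_darts r, ?_, fun d hd => ?_⟩
  · rw [SimpleGraph.Walk.map_fst_darts_append]
    exact (SimpleGraph.Walk.bypass_isPath _).support_nodup
  · have h1 := SimpleGraph.Walk.dart_fst_mem_support_of_mem_darts r hd
    have h2 := SimpleGraph.Walk.support_bypass_subset_support _ h1
    rw [SimpleGraph.Walk.mem_support_append_iff, SimpleGraph.Walk.support_reverse,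
      List.mem_reverse] at h2
    exact h2.elim (hp _) (hq _)

/-- A directed path without right turns that leaves a core and comes back to it has a bounded
number of left turns. -/
lemma IsCore.ts_le {P : Finset V} (hP : T.IsCore P) (hS : T.IsMaximalSchnyderWood S) {u v : V}
    (hs : IsSeg u l v) (hout : ∀ x ∈ l, S.out x = true) (hc : l.IsChain (NoRight S))
    (hu : u ∈ P) (hv : v ∈ P) (hl : 2 ≤ l.length) (hoff : ∀ x ∈ l, x.fst ≠ u → x.fst ∉ P) :
    ts S l ≤ 2 * P.card + 7 := by
  classical
  have hnd := nodup_of_noRight hS hs hout hc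
  have hne : l ≠ [] := by rintro rfl; simp at hl
  have huv : v ≠ u := by
    rintro rfl
    rw [List.nodup_append] at hnd
    exact hnd.2.2 v (List.mem_map.2 ⟨_, List.head_mem hne, hs.fst_head hne⟩) v (by simp) rfl
  obtain ⟨m, hm, hmnd, hmP⟩ := hP.exists_path hv hu
  have hmne : m ≠ [] := by rintro rfl; exact huv hm
  rw [List.nodup_append] at hnd hmnd
  have hcyc : IsCyc (l ++ m) := by
    refine ⟨by
      have := List.length_pos_of_ne_nil hmne
      rw [List.length_append]; omega, ?_, u, hs.append hm⟩
    rw [List.map_append, List.nodup_append]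
    refine ⟨hnd.1, hmnd.1, ?_⟩
    rintro a ha b hb rfl
    obtain ⟨x, hx, rfl⟩ := List.mem_map.1 ha
    obtain ⟨y, hy, hyx⟩ := List.mem_map.1 hb
    by_cases hxu : x.fst = u
    · exact hmnd.2.2 _ hb u (by simp) hxu
    · exact hoff x hx hxu (hyx ▸ hmP y hy)
  have h3 : cturn S (l ++ m) ≤ 3 := by
    by_cases h : T.root.symm ∈ T.left (l ++ m)
    · rw [(cturn_eq hS.1 hcyc).1 h]; norm_num
    · rw [(cturn_eq hS.1 hcyc).2 h]
  rw [cturn_append hne hmne] at h3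
  have h4 := neg_le_ts (S := S) hS.1 hm
  have h5 := neg_two_le_turn (S := S) hS.1
    ((hs.snd_getLast hne).trans (hm.fst_head hmne).symm)
  have h6 := neg_two_le_turn (S := S) hS.1
    ((hm.snd_getLast hmne).trans (hs.fst_head hne).symm)
  have h7 : m.length ≤ P.card := by
    have h8 : (m.map fun d => d.fst).toFinset ⊆ P := by
      intro x hx
      obtain ⟨y, hy, rfl⟩ := List.mem_map.1 (List.mem_toFinset.1 hx)
      exact hmP y hy
    have := Finset.card_le_card h8
    rwa [List.toFinset_card_of_nodup hmnd.1, List.length_map] at this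
  have h8 : (m.length : ℤ) ≤ P.card := by exact_mod_cast h7
  -- The bound collects 3 for the total turn of the cycle, 2 for each of the two joints, and 2 for
  -- each of the at most `P.card` darts of the path in the core.
  linarith

/-- A walk to the boundary that avoids an edge set stays in the exterior region. -/
lemma sameRegion_root {F : Set (Sym2 V)} {x : V} (p : T.graph.Walk x T.vr)
    (hp : ∀ z ∈ p.support, ∀ d : T.graph.Dart, d.fst = z → d.edge ∉ F) {d : T.graph.Dart}
    (hd : d.fst = x) : T.SameRegion F d T.root.symm := by
  have key : ∀ (x y : V) (p : T.graph.Walk x y),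
      (∀ z ∈ p.support, ∀ d : T.graph.Dart, d.fst = z → d.edge ∉ F) →
      ∀ d e : T.graph.Dart, d.fst = x → e.fst = y → T.SameRegion F d e := by
    intro x y p
    induction p with
    | nil =>
      intro h d e hd he
      exact sameRegion_of_fst_eq (hd.trans he.symm) fun z hz => h _ (by simp) z (hz.trans hd)
    | @cons u v w hadj p ih =>
      intro h d e hd he
      have h1 : T.SameRegion F d ⟨(u, v), hadj⟩ := sameRegion_of_fst_eq hd
        fun z hz => h _ (by simp) z (hz.trans hd)
      have h2 : T.SameRegion F ⟨(u, v), hadj⟩ (SimpleGraph.Dart.symm ⟨(u, v), hadj⟩) :=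
        sameRegion_symm (h u (by simp) _ rfl)
      exact (h1.trans h2).trans (ih (fun z hz => h z (by simp [hz])) _ e rfl he)
  exact (key x T.vr p hp d T.root hd rfl).trans
    (sameRegion_symm (hp _ p.end_mem_support _ rfl))

/-! ### Sequences of darts -/

/-- The list `s a, s (a + 1), …` with `n` terms. -/
def sl (s : ℕ → T.graph.Dart) (a n : ℕ) : List T.graph.Dart := (List.range n).map fun i => s (a + i)

variable {s : ℕ → T.graph.Dart} {a n : ℕ}

@[simp] lemma length_sl : (sl s a n).length = n := by simp [sl]

lemma mem_sl {z : T.graph.Dart} : z ∈ sl s a n ↔ ∃ i, a ≤ i ∧ i < a + n ∧ s i = z := by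
  simp only [sl, List.mem_map, List.mem_range]
  constructor
  · rintro ⟨i, hi, rfl⟩
    exact ⟨a + i, by omega, by omega, rfl⟩
  · rintro ⟨i, h1, h2, rfl⟩
    exact ⟨i - a, by omega, by rw [Nat.add_sub_cancel' h1]⟩

lemma sl_succ : sl s a (n + 1) = sl s a n ++ [s (a + n)] := by
  simp [sl, List.range_succ]

lemma sl_succ' : sl s a (n + 1) = s a :: sl s (a + 1) n := by
  simp only [sl, List.range_succ_eq_map, List.map_cons, List.map_map, add_zero]
  congr 1
  refine List.map_congr_left fun i _ => ?_
  simp only [Function.comp_apply]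
  congr 1
  omega

lemma sl_ne_nil (h : 0 < n) : sl s a n ≠ [] := by
  intro hc
  have := length_sl (s := s) (a := a) (n := n)
  rw [hc] at this
  simp at this
  omega

lemma head_sl (h : sl s a n ≠ []) : (sl s a n).head h = s a := by
  cases n with
  | zero => simp [sl] at h
  | succ n => simp [sl_succ']

lemma getLast_sl (h : sl s a n ≠ []) : (sl s a n).getLast h = s (a + n - 1) := by
  cases n with
  | zero => simp [sl] at h
  | succ n => simp [sl_succ]

lemma isSeg_sl (hs : ∀ i, a ≤ i → i + 1 < a + n → (s i).snd = (s (i + 1)).fst) (hn : 0 < n) :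
    IsSeg (s a).fst (sl s a n) (s (a + n - 1)).snd := by
  induction n with
  | zero => omega
  | succ n ih =>
    rcases Nat.eq_zero_or_pos n with rfl | h0
    · exact ⟨rfl, rfl⟩
    · rw [sl_succ]
      refine (ih (fun i h1 h2 => hs i h1 (by omega)) h0).append ⟨?_, rfl⟩
      have := hs (a + n - 1) (by omega) (by omega)
      rw [show a + n - 1 + 1 = a + n by omega] at this
      exact this.symm

lemma isChain_sl {R : T.graph.Dart → T.graph.Dart → Prop}
    (hs : ∀ i, a ≤ i → i + 1 < a + n → R (s i) (s (i + 1))) : (sl s a n).IsChain R := by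
  induction n generalizing a with
  | zero => simp [sl]
  | succ n ih =>
    rw [sl_succ', List.isChain_cons]
    refine ⟨fun y hy => ?_, ih fun i h1 h2 => hs i (by omega) (by omega)⟩
    cases n with
    | zero => simp [sl] at hy
    | succ n =>
      rw [sl_succ', List.head?_cons, Option.mem_some_iff] at hy
      rw [← hy]
      exact hs a le_rfl (by omega)

lemma ts_sl_succ (hn : 0 < n) :
    ts S (sl s a (n + 1)) = ts S (sl s a n) + turn S (s (a + n - 1)) (s (a + n)) := by
  rw [sl_succ, ts_append (sl_ne_nil hn) (by simp), getLast_sl]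
  simp

open Classical in
variable (S) in
/-- The directed walk that starts with the dart `z` and applies `f` to the colour in each step; it
stays at its last dart when it cannot go on. -/
noncomputable def walkSeq (f : Colour → Colour) (z : T.graph.Dart) : ℕ → T.graph.Dart
  | 0 => z
  | n + 1 =>
    if h : ∃ x : T.graph.Dart, x.fst = (walkSeq f z n).snd ∧ S.out x = true ∧
      S.colour x = f (S.colour (walkSeq f z n)) then h.choose else walkSeq f z n

lemma walkSeq_succ {f : Colour → Colour} {z : T.graph.Dart} {n : ℕ}
    (h : ∃ x : T.graph.Dart, x.fst = (walkSeq S f z n).snd ∧ S.out x = true ∧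
      S.colour x = f (S.colour (walkSeq S f z n))) :
    (walkSeq S f z (n + 1)).fst = (walkSeq S f z n).snd ∧ S.out (walkSeq S f z (n + 1)) = true ∧
      S.colour (walkSeq S f z (n + 1)) = f (S.colour (walkSeq S f z n)) := by
  rw [walkSeq, dif_pos h]
  exact h.choose_spec

/-- The cyclic order of three darts does not depend on the first. -/
lemma mem_fan_rotate {x y z : T.graph.Dart} (hxy : x.fst = y.fst) (hne : x ≠ y) 
    (hz : z ∈ T.fan x y) (hzx : z ≠ x) : y ∈ T.fan z x := by
  have hzf := fst_of_mem_fan hz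
  have hzy : z ≠ y := by rintro rfl; exact right_notMem_fan hxy hne hz
  refine (mem_fan_or (x := z) (y := x) hzf hzx (hxy.symm.trans hzf.symm)).resolve_right fun hy => ?_
  have h1 := sum_fan_split (fun _ => (1 : ℤ)) hxy hz hzx
  have h2 := sum_fan_split (fun _ => (1 : ℤ)) hzf.symm hy hne.symm
  have h3 : 0 < (T.fan y z).card := Finset.card_pos.2 ⟨y, left_mem_fan (hxy.symm.trans hzf.symm)⟩
  have h4 : 0 < (T.fan z y).card := Finset.card_pos.2 ⟨z, left_mem_fan (hzf.trans hxy)⟩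
  simp only [Finset.sum_const, nsmul_eq_mul, mul_one] at h1 h2
  omega

end InfiniteTriangulation

namespace InfiniteTriangulation

variable {V : Type*} {T : InfiniteTriangulation V} {S : ColouredOrientation T.graph}

/-! ### The two sides of a two-ended infinite path -/

/-- A chain of region steps is finite and crosses finitely many edges, so edges that avoid a
suitable finite set of vertices cannot block it. -/
lemma sameRegion_local {F : Set (Sym2 V)} {a b : T.graph.Dart} (h : T.SameRegion F a b) :
    ∃ K : Set V, K.Finite ∧ ∀ F' : Set (Sym2 V), (∀ e ∈ F', e ∈ F ∨ ∀ v ∈ K, v ∉ e) →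
      T.SameRegion F' a b := by
  induction h with
  | rel x y h =>
    rcases h with rfl | ⟨rfl, h⟩
    · exact ⟨∅, Set.finite_empty, fun F' _ => sameRegion_faceNext F' x⟩
    · refine ⟨{x.fst}, Set.finite_singleton _, fun F' hF' => sameRegion_symm fun hc => ?_⟩
      rcases hF' _ hc with h1 | h1
      · exact h h1
      · exact h1 x.fst rfl (Sym2.mem_mk_left _ _)
  | refl x => exact ⟨∅, Set.finite_empty, fun F' _ => T.sameRegion_refl F' x⟩
  | symm x y _ ih =>
    obtain ⟨K, hK, h⟩ := ih
    exact ⟨K, hK, fun F' hF' => (h F' hF').symm⟩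
  | trans x y z _ _ h1 h2 =>
    obtain ⟨K, hK, h1⟩ := h1
    obtain ⟨K', hK', h2⟩ := h2
    refine ⟨K ∪ K', hK.union hK', fun F' hF' => (h1 F' fun e he => ?_).trans
      (h2 F' fun e he => ?_)⟩
    · exact (hF' e he).imp id fun h v hv => h v (.inl hv)
    · exact (hF' e he).imp id fun h v hv => h v (.inr hv)

/-- A two-ended infinite path separates its left side from its right side. -/
theorem not_sameRegion_symm {γ : ℤ → T.graph.Dart} (hch : ∀ i, (γ i).snd = (γ (i + 1)).fst)
    (hinj : Function.Injective fun i => (γ i).fst) (i : ℤ) :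
    ¬ T.SameRegion {e | ∃ j, e = (γ j).edge} (γ i) (γ i).symm := by
  intro h
  obtain ⟨K, hK, hloc⟩ := sameRegion_local h
  obtain ⟨N, hN⟩ : ∃ N : ℕ, i.natAbs ≤ N ∧ ∀ k : ℤ, (γ k).fst ∈ K → k.natAbs ≤ N := by
    have h1 : {k : ℤ | (γ k).fst ∈ K}.Finite := hK.preimage hinj.injOn
    obtain ⟨B, hB⟩ := (h1.image Int.natAbs).bddAbove
    exact ⟨max i.natAbs B, le_max_left _ _,
      fun k hk => (hB ⟨k, hk, rfl⟩).trans (le_max_right _ _)⟩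
  -- The set to be avoided: the vertices that matter for the region chain and a central stretch of
  -- the path.
  set W : Set V := K ∪ (fun k : ℤ => (γ k).fst) '' Set.Icc (-(N : ℤ)) N with hW
  have hWfin : W.Finite := hK.union ((Set.finite_Icc _ _).image _)
  have hoff : ∀ k : ℤ, N < k.natAbs → (γ k).fst ∈ Wᶜ := by
    rintro k hk (hc | ⟨k', hk', hc⟩)
    · have := hN.2 k hc; omega
    · have := hinj hc
      rw [Set.mem_Icc] at hk'
      omega
  have hadj : ∀ k, T.graph.Adj (γ k).fst (γ (k + 1)).fst := fun k => by
    rw [← hch]; exact (γ k).adj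
  set G := T.graph.induce Wᶜ
  have hup : ∀ n : ℕ, G.Reachable ⟨_, hoff (N + 1) (by omega)⟩ ⟨_, hoff (N + 1 + n) (by omega)⟩ := by
    intro n
    induction n with
    | zero => simp only [Nat.cast_zero, add_zero]; exact .refl _
    | succ n ih =>
      refine ih.trans (SimpleGraph.Adj.reachable ?_)
      have := hadj (N + 1 + n)
      rw [add_assoc _ (n : ℤ) 1] at this
      exact_mod_cast this
  have hdown : ∀ n : ℕ, G.Reachable ⟨_, hoff (-N - 1) (by omega)⟩
      ⟨_, hoff (-N - 1 - n) (by omega)⟩ := by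
    intro n
    induction n with
    | zero => simp only [Nat.cast_zero, sub_zero]; exact .refl _
    | succ n ih =>
      refine ih.trans (SimpleGraph.Adj.reachable ?_)
      have := (hadj (-N - 1 - (n + 1))).symm
      rw [sub_add_eq_add_sub, sub_add_eq_sub_sub, add_sub_right_comm, add_sub_cancel_right] at this
      push_cast
      exact this
  have hinf : ∀ (x : (Wᶜ : Set V)) (g : ℕ → ℤ) (hg : ∀ n, N < (g n).natAbs), g.Injective →
      (∀ n, G.Reachable x ⟨_, hoff (g n) (hg n)⟩) → (G.connectedComponentMk x).supp.Infinite := by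
    intro x g hg hgi hr
    refine Set.infinite_of_injective_forall_mem (f := fun n => ⟨_, hoff (g n) (hg n)⟩) ?_ ?_
    · intro a b hab
      exact hgi (hinj (congrArg Subtype.val hab))
    · intro n
      exact SimpleGraph.ConnectedComponent.sound (hr n).symm
  have h1 := hinf _ (fun n => N + 1 + n) (fun n => by omega) (fun a b h => by simpa using h) hup
  have h2 := hinf _ (fun n => -N - 1 - n) (fun n => by omega) (fun a b h => by simpa using h) hdown
  -- Both tails of the path lie in infinite components off `W`, which coincide by one-endedness. A
  -- path between the tails closes the central stretch to a cycle.
  have h3 := SimpleGraph.ConnectedComponent.exact (T.oneEnded W hWfin _ _ h1 h2)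
  obtain ⟨p, hp⟩ := h3.exists_isPath
  set ι := (SimpleGraph.Embedding.induce (Wᶜ : Set V) (G := T.graph)).toHom
  set m := (p.map ι).darts with hm
  have hseg : IsSeg (γ (N + 1)).fst m (γ (-N - 1)).fst := isSeg_darts _
  have hnd : ((m.map fun d => d.fst) ++ [(γ (-N - 1)).fst]).Nodup := by
    have := (hp.map (f := ι) Subtype.val_injective).support_nodup
    rwa [← SimpleGraph.Walk.map_fst_darts_append] at this
  have hmW : ∀ x ∈ m, x.fst ∈ Wᶜ := by
    intro x hx
    have := SimpleGraph.Walk.dart_fst_mem_support_of_mem_darts _ hx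
    rw [SimpleGraph.Walk.support_map, List.mem_map] at this
    obtain ⟨y, -, hy⟩ := this
    rw [← hy]
    exact y.2
  rw [List.nodup_append] at hnd
  set s : ℕ → T.graph.Dart := fun n => γ (-N - 1 + n) with hs
  have hsl : IsSeg (γ (-N - 1)).fst (sl s 0 (2 * N + 2)) (γ (N + 1)).fst := by
    have := isSeg_sl (s := s) (a := 0) (n := 2 * N + 2) (fun k _ _ => by
      simp only [hs, hch]
      push_cast
      rw [add_assoc]) (by omega)
    have e1 : (s (0 + (2 * N + 2) - 1)).snd = (γ (N + 1)).fst := by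
      simp only [hs, hch]
      congr 3
      have : ((0 + (2 * N + 2) - 1 : ℕ) : ℤ) = 2 * N + 1 := by omega
      rw [this]; ring
    rw [e1] at this
    simpa [hs] using this
  have hmne : m ≠ [] := by
    intro h0
    rw [h0] at hseg
    have := hinj hseg
    omega
  set c := sl s 0 (2 * N + 2) ++ m with hc
  have hcyc : IsCyc c := by
    refine ⟨?_, ?_, _, hsl.append hseg⟩
    · have := List.length_pos_of_ne_nil hmne
      rw [hc, List.length_append, length_sl]
      omega
    · rw [hc, List.map_append, List.nodup_append]
      refine ⟨?_, hnd.1, ?_⟩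
      · rw [sl, List.map_map]
        refine List.Nodup.map ?_ List.nodup_range
        intro a b hab
        have := hinj hab
        simpa using this
      · rintro a ha b hb rfl
        obtain ⟨x, hx, rfl⟩ := List.mem_map.1 ha
        obtain ⟨y, hy, hyx⟩ := List.mem_map.1 hb
        obtain ⟨k, -, hk, rfl⟩ := mem_sl.1 hx
        rcases Nat.eq_zero_or_pos k with rfl | h0
        · refine hnd.2.2 _ hb _ (List.mem_singleton_self _) ?_
          simp [hs]
        · refine hmW y hy (.inr ⟨-N - 1 + k, ?_, hyx.symm⟩)
          rw [Set.mem_Icc]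
          omega
  -- The closing path misses `K`, so the region chain survives for the cycle, against planarity.
  have hreg := hloc (edgesOf c) fun e he => by
    obtain ⟨d, hd, rfl⟩ := he
    rcases List.mem_append.1 hd with hd | hd
    · obtain ⟨k, -, -, rfl⟩ := mem_sl.1 hd
      exact .inl ⟨_, rfl⟩
    · right
      have h4 : d.fst ∉ K := fun hk => hmW d hd (.inl hk)
      have h5 : d.snd ∉ K := by
        rcases hseg.snd_mem hd with h5 | ⟨y, hy, h5⟩
        · rw [h5]; exact fun hk => hoff (-N - 1) (by omega) (.inl hk)
        · rw [← h5]; exact fun hk => hmW y hy (.inl hk)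
      intro v hv hve
      rcases Sym2.mem_iff.1 hve with rfl | rfl
      · exact h4 hv
      · exact h5 hv
  have hic : γ i ∈ c := by
    refine List.mem_append_left _ (mem_sl.2 ⟨(i + N + 1).toNat, by omega, by omega, ?_⟩)
    simp only [hs]
    congr 1
    omega
  exact hcyc.disjoint (left_of_sameRegion (mem_left hic) hreg) (symm_mem_right hic)

/-! ### An Euler inequality -/

lemma mem_of_mem_face {A : Set T.graph.Dart} (hA : ∀ z, z ∈ A ↔ T.faceNext z ∈ A)
    {a z : T.graph.Dart} (ha : a ∈ A) (hz : z ∈ T.face a) : z ∈ A :=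
  (mem_of_sameRegion (F := Set.univ) hA (fun _ h => absurd (Set.mem_univ _) h)
    (sameRegion_of_mem_face _ hz)).1 ha

open Classical in
lemma card_eq_three_mul {G : Finset T.graph.Dart} (hG : ∀ z, z ∈ G ↔ T.faceNext z ∈ G)
    (hG' : ∀ z ∈ G, z ∉ T.exterior) : G.card = 3 * (G.image T.face).card := by
  rw [Finset.card_eq_sum_card_image T.face G, Finset.sum_const_nat (m := 3), mul_comm]
  intro F hF
  obtain ⟨a, ha, rfl⟩ := Finset.mem_image.1 hF
  rw [← T.triangular a (hG' a ha), ← Set.ncard_coe_finset]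
  congr 1
  ext z
  simp only [Finset.coe_filter, Set.mem_ofPred_eq]
  constructor
  · rintro ⟨-, h⟩
    rw [← h]
    exact mem_face_self z
  · intro h
    exact ⟨mem_of_mem_face (A := {z | z ∈ G}) hG ha h, face_eq_of_mem h⟩

lemma infinite_darts : Infinite T.graph.Dart := by
  have := T.infinite
  choose f hf using T.exists_dart_at
  exact Infinite.of_injective f fun a b h => by rw [← hf a, h, hf b]

/-- The number of vertices and faces of a connected finite subgraph is bounded by its number of
edges. The set `E` holds one dart for each edge, and `G` is the set of the darts of the faces. -/
theorem euler_le {D : Finset V} {E G : Finset T.graph.Dart} {b : V} (hb : b ∈ D)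
    (hE : ∀ e ∈ E, e.fst ∈ D ∧ e.snd ∈ D ∧ e.symm ∉ E)
    (hG : ∀ z, z ∈ G ↔ T.faceNext z ∈ G) (hG' : ∀ z ∈ G, z ∉ T.exterior)
    (hGE : ∀ z ∈ G, z ∈ E ∨ z.symm ∈ E)
    (hconn : ∀ f : V → ℚ, (∀ e ∈ E, f e.fst = f e.snd) → ∀ x ∈ D, f x = f b) :
    3 * D.card + G.card ≤ 3 * E.card + 3 := by
  classical
  set Fs := G.image T.face with hFs
  have hmem : ∀ z, T.face z ∈ Fs ↔ z ∈ G := by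
    intro z
    rw [hFs, Finset.mem_image]
    refine ⟨fun ⟨a, ha, haz⟩ => ?_, fun h => ⟨z, h, rfl⟩⟩
    exact mem_of_mem_face (A := {z | z ∈ G}) hG ha (haz ▸ mem_face_self z)
  let fe : (↥(D.erase b) → ℚ) → V → ℚ := fun f x => if h : x ∈ D.erase b then f ⟨x, h⟩ else 0
  let ph : (↥Fs → ℚ) → T.graph.Dart → ℚ := fun φ z => if h : T.face z ∈ Fs then φ ⟨_, h⟩ else 0
  have fe_add : ∀ f g x, fe (f + g) x = fe f x + fe g x := by
    intro f g x; simp only [fe]; split_ifs <;> simp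
  have fe_smul : ∀ (c : ℚ) f x, fe (c • f) x = c * fe f x := by
    intro c f x; simp only [fe]; split_ifs <;> simp
  have ph_add : ∀ f g x, ph (f + g) x = ph f x + ph g x := by
    intro f g x; simp only [ph]; split_ifs <;> simp
  have ph_smul : ∀ (c : ℚ) f x, ph (c • f) x = c * ph f x := by
    intro c f x; simp only [ph]; split_ifs <;> simp
  -- A map to functions on the edges, whose injectivity gives |D| − 1 + (number of faces) ≤ |E|: the
  -- difference of a vertex function along the edge plus the difference of a face function across
  -- it. The value at `b` is fixed to be zero, and so is the value on faces outside `G`.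
  let L : ((↥(D.erase b) → ℚ) × (↥Fs → ℚ)) →ₗ[ℚ] (↥E → ℚ) :=
    { toFun := fun x e => fe x.1 e.1.snd - fe x.1 e.1.fst + (ph x.2 e.1 - ph x.2 e.1.symm)
      map_add' := fun x y => by
        funext e
        simp only [Prod.fst_add, Prod.snd_add, fe_add, ph_add, Pi.add_apply]
        ring
      map_smul' := fun c x => by
        funext e
        simp only [Prod.smul_fst, Prod.smul_snd, fe_smul, ph_smul, Pi.smul_apply, smul_eq_mul,
          RingHom.id_apply]
        ring }
  have hinj : Function.Injective L := by
    rw [← LinearMap.ker_eq_bot, LinearMap.ker_eq_bot']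
    rintro ⟨f, φ⟩ h0
    have h1 : ∀ e ∈ E, fe f e.snd - fe f e.fst + (ph φ e - ph φ e.symm) = 0 := fun e he =>
      congrFun h0 ⟨e, he⟩
    have hΦ0 : ∀ z, z ∉ G → ph φ z = 0 := by
      intro z hz
      exact dif_neg (by rwa [hmem])
    have hΦn : ∀ z, ph φ (T.faceNext z) = ph φ z := by
      intro z
      have : T.face (T.faceNext z) = T.face z := face_eq_of_mem (faceNext_mem_face (mem_face_self z))
      simp only [ph, this]
    -- Around a face the differences of `f` add up to zero. Hence the two parts of `L` are
    -- orthogonal, and if their sum vanishes then each of them does.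
    have hsum : ∑ w ∈ G, (fe f w.snd - fe f w.fst) * ph φ w = 0 := by
      have h2 : ∑ w ∈ G, fe f w.snd * ph φ w = ∑ w ∈ G, fe f w.fst * ph φ w := by
        refine Finset.sum_bij (fun w _ => T.faceNext w) (fun w hw => (hG w).1 hw)
          (fun a _ c _ h => faceNext_injective h) (fun w hw => ?_) (fun w _ => ?_)
        · refine ⟨T.facePerm.symm w, ?_, T.facePerm.apply_symm_apply w⟩
          rw [hG]
          have h := T.facePerm.apply_symm_apply w
          rw [facePerm_apply] at h
          rw [h]
          exact hw
        · rw [hΦn, faceNext_fst]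
      simp only [sub_mul, Finset.sum_sub_distrib, h2, sub_self]
    have hsum2 : ∑ e ∈ E, (fe f e.snd - fe f e.fst) * (ph φ e - ph φ e.symm) = 0 := by
      set g : T.graph.Dart → ℚ := fun w => (fe f w.snd - fe f w.fst) * ph φ w with hg
      have h2 : ∀ e ∈ E, (fe f e.snd - fe f e.fst) * (ph φ e - ph φ e.symm) = g e + g e.symm := by
        intro e _
        simp only [hg]
        change _ = _ + (fe f e.fst - fe f e.snd) * _
        ring
      rw [Finset.sum_congr rfl h2, Finset.sum_add_distrib,
        ← Finset.sum_image (s := E) (g := SimpleGraph.Dart.symm) (f := g)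
          (fun a _ c _ h => SimpleGraph.Dart.symm_involutive.injective h),
        ← Finset.sum_union, ← hsum]
      · symm
        refine Finset.sum_subset (fun z hz => ?_) (fun z _ hz => ?_)
        · rw [Finset.mem_union, Finset.mem_image]
          exact (hGE z hz).imp id fun h => ⟨_, h, by simp⟩
        · simp only [hΦ0 z hz, mul_zero]
      · rw [Finset.disjoint_left]
        intro z hz hz'
        obtain ⟨y, hy, rfl⟩ := Finset.mem_image.1 hz'
        exact (hE y hy).2.2 hz
    have hsq : ∀ e ∈ E, fe f e.snd - fe f e.fst = 0 := by
      have h3 : ∑ e ∈ E, (fe f e.snd - fe f e.fst) ^ 2 = 0 := by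
        rw [← neg_eq_zero, ← Finset.sum_neg_distrib, ← hsum2]
        refine Finset.sum_congr rfl fun e he => ?_
        have := h1 e he
        have h4 : ph φ e - ph φ e.symm = -(fe f e.snd - fe f e.fst) := by linarith
        rw [h4]
        ring
      intro e he
      have := (Finset.sum_eq_zero_iff_of_nonneg fun e _ => sq_nonneg _).1 h3 e he
      exact pow_eq_zero_iff two_ne_zero |>.1 this
    have hf : f = 0 := by
      funext x
      have h4 := hconn (fe f) (fun e he => by have := hsq e he; linarith) x.1
        (Finset.mem_of_mem_erase x.2)
      have h5 : fe f b = 0 := dif_neg (by simp)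
      have h6 : fe f x.1 = f x := dif_pos x.2
      rw [← h6, h4, h5]
      rfl
    have hΦs : ∀ z, ph φ z.symm = ph φ z := by
      have hE' : ∀ e ∈ E, ph φ e.symm = ph φ e := by
        intro e he
        have h4 := h1 e he
        have h5 := hsq e he
        linarith
      intro z
      by_cases hz : z ∈ E
      · exact hE' z hz
      by_cases hz' : z.symm ∈ E
      · have := hE' _ hz'
        rw [SimpleGraph.Dart.symm_symm] at this
        exact this.symm
      · rw [hΦ0 z fun h => (hGE z h).elim hz hz', hΦ0 z.symm fun h => ?_]
        have := hGE _ h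
        rw [SimpleGraph.Dart.symm_symm] at this
        exact this.elim hz' hz
    -- The face function is now constant on all darts, and it is zero at a dart outside the finite
    -- set `G`.
    have := infinite_darts (T := T)
    obtain ⟨a, ha⟩ := Infinite.exists_notMem_finset G
    have hφ : ∀ z, ph φ z = 0 := by
      intro z
      have := all_of_closed (A := {z | ph φ z = 0}) (fun d => by
        simp only [Set.mem_ofPred_eq, hΦn]) (fun d hd => by
        simp only [Set.mem_ofPred_eq] at hd ⊢
        rw [hΦs, hd]) (a := a) (hΦ0 a ha) z
      exact this
    have hφ0 : φ = 0 := by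
      funext x
      obtain ⟨z, hz, hzx⟩ := Finset.mem_image.1 x.2
      have hz' : T.face z ∈ Fs := (hmem z).2 hz
      have h7 : ph φ z = φ ⟨_, hz'⟩ := dif_pos hz'
      have h8 : x = ⟨_, hz'⟩ := Subtype.ext hzx.symm
      rw [h8, ← h7, hφ]
      rfl
    rw [hf, hφ0]
    rfl
  have hfr := LinearMap.finrank_le_finrank_of_injective hinj
  rw [Module.finrank_prod, Module.finrank_fintype_fun_eq_card, Module.finrank_fintype_fun_eq_card,
    Module.finrank_fintype_fun_eq_card, Fintype.card_coe, Fintype.card_coe, Fintype.card_coe,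
    Finset.card_erase_of_mem hb] at hfr
  have h3 := card_eq_three_mul hG hG'
  rw [← hFs] at h3
  omega

end InfiniteTriangulation

/-- König's lemma: infinitely many predecessors give an infinite simple backward path. -/
lemma exists_backward_path {α : Type*} {R : α → α → Prop} (hf : ∀ w, {v | R v w}.Finite) {b : α}
    (hinf : {v | Relation.ReflTransGen R v b}.Infinite) :
    ∃ q : ℕ → α, q 0 = b ∧ Function.Injective q ∧ ∀ n, R (q (n + 1)) (q n) := by
  classical
  obtain ⟨P, hP0, hPs⟩ : ∃ P : ℕ → α → Prop, (∀ v, P 0 v ↔ v = b) ∧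
      ∀ n v, P (n + 1) v ↔ ∃ w, R v w ∧ P n w :=
    ⟨fun n => Nat.rec (fun v => v = b) (fun _ p v => ∃ w, R v w ∧ p w) n,
      fun _ => Iff.rfl, fun _ _ => Iff.rfl⟩
  -- The layer of the elements at distance exactly `n` from `b`. Steps of `R'` go down by one layer,
  -- so a path of such steps is simple.
  let L : ℕ → α → Prop := fun n v => P n v ∧ ∀ m < n, ¬ P m v
  have hL : ∀ {m n v}, L m v → L n v → m = n := by
    intro m n v h1 h2
    rcases lt_trichotomy m n with h | h | h
    · exact absurd h1.1 (h2.2 m h)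
    · exact h
    · exact absurd h2.1 (h1.2 n h)
  let R' : α → α → Prop := fun v w => R v w ∧ ∃ n, L n w ∧ L (n + 1) v
  have hR' : ∀ n v, L n v → Relation.ReflTransGen R' v b := by
    intro n
    induction n with
    | zero =>
      intro v hv
      rw [(hP0 v).1 hv.1]
    | succ n ih =>
      intro v hv
      obtain ⟨w, hvw, hw⟩ := (hPs n v).1 hv.1
      have hLw : L n w := ⟨hw, fun m hm hc => hv.2 (m + 1) (by omega) ((hPs _ _).2 ⟨w, hvw, hc⟩)⟩
      exact .head ⟨hvw, n, hLw, hv⟩ (ih w hLw)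
  have hsub : {v | Relation.ReflTransGen R v b} ⊆ {v | Relation.ReflTransGen R' v b} := by
    intro v hv
    have hP : ∃ n, P n v := by
      rw [Set.mem_ofPred_eq] at hv
      induction hv using Relation.ReflTransGen.head_induction_on with
      | refl => exact ⟨0, (hP0 _).2 rfl⟩
      | head h _ ih =>
        obtain ⟨n, hn⟩ := ih
        exact ⟨n + 1, (hPs _ _).2 ⟨_, h, hn⟩⟩
    exact hR' _ v ⟨Nat.find_spec hP, fun m hm => Nat.find_min hP hm⟩
  -- An element with infinitely many predecessors has finitely many direct ones, one of which must
  -- again have infinitely many.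
  have hstep : ∀ w : {w // {v | Relation.ReflTransGen R' v w}.Infinite},
      ∃ u : {w // {v | Relation.ReflTransGen R' v w}.Infinite}, R' u w := by
    rintro ⟨w, hw⟩
    refine by_contra fun hc => ?_
    push Not at hc
    refine hw (((Set.finite_singleton w).union ((((hf w).subset fun u hu =>
      hu.1 : {u | R' u w}.Finite)).biUnion (t := fun u => {v | Relation.ReflTransGen R' v u})
      fun u hu => ?_)).subset fun v hv => ?_)
    · by_contra h
      exact hc ⟨u, h⟩ hu
    · rcases Relation.ReflTransGen.cases_tail hv with h | ⟨u, h1, h2⟩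
      · exact .inl h.symm
      · exact .inr (Set.mem_biUnion h2 h1)
  choose g hg using hstep
  let q : ℕ → {w // {v | Relation.ReflTransGen R' v w}.Infinite} := fun n =>
    Nat.rec ⟨b, hinf.mono hsub⟩ (fun _ w => g w) n
  have hq : ∀ n, R' (q (n + 1)).1 (q n).1 := fun n => hg (q n)
  have hqL : ∀ n, L n (q n).1 := by
    intro n
    induction n with
    | zero => exact ⟨(hP0 _).2 rfl, fun m hm => absurd hm (Nat.not_lt_zero m)⟩
    | succ n ih =>
      obtain ⟨-, m, h1, h2⟩ := hq n
      obtain rfl := hL ih h1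
      exact h2
  refine ⟨fun n => (q n).1, rfl, fun m n h => hL (hqL m) ?_, fun n => (hq n).1⟩
  simp only at h
  rw [h]
  exact hqL n

namespace InfiniteTriangulation

variable {V : Type*} {T : InfiniteTriangulation V} {S : ColouredOrientation T.graph}

/-! ### Infinite directed paths without right turns -/

/-- An infinite directed path without right turns. -/
structure IsRay (S : ColouredOrientation T.graph) (s : ℕ → T.graph.Dart) : Prop where
  chain : ∀ i, (s i).snd = (s (i + 1)).fst
  out : ∀ i, S.out (s i) = true
  step : ∀ i, NoRight S (s i) (s (i + 1))

variable {s : ℕ → T.graph.Dart}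

lemma IsRay.shift (h : IsRay S s) (k : ℕ) : IsRay S fun i => s (k + i) :=
  ⟨fun _ => h.chain _, fun _ => h.out _, fun _ => h.step _⟩

lemma out_of_mem_sl {a n : ℕ} (h : ∀ i, S.out (s i) = true) : ∀ x ∈ sl s a n, S.out x = true := by
  intro x hx
  obtain ⟨i, -, -, rfl⟩ := mem_sl.1 hx
  exact h i

lemma IsRay.isSeg (h : IsRay S s) (a : ℕ) {n : ℕ} (hn : 0 < n) :
    IsSeg (s a).fst (sl s a n) (s (a + n)).fst := by
  have := isSeg_sl (s := s) (a := a) (n := n) (fun i _ _ => h.chain i) hn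
  rwa [h.chain, Nat.sub_add_cancel (by omega)] at this

lemma IsRay.isChain (h : IsRay S s) (a n : ℕ) : (sl s a n).IsChain (NoRight S) :=
  isChain_sl fun i _ _ => h.step i

lemma IsRay.injective (hS : T.IsMaximalSchnyderWood S) (h : IsRay S s) :
    Function.Injective fun i => (s i).fst := by
  have key : ∀ a b, a < b → (s a).fst ≠ (s b).fst := by
    intro a b hab hc
    have h1 := nodup_of_noRight hS (h.isSeg a (n := b - a) (by omega)) (out_of_mem_sl h.out)
      (h.isChain _ _)
    rw [List.nodup_append] at h1
    refine h1.2.2 (s a).fst (List.mem_map.2 ⟨s a, mem_sl.2 ⟨a, le_rfl, by omega, rfl⟩, rfl⟩) _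
      (List.mem_singleton_self _) ?_
    rw [hc, Nat.add_sub_cancel' hab.le]
  intro a b (hab : (s a).fst = (s b).fst)
  rcases lt_trichotomy a b with h1 | h1 | h1
  · exact absurd hab (key a b h1)
  · exact h1
  · exact absurd hab.symm (key b a h1)

lemma ts_sl_nonneg (hS : T.IsSchnyderWood S) (h : IsRay S s) (a n : ℕ) : 0 ≤ ts S (sl s a n) := by
  rcases Nat.eq_zero_or_pos n with rfl | hn
  · simp [sl]
  · exact ts_nonneg hS (h.isSeg a hn) (out_of_mem_sl h.out) (h.isChain _ _)

/-- The number of left turns is unbounded. -/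
lemma IsRay.exists_ts_lt (hS : T.IsSchnyderWood S) (h : IsRay S s)
    (hturn : ∀ N, ∃ i ≥ N, S.colour (s (i + 1)) = (S.colour (s i)).next) (B : ℤ) :
    ∃ N, ∀ n ≥ N, B < ts S (sl s 0 n) := by
  have hmono : ∀ m n, m ≤ n → ts S (sl s 0 m) ≤ ts S (sl s 0 n) := by
    intro m n hmn
    induction n, hmn using Nat.le_induction with
    | base => rfl
    | succ n hn ih =>
      rcases Nat.eq_zero_or_pos n with rfl | h0
      · exact ih.trans (by simp [sl])
      · rw [ts_sl_succ h0]
        have : 0 ≤ turn S (s (0 + n - 1)) (s (0 + n)) := by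
          obtain ⟨k, rfl⟩ : ∃ k, n = k + 1 := ⟨n - 1, by omega⟩
          have e : 0 + (k + 1) - 1 = k := by omega
          rw [e, zero_add]
          rcases h.step k with h1 | h1
          · rw [turn_same hS (h.chain k) (h.out _) (h.out _) h1]
          · rw [turn_next hS (h.chain k) (h.out _) (h.out _) h1]; norm_num
        linarith
  have hex : ∀ k : ℕ, ∃ N, (k : ℤ) ≤ ts S (sl s 0 N) := by
    intro k
    induction k with
    | zero => exact ⟨0, by simp [sl]⟩
    | succ k ih =>
      obtain ⟨N, hN⟩ := ih
      obtain ⟨i, hi, hc⟩ := hturn N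
      refine ⟨i + 1 + 1, ?_⟩
      rw [ts_sl_succ (by omega)]
      have e : 0 + (i + 1) - 1 = i := by omega
      rw [e, zero_add, turn_next hS (h.chain i) (h.out _) (h.out _) hc]
      have := hmono N (i + 1) (by omega)
      push_cast
      linarith
  obtain ⟨N, hN⟩ := hex (B.toNat + 1)
  refine ⟨N, fun n hn => ?_⟩
  have := hmono N n hn
  have := Int.self_le_toNat B
  push_cast at hN
  linarith

lemma notMem_fan_of_osum {x y z : T.graph.Dart} (h : osum S x y = 0) (hxy : x.fst = y.fst)
    (hz : S.out z = true) (hne : z ≠ x) : z ∉ T.fan x y := by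
  classical
  intro hm
  have h1 := Finset.add_sum_erase (T.fan x y) (weight S) (left_mem_fan hxy)
  have h2 := Finset.single_le_sum (f := weight S) (fun z _ => weight_nonneg z)
    (Finset.mem_erase.2 ⟨hne, hm⟩)
  have h3 : outN S z ≤ weight S z := by
    have := virt_pos (T := T) z.fst
    unfold weight; split_ifs <;> omega
  have h4 : outN S x ≤ weight S x := by
    have := virt_pos (T := T) x.fst
    unfold weight; split_ifs <;> omega
  rw [outN_of_true hz] at h3
  unfold osum at h
  linarith

lemma walkSeq_spec (hS : T.IsSchnyderWood S) {f : Colour → Colour} {z : T.graph.Dart}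
    (hz : S.out z = true) {n : ℕ} (h : ∀ m < n, (walkSeq S f z m).snd ∉ T.boundary) :
    S.out (walkSeq S f z n) = true ∧ ∀ m < n,
      (walkSeq S f z (m + 1)).fst = (walkSeq S f z m).snd ∧
      S.colour (walkSeq S f z (m + 1)) = f (S.colour (walkSeq S f z m)) := by
  induction n with
  | zero => exact ⟨hz, fun m hm => absurd hm (Nat.not_lt_zero m)⟩
  | succ n ih =>
    obtain ⟨h1, h2⟩ := ih fun m hm => h m (by omega)
    have h3 := walkSeq_succ (S := S) (f := f) (z := z) (n := n) (exists_out hS (h n (by omega)) _)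
    refine ⟨h3.2.1, fun m hm => ?_⟩
    rcases Nat.lt_succ_iff_lt_or_eq.1 hm with h4 | rfl
    · exact h2 m h4
    · exact ⟨h3.1, h3.2.2⟩

/-- An infinite path without right turns that leaves the core `P` at once, and an infinite
monochromatic path that goes straight on where the first path turns left at position `j`. -/
structure IsFork (S : ColouredOrientation T.graph) (P : Finset V) (s k : ℕ → T.graph.Dart)
    (j : ℕ) : Prop where
  core : T.IsCore P
  ray : IsRay S s
  start : (s 0).fst ∈ P
  off : ∀ i, 1 ≤ i → (s i).fst ∉ P
  pos : 1 ≤ j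
  left : S.colour (s j) = (S.colour (s (j - 1))).next
  branch : IsRay S k
  same : ∀ n, S.colour (k n) = S.colour (s (j - 1))
  fst_zero : (k 0).fst = (s j).fst
  branch_off : ∀ n, (k n).fst ∉ P
  prefix_ne : ∀ n i, i < j → (k n).fst ≠ (s i).fst

/-- The ray is cut at its last visit to the core, and a left turn is chosen after more than `2 *
P.card + 7` left turns. Going straight on there can never lead back to the core, by `IsCore.ts_le`,
so it can be continued forever: all vertices off the core are interior. -/
lemma exists_isFork (hS : T.IsMaximalSchnyderWood S) (h : IsRay S s)
    (hturn : ∀ N, ∃ i ≥ N, S.colour (s (i + 1)) = (S.colour (s i)).next) :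
    ∃ P s' k j, IsFork S P s' k j ∧
      ∀ N, ∃ i ≥ N, S.colour (s' (i + 1)) = (S.colour (s' i)).next := by
  classical
  obtain ⟨P, hP, hs0⟩ := T.exists_core {(s 0).fst} (Set.finite_singleton _)
  have hfin : {i | (s i).fst ∈ P}.Finite := P.finite_toSet.preimage (h.injective hS).injOn
  obtain ⟨a, haP, hmax⟩ := hfin.exists_maximal ⟨0, hs0 _ rfl⟩
  set s' : ℕ → T.graph.Dart := fun i => s (a + i) with hs'
  have hray : IsRay S s' := h.shift a
  have hoff : ∀ i, 1 ≤ i → (s' i).fst ∉ P := by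
    intro i hi hc
    have := hmax (show a + i ∈ {i | (s i).fst ∈ P} from hc) (by omega)
    omega
  have hturn' : ∀ N, ∃ i ≥ N, S.colour (s' (i + 1)) = (S.colour (s' i)).next := by
    intro N
    obtain ⟨i, hi, hc⟩ := hturn (a + N)
    obtain ⟨b, rfl⟩ := Nat.exists_eq_add_of_le (show a ≤ i by omega)
    exact ⟨b, by omega, hc⟩
  obtain ⟨N, hN⟩ := hray.exists_ts_lt hS.1 hturn' (2 * P.card + 7)
  obtain ⟨i, hi, hc⟩ := hturn' N
  have hlt := hN (i + 1) (by omega)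
  set k₀ := walkSeq S id (s' i) with hk₀
  have hi1 : ∀ n, S.out (k₀ n) = true ∧ (k₀ n).snd ∉ P ∧ ∀ m < n,
      (k₀ (m + 1)).fst = (k₀ m).snd ∧ S.colour (k₀ (m + 1)) = S.colour (k₀ m) := by
    intro n
    induction n using Nat.strong_induction_on with
    | _ n ih =>
      have h1 := walkSeq_spec hS.1 (f := id) (hray.out i) (n := n)
        fun m hm hb => (ih m hm).2.1 (hP.boundary _ hb)
      refine ⟨h1.1, fun hPn => ?_, h1.2⟩
      rcases Nat.eq_zero_or_pos n with rfl | hn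
      · refine hoff (i + 1) (by omega) ?_
        rw [← hray.chain]
        exact hPn
      have hseg : IsSeg (s' 0).fst (sl s' 0 (i + 1)) (k₀ 1).fst := by
        have := hray.isSeg 0 (n := i + 1) (by omega)
        rwa [zero_add, ← hray.chain, ← show k₀ 0 = s' i from rfl, ← (h1.2 0 hn).1] at this
      have hseg2 : IsSeg (k₀ 1).fst (sl k₀ 1 n) (k₀ n).snd := by
        have := isSeg_sl (s := k₀) (a := 1) (n := n) (fun m _ hm => (h1.2 m (by omega)).1.symm) hn
        rwa [Nat.add_sub_cancel_left] at this
      have hout2 : ∀ x ∈ sl k₀ 1 n, S.out x = true := by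
        intro x hx
        obtain ⟨m, hm1, hm2, rfl⟩ := mem_sl.1 hx
        rcases Nat.lt_or_ge m n with h2 | h2
        · exact (ih m h2).1
        · rw [show m = n by omega]; exact h1.1
      have hne1 : sl s' 0 (i + 1) ≠ [] := sl_ne_nil (by omega)
      have hne2 : sl k₀ 1 n ≠ [] := sl_ne_nil hn
      have hch2 : (sl k₀ 1 n).IsChain (NoRight S) :=
        isChain_sl fun m _ hm => .inl (h1.2 m (by omega)).2
      have hch : (sl s' 0 (i + 1) ++ sl k₀ 1 n).IsChain (NoRight S) := by
        refine List.IsChain.append (hray.isChain _ _) hch2 ?_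
        intro x hx y hy
        rw [List.getLast?_eq_some_getLast hne1, getLast_sl] at hx
        rw [List.head?_eq_some_head hne2, head_sl] at hy
        obtain rfl := (Option.mem_some.1 hx).symm
        obtain rfl := (Option.mem_some.1 hy).symm
        have e : 0 + (i + 1) - 1 = i := by omega
        rw [e]
        exact .inl (h1.2 0 hn).2
      have hle := hP.ts_le hS (hseg.append hseg2) (fun x hx => (List.mem_append.1 hx).elim
        (out_of_mem_sl hray.out x) (hout2 x)) hch (by simpa [hs'] using haP) hPn
        (by rw [List.length_append, length_sl, length_sl]; omega) (fun x hx hx0 => by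
          rcases List.mem_append.1 hx with hx | hx
          · obtain ⟨m, -, -, rfl⟩ := mem_sl.1 hx
            refine hoff m (Nat.pos_of_ne_zero ?_)
            rintro rfl
            exact hx0 rfl
          · obtain ⟨m, hm1, hm2, rfl⟩ := mem_sl.1 hx
            obtain ⟨m, rfl⟩ : ∃ k, m = k + 1 := ⟨m - 1, by omega⟩
            rw [(h1.2 m (by omega)).1]
            exact (ih m (by omega)).2.1)
      rw [ts_append hne1 hne2, getLast_sl, head_sl] at hle
      have h2 := ts_nonneg hS.1 hseg2 hout2 hch2
      have h3 : turn S (s' (0 + (i + 1) - 1)) (k₀ 1) = 0 := by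
        have e : 0 + (i + 1) - 1 = i := by omega
        rw [e]
        exact turn_same hS.1 (h1.2 0 hn).1.symm (hray.out i) (hout2 _ (mem_sl.2 ⟨1, by omega,
          by omega, rfl⟩)) (h1.2 0 hn).2
      linarith
  set k : ℕ → T.graph.Dart := fun n => k₀ (n + 1) with hk
  have hst : ∀ n, (k₀ (n + 1)).fst = (k₀ n).snd ∧ S.colour (k₀ (n + 1)) = S.colour (k₀ n) :=
    fun n => (hi1 (n + 1)).2.2 n (by omega)
  have hbr : IsRay S k := ⟨fun n => (hst _).1.symm, fun n => (hi1 _).1, fun n => .inl (hst _).2⟩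
  refine ⟨P, s', k, i + 1, ⟨hP, hray, by simpa [hs'] using haP, hoff, by omega, hc, hbr,
    fun n => ?_, ?_, fun n => ?_, ?_⟩, hturn'⟩
  · have : ∀ n, S.colour (k₀ n) = S.colour (s' i) := by
      intro n
      induction n with
      | zero => rfl
      | succ n ih => rw [(hst n).2, ih]
    exact this _
  · exact (hst 0).1.trans (hray.chain i)
  · change (k₀ (n + 1)).fst ∉ P
    rw [(hst n).1]
    exact (hi1 n).2.1
  · intro n m hm heq
    -- The stem followed by the straight branch is itself a ray, hence simple, so the branch does
    -- not meet the stem again.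
    set t : ℕ → T.graph.Dart := fun b => if b ≤ i then s' b else k₀ (b - i) with ht
    have ht1 : ∀ b, b ≤ i → t b = s' b := fun b hb => if_pos hb
    have ht2 : ∀ b, t (i + b) = k₀ b := by
      intro b
      rcases Nat.eq_zero_or_pos b with rfl | hb
      · exact ht1 _ le_rfl
      · simp only [ht]
        rw [if_neg (by omega), Nat.add_sub_cancel_left]
    have htr : IsRay S t := by
      have hcase : ∀ b, (t b = s' b ∧ t (b + 1) = s' (b + 1)) ∨
          ∃ c, t b = k₀ c ∧ t (b + 1) = k₀ (c + 1) := by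
        intro b
        rcases Nat.lt_or_ge b i with hb | hb
        · exact .inl ⟨ht1 b hb.le, ht1 _ hb⟩
        · obtain ⟨c, rfl⟩ := Nat.exists_eq_add_of_le hb
          exact .inr ⟨c, ht2 c, ht2 (c + 1)⟩
      constructor
      · intro b
        rcases hcase b with ⟨h1, h2⟩ | ⟨c, h1, h2⟩
        · rw [h1, h2, hray.chain]
        · rw [h1, h2, (hst c).1]
      · intro b
        rcases hcase b with ⟨h1, h2⟩ | ⟨c, h1, h2⟩
        · rw [h1]; exact hray.out b
        · rw [h1]; exact (hi1 c).1
      · intro b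
        rcases hcase b with ⟨h1, h2⟩ | ⟨c, h1, h2⟩
        · rw [h1, h2]; exact hray.step b
        · rw [h1, h2]; exact .inl (hst c).2
    have := htr.injective hS (a₁ := i + (n + 1)) (a₂ := m) (by
      simp only
      rw [ht2, ht1 m (by omega)]
      exact heq)
    omega

/-- The part of a path up to position `i` connects its vertices to the exterior face. -/
lemma IsFork.sameRegion_root {P : Finset V} {k : ℕ → T.graph.Dart} {j : ℕ} (h : IsFork S P s k j)
    {F : Set (Sym2 V)} {i : ℕ} (hP : ∀ d : T.graph.Dart, d.fst ∈ P → d.edge ∉ F)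
    (hs : ∀ b ≤ i, 1 ≤ b → ∀ d : T.graph.Dart, d.fst = (s b).fst → d.edge ∉ F)
    {d : T.graph.Dart} (hd : d.fst = (s i).fst) : T.SameRegion F d T.root.symm := by
  have hw : ∀ n, n ≤ i → ∃ p : T.graph.Walk (s n).fst T.vr,
      ∀ z ∈ p.support, z ∈ P ∨ ∃ b ≤ i, 1 ≤ b ∧ z = (s b).fst := by
    intro n hn
    induction n with
    | zero =>
      obtain ⟨p, hp⟩ := h.core.conn _ h.start
      exact ⟨p, fun z hz => .inl (hp z hz)⟩
    | succ n ih =>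
      obtain ⟨p, hp⟩ := ih (by omega)
      refine ⟨.cons (h.ray.chain n ▸ (s n).adj.symm) p, fun z hz => ?_⟩
      rw [SimpleGraph.Walk.support_cons, List.mem_cons] at hz
      rcases hz with rfl | hz
      · exact .inr ⟨n + 1, hn, by omega, rfl⟩
      · exact hp z hz
  obtain ⟨p, hp⟩ := hw i le_rfl
  refine InfiniteTriangulation.sameRegion_root p (fun z hz e he => ?_) hd
  rcases hp z hz with h1 | ⟨b, hb, hb1, h1⟩
  · exact hP e (he ▸ h1)
  · exact hs b hb hb1 e (he.trans h1)

/-- The monochromatic branch of a fork is disjoint from the other branch. -/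
lemma IsFork.disjoint (hS : T.IsMaximalSchnyderWood S) {P : Finset V} {k : ℕ → T.graph.Dart} {j : ℕ}
    (h : IsFork S P s k j) (b i : ℕ) (hb : 1 ≤ b) : (k b).fst ≠ (s i).fst := by
  intro hbi
  have hex : ∃ b, 1 ≤ b ∧ ∃ i, (k b).fst = (s i).fst := ⟨b, hb, i, hbi⟩
  classical
  obtain ⟨hb, i, hbi⟩ := Nat.find_spec hex
  have hmin : ∀ m < Nat.find hex, 1 ≤ m → ∀ i, (k m).fst ≠ (s i).fst := fun m hm h1 i hi =>
    Nat.find_min hex hm ⟨h1, i, hi⟩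
  set b := Nat.find hex
  have hinj := h.ray.injective hS
  have hkinj := h.branch.injective hS
  have hij : j < i := by
    rcases lt_trichotomy i j with h1 | rfl | h1
    · exact absurd hbi (h.prefix_ne b i h1)
    · have := hkinj (show (fun i => (k i).fst) b = (fun i => (k i).fst) 0 from
        hbi.trans h.fst_zero.symm)
      omega
    · exact h1
  obtain ⟨n, rfl⟩ := Nat.exists_eq_add_of_le hij.le
  have hn : 0 < n := by omega
  have hcol : S.colour (k 0) ≠ S.colour (s j) := by
    rw [h.same, h.left]; exact (Colour.next_ne _).symm
  have hseg1 : IsSeg (k 0).fst (sl k 0 b) (k b).fst := by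
    have := h.branch.isSeg 0 (n := b) hb
    rwa [zero_add] at this
  have hseg2 := h.ray.isSeg j hn
  have hseg3 : IsSeg (k b).fst (rev (sl s j n)) (k 0).fst := by
    rw [hbi, h.fst_zero]; exact hseg2.rev
  have hfst : ∀ x ∈ rev (sl s j n), ∃ m, j < m ∧ m ≤ j + n ∧ x.fst = (s m).fst := by
    intro x hx
    obtain ⟨m, h1, h2, h3⟩ := mem_sl.1 (mem_rev.1 hx)
    refine ⟨m + 1, by omega, by omega, ?_⟩
    rw [← h.ray.chain, h3]
    rfl
  have hk0 : ∀ m, j < m → (k 0).fst ≠ (s m).fst := by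
    intro m hm hc
    have := hinj (h.fst_zero.symm.trans hc)
    omega
  have hcyc : IsCyc (sl k 0 b ++ rev (sl s j n)) := by
    refine ⟨?_, ?_, _, hseg1.append hseg3⟩
    · rw [List.length_append, length_rev, length_sl, length_sl]
      by_contra hc
      obtain ⟨h1, rfl⟩ : b = 1 ∧ n = 1 := by omega
      have : k 0 = s j := T.dart_ext h.fst_zero (by
        rw [h.branch.chain, h.ray.chain, ← hbi]
        rw [h1])
      exact hcol (by rw [this])
    · rw [List.map_append, List.nodup_append]
      refine ⟨?_, ?_, ?_⟩
      · rw [sl, List.map_map]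
        refine List.Nodup.map ?_ List.nodup_range
        intro x y hxy
        have := hkinj hxy
        simpa using this
      · rw [map_fst_rev, List.nodup_reverse, sl, List.map_map]
        refine List.Nodup.map ?_ List.nodup_range
        intro x y hxy
        simp only [Function.comp_apply, h.ray.chain] at hxy
        have := hinj hxy
        omega
      · rintro x hx y hy rfl
        obtain ⟨d, hd, rfl⟩ := List.mem_map.1 hx
        obtain ⟨e, he, hed⟩ := List.mem_map.1 hy
        obtain ⟨m, h1, h2, h3⟩ := hfst e he
        obtain ⟨m', -, h5, rfl⟩ := mem_sl.1 hd
        rcases Nat.eq_zero_or_pos m' with rfl | h0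
        · exact hk0 m h1 (hed.symm.trans h3)
        · exact hmin m' (by omega) h0 m (hed.symm.trans h3)
  have hne1 : sl k 0 b ≠ [] := sl_ne_nil (by omega)
  have hne2 : sl s j n ≠ [] := sl_ne_nil hn
  have hne3 : rev (sl s j n) ≠ [] := by
    intro hc
    have := congrArg List.length hc
    rw [length_rev, length_sl] at this
    simp at this
    omega
  have hlast : (rev (sl s j n)).getLast hne3 = (s j).symm := by
    simp only [rev]
    rw [List.getLast_reverse, List.head_map, head_sl]
  -- The straight part contributes nothing, the reversed part at most zero, and the two joints at
  -- most one each. The total turn is at most 2, so it is not 3.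
  have hleft : T.root.symm ∈ T.left (sl k 0 b ++ rev (sl s j n)) := by
    by_contra hc
    have h3 := (cturn_eq hS.1 hcyc).2 hc
    rw [cturn_append hne1 hne3, ts_rev hS.1 hseg2 hne2 (by
      intro x hx y hy hxy
      exact symm_notMem_of_out (out_of_mem_sl h.ray.out) x hx (hxy ▸ hy)), getLast_sl, head_sl,
      getLast_sl, head_sl, outN_of_true (h.ray.out _), outN_of_true (h.ray.out _)] at h3
    have h4 := ts_sl_nonneg hS.1 h.ray j n
    have h5 : ts S (sl k 0 b) = 0 := by
      have : ∀ m, ts S (sl k 0 m) = 0 := by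
        intro m
        induction m with
        | zero => simp [sl]
        | succ m ih =>
          rcases Nat.eq_zero_or_pos m with rfl | h0
          · simp [sl]
          obtain ⟨m, rfl⟩ : ∃ c, m = c + 1 := ⟨m - 1, by omega⟩
          have e : 0 + (m + 1) - 1 = m := by omega
          rw [ts_sl_succ h0, ih, e, zero_add, zero_add, turn_same hS.1 (h.branch.chain m)
            (h.branch.out _) (h.branch.out _) ((h.same _).trans (h.same _).symm)]
      exact this b
    have h6 := turn_le_one (S := S) ((hseg1.snd_getLast hne1).trans (hseg3.fst_head hne3).symm)
    have h7 := turn_le_one (S := S) ((hseg3.snd_getLast hne3).trans (hseg1.fst_head hne1).symm)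
    rw [getLast_sl] at h6
    rw [head_sl] at h7
    linarith
  obtain ⟨j', rfl⟩ : ∃ c, j = c + 1 := ⟨j - 1, by have := h.pos; omega⟩
  set e := s j' with he
  have hef : e.symm.fst = (s (j' + 1)).fst := h.ray.chain j'
  have hkout := h.branch.out 0
  -- The anticlockwise order at the fork is: straight branch, turning branch, reverse of the stem.
  -- So the stem leaves the fork on the right of the cycle, and it connects that side to the
  -- exterior face.
  have hfan : e.symm ∈ T.fan (s (j' + 1)) (k 0) := by
    have h1 := (osum_in_out hS.1 (x := s (j' + 1)) (y := e.symm) hef.symm (h.ray.out _)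
      (out_symm_of_true (h.ray.out _))).1 (by rw [S.colour_symm]; exact h.left)
    have hks : k 0 ≠ s (j' + 1) := fun hc => hcol (by rw [hc])
    have h2 := notMem_fan_of_osum h1 hef.symm hkout hks
    have hne : s (j' + 1) ≠ e.symm := by
      intro hc
      have := h.ray.out (j' + 1)
      rw [hc, out_symm_of_true (h.ray.out _)] at this
      cases this
    have hke : k 0 ≠ e.symm := by
      intro hc
      rw [hc, out_symm_of_true (h.ray.out _)] at hkout
      cases hkout
    have h3 := (mem_fan_or (z := k 0) hef.symm hne h.fst_zero).resolve_left h2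
    have h4 := mem_fan_rotate hef hne.symm h3 hke
    exact mem_fan_rotate (h.fst_zero.trans hef.symm) hke h4 hks.symm
  have hF : ∀ d : T.graph.Dart, (∀ x ∈ sl k 0 b ++ rev (sl s (j' + 1) n), x.fst ≠ d.fst) →
      d.edge ∉ edgesOf (sl k 0 b ++ rev (sl s (j' + 1) n)) := fun d hd =>
    edge_notMem_of_fst hcyc.seg hd
  have hoffs : ∀ m ≤ j', ∀ d : T.graph.Dart, d.fst = (s m).fst →
      ∀ x ∈ sl k 0 b ++ rev (sl s (j' + 1) n), x.fst ≠ d.fst := by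
    intro m hm d hd x hx hxd
    rcases List.mem_append.1 hx with hx | hx
    · obtain ⟨m', -, -, rfl⟩ := mem_sl.1 hx
      exact h.prefix_ne m' m (by omega) (hxd.trans hd)
    · obtain ⟨m', h1, -, h2⟩ := hfst x hx
      have := hinj (h2.symm.trans (hxd.trans hd))
      omega
  have hreg : T.SameRegion (edgesOf (sl k 0 b ++ rev (sl s (j' + 1) n))) e T.root.symm := by
    refine h.sameRegion_root (i := j') (fun d hd => hF d fun x hx hxd => ?_)
      (fun m hm _ d hd => hF d (hoffs m hm d hd)) rfl
    rcases List.mem_append.1 hx with hx | hx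
    · obtain ⟨m', -, -, rfl⟩ := mem_sl.1 hx
      exact h.branch_off m' (hxd ▸ hd)
    · obtain ⟨m', h1, -, h2⟩ := hfst x hx
      exact h.off m' (by omega) (h2 ▸ hxd ▸ hd)
  have hes := InfiniteTriangulation.sameRegion_symm (hF e (hoffs j' le_rfl e rfl))
  have h8 := hcyc.sameRegion_right_fan (d := (s (j' + 1)).symm) (d' := k 0) (z := e.symm)
    (List.mem_append_right _ (mem_rev.2 (mem_sl.2 ⟨j' + 1, le_rfl, by omega, rfl⟩)))
    (List.mem_append_left _ (mem_sl.2 ⟨0, le_rfl, by omega, rfl⟩)) h.fst_zero.symm hfan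
  refine hcyc.disjoint hleft (right_of_sameRegion (symm_mem_right (d := (s (j' + 1)).symm)
    (List.mem_append_right _ (mem_rev.2 (mem_sl.2 ⟨j' + 1, le_rfl, by omega, rfl⟩)))) ?_)
  exact (h8.trans hes.symm).trans hreg

end InfiniteTriangulation

namespace InfiniteTriangulation

variable {V : Type*} {T : InfiniteTriangulation V} {S : ColouredOrientation T.graph}
  {s : ℕ → T.graph.Dart}

/-! ### The left side of a two-ended infinite path -/

/-- A two-ended infinite path. -/
structure IsLine (γ : ℤ → T.graph.Dart) : Prop where
  chain : ∀ i, (γ i).snd = (γ (i + 1)).fst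
  inj : Function.Injective fun i => (γ i).fst

/-- The edges of a two-ended infinite path. -/
def lineEdges (γ : ℤ → T.graph.Dart) : Set (Sym2 V) := {e | ∃ j, e = (γ j).edge}

/-- The darts whose left face lies to the left of a two-ended infinite path. -/
def lineLeft (γ : ℤ → T.graph.Dart) : Set T.graph.Dart :=
  {z | T.SameRegion (lineEdges γ) (γ 0) z}

/-- The darts of the edges on or to the left of a two-ended infinite path. -/
def lineSide (γ : ℤ → T.graph.Dart) : Set T.graph.Dart :=
  {z | z ∈ lineLeft γ ∨ z.symm ∈ lineLeft γ}

variable {γ : ℤ → T.graph.Dart}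

lemma IsLine.chain_sub (h : IsLine γ) (m : ℤ) : (γ m).fst = (γ (m - 1)).symm.fst := by
  have := h.chain (m - 1)
  rw [sub_add_cancel] at this
  exact this.symm

lemma IsLine.ne (h : IsLine γ) (m : ℤ) : γ m ≠ (γ (m - 1)).symm := by
  intro hc
  have h1 : (γ m).snd = (γ (m - 1)).fst := by rw [hc]; rfl
  rw [h.chain] at h1
  have := h.inj h1
  omega

lemma IsLine.eq_or (h : IsLine γ) {z : T.graph.Dart} {m : ℤ} (hz : z.fst = (γ m).fst)
    (hF : z.edge ∈ lineEdges γ) : z = γ m ∨ z = (γ (m - 1)).symm := by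
  obtain ⟨i, hi⟩ := hF
  rcases SimpleGraph.dart_edge_eq_iff _ _ |>.1 hi with rfl | rfl
  · exact .inl (by rw [h.inj hz])
  · right
    have h1 : (γ i).snd = (γ m).fst := hz
    rw [h.chain] at h1
    rw [← h.inj h1, add_sub_cancel_right]

lemma IsLine.sameRegion_fan (h : IsLine γ) {z : T.graph.Dart} {m : ℤ}
    (hz : z ∈ T.fan (γ m) (γ (m - 1)).symm) : T.SameRegion (lineEdges γ) (γ m) z := by
  refine sameRegion_of_mem_fan (h.chain_sub m) (fun y hy hne hF => ?_) z hz
  rcases h.eq_or (fst_of_mem_fan hy) hF with rfl | rfl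
  · exact hne rfl
  · exact right_notMem_fan (h.chain_sub m) (h.ne m) hy

lemma IsLine.sameRegion_fan' (h : IsLine γ) {z : T.graph.Dart} {m : ℤ}
    (hz : z ∈ T.fan (γ (m - 1)).symm (γ m)) : T.SameRegion (lineEdges γ) (γ (m - 1)).symm z := by
  refine sameRegion_of_mem_fan (h.chain_sub m).symm (fun y hy hne hF => ?_) z hz
  rcases h.eq_or ((fst_of_mem_fan hy).trans (h.chain_sub m).symm) hF with rfl | rfl
  · exact right_notMem_fan (h.chain_sub m).symm (h.ne m).symm hy
  · exact hne rfl

lemma IsLine.mem_lineLeft (h : IsLine γ) (m : ℤ) : γ m ∈ lineLeft γ := by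
  have hs : ∀ m, T.SameRegion (lineEdges γ) (γ m) (γ (m - 1)) := by
    intro m
    have := sameRegion_fan_symm (F := lineEdges γ) (h.chain_sub m) (fun y hy hne hF => by
      rcases h.eq_or (fst_of_mem_fan hy) hF with rfl | rfl
      · exact hne rfl
      · exact right_notMem_fan (h.chain_sub m) (h.ne m) hy)
    rwa [SimpleGraph.Dart.symm_symm] at this
  induction m with
  | zero => exact T.sameRegion_refl _ _
  | succ m ih =>
    have := hs (m + 1)
    rw [add_sub_cancel_right] at this
    exact Relation.EqvGen.trans _ _ _ ih this.symm
  | pred m ih => exact Relation.EqvGen.trans _ _ _ ih (hs _)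

lemma IsLine.symm_notMem_lineLeft (h : IsLine γ) (m : ℤ) : (γ m).symm ∉ lineLeft γ := fun hc =>
  not_sameRegion_symm h.chain h.inj m
    ((Relation.EqvGen.symm _ _ (h.mem_lineLeft m)).trans _ _ _ hc)

lemma symm_mem_lineLeft {z : T.graph.Dart} (hz : z.edge ∉ lineEdges γ) (h : z ∈ lineLeft γ) :
    z.symm ∈ lineLeft γ :=
  Relation.EqvGen.trans _ _ _ h (sameRegion_symm hz)

lemma symm_mem_lineSide {z : T.graph.Dart} (h : z ∈ lineSide γ) : z.symm ∈ lineSide γ := by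
  rcases h with h | h
  · exact .inr (by rwa [SimpleGraph.Dart.symm_symm])
  · exact .inl h

lemma faceNext_mem_lineLeft {z : T.graph.Dart} : T.faceNext z ∈ lineLeft γ ↔ z ∈ lineLeft γ :=
  ⟨fun h => Relation.EqvGen.trans _ _ _ h (Relation.EqvGen.symm _ _ (sameRegion_faceNext _ z)),
    fun h => Relation.EqvGen.trans _ _ _ h (sameRegion_faceNext _ z)⟩

/-- The fan on the right belongs to the region of the reversed path, which differs from the left
region by `not_sameRegion_symm`. -/
lemma IsLine.mem_lineLeft_iff (h : IsLine γ) {z : T.graph.Dart} {m : ℤ} (hz : z.fst = (γ m).fst) :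
    z ∈ lineLeft γ ↔ z ∈ T.fan (γ m) (γ (m - 1)).symm := by
  constructor
  · intro hl
    refine (mem_fan_or (h.chain_sub m) (h.ne m) hz).resolve_right fun hc => ?_
    exact h.symm_notMem_lineLeft (m - 1)
      (Relation.EqvGen.trans _ _ _ hl (Relation.EqvGen.symm _ _ (h.sameRegion_fan' hc)))
  · exact fun hf => Relation.EqvGen.trans _ _ _ (h.mem_lineLeft m) (h.sameRegion_fan hf)

lemma IsLine.mem_lineSide_iff (h : IsLine γ) {z : T.graph.Dart} {m : ℤ} (hz : z.fst = (γ m).fst) :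
    z ∈ lineSide γ ↔ z = (γ (m - 1)).symm ∨ z ∈ T.fan (γ m) (γ (m - 1)).symm := by
  rw [← h.mem_lineLeft_iff hz]
  constructor
  · rintro (hl | hl)
    · exact .inr hl
    · by_cases hF : z.edge ∈ lineEdges γ
      · rcases h.eq_or hz hF with rfl | rfl
        · exact .inr (h.mem_lineLeft m)
        · exact .inl rfl
      · right
        have := symm_mem_lineLeft (z := z.symm) (by rwa [SimpleGraph.Dart.edge_symm]) hl
        rwa [SimpleGraph.Dart.symm_symm] at this
  · rintro (rfl | hl)
    · exact .inr (by rw [SimpleGraph.Dart.symm_symm]; exact h.mem_lineLeft _)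
    · exact .inl hl

lemma IsLine.mem_lineLeft_of_off (h : IsLine γ) {y z : T.graph.Dart} (hv : ∀ m, z.fst ≠ (γ m).fst)
    (hz : z ∈ lineSide γ) (hy : y.fst = z.fst) : y ∈ lineLeft γ := by
  have hF : ∀ x : T.graph.Dart, x.fst = z.fst → x.edge ∉ lineEdges γ := by
    rintro x hx ⟨i, hi⟩
    rcases SimpleGraph.dart_edge_eq_iff _ _ |>.1 hi with rfl | rfl
    · exact hv i hx.symm
    · exact hv (i + 1) (by rw [← h.chain]; exact hx.symm)
  have hzl : z ∈ lineLeft γ := by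
    rcases hz with hz | hz
    · exact hz
    · have := symm_mem_lineLeft (z := z.symm) (by
        rw [SimpleGraph.Dart.edge_symm]; exact hF z rfl) hz
      rwa [SimpleGraph.Dart.symm_symm] at this
  exact Relation.EqvGen.trans _ _ _ hzl (sameRegion_of_fst_eq hy.symm hF)

lemma rot_mem_lineSide {z : T.graph.Dart} (h : z ∈ lineLeft γ) : T.rot z ∈ lineSide γ :=
  .inr (Relation.EqvGen.trans _ _ _ h (sameRegion_rot_symm _ z))

variable {P : Finset V} {k : ℕ → T.graph.Dart} {j : ℕ}

/-- The two-ended path formed by the two branches of a fork. -/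
def forkLine (s k : ℕ → T.graph.Dart) (j : ℕ) : ℤ → T.graph.Dart
  | .ofNat n => s (j + n)
  | .negSucc n => (k n).symm

lemma forkLine_natCast (n : ℕ) : forkLine s k j n = s (j + n) := rfl

lemma forkLine_neg (n : ℕ) : forkLine s k j (-(n : ℤ) - 1) = (k n).symm := by
  rw [show -(n : ℤ) - 1 = Int.negSucc n by rw [Int.negSucc_eq]; ring]
  rfl

lemma IsFork.forkLine_fst_neg (h : IsFork S P s k j) (n : ℕ) :
    (forkLine s k j (-(n : ℤ))).fst = (k n).fst := by
  cases n with
  | zero => exact h.fst_zero.symm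
  | succ n =>
    have := forkLine_neg (s := s) (k := k) (j := j) n
    rw [show -((n + 1 : ℕ) : ℤ) = -(n : ℤ) - 1 by push_cast; ring, this]
    exact h.branch.chain n

lemma IsFork.isLine (hS : T.IsMaximalSchnyderWood S) (h : IsFork S P s k j) :
    IsLine (forkLine s k j) := by
  constructor
  · intro i
    obtain ⟨n, rfl | rfl⟩ := i.eq_nat_or_neg
    · exact h.ray.chain _
    · cases n with
      | zero => exact h.ray.chain _
      | succ n =>
        rw [show -((n + 1 : ℕ) : ℤ) + 1 = -n by push_cast; ring, h.forkLine_fst_neg,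
          show -((n + 1 : ℕ) : ℤ) = -(n : ℤ) - 1 by push_cast; ring, forkLine_neg]
        rfl
  · have key : ∀ (m n : ℕ), (forkLine s k j m).fst = (forkLine s k j (-(n : ℤ))).fst → n = 0 := by
      intro m n hmn
      rw [h.forkLine_fst_neg] at hmn
      by_contra hn
      exact h.disjoint hS n (j + m) (by omega) hmn.symm
    intro a b hab
    obtain ⟨m, rfl | rfl⟩ := a.eq_nat_or_neg <;> obtain ⟨n, rfl | rfl⟩ := b.eq_nat_or_neg
    · have : j + m = j + n := h.ray.injective hS hab
      omega
    · obtain rfl := key m n hab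
      have : j + m = j + 0 := h.ray.injective hS hab
      omega
    · obtain rfl := key n m hab.symm
      have : j + 0 = j + n := h.ray.injective hS hab
      omega
    · simp only [h.forkLine_fst_neg] at hab
      have : m = n := h.branch.injective hS hab
      omega

open Classical in
/-- The darts on or to the left of a two-ended path with tail `v`. -/
noncomputable def sideAt (γ : ℤ → T.graph.Dart) (v : V) : Finset T.graph.Dart :=
  {z ∈ T.dartsAt v | z ∈ lineSide γ}

lemma mem_sideAt {v : V} {z : T.graph.Dart} : z ∈ sideAt γ v ↔ z.fst = v ∧ z ∈ lineSide γ := by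
  simp [sideAt]

open Classical in
/-- The indicator of the vertices after position `j` at which a path turns left. -/
noncomputable def leftAt (S : ColouredOrientation T.graph) (s : ℕ → T.graph.Dart) (j : ℕ) (v : V) :
    ℤ := if ∃ i ≥ j, v = (s (i + 1)).fst ∧ S.colour (s (i + 1)) = (S.colour (s i)).next then 1
  else 0

open Classical in
-- Off the path all three outgoing edges are counted. On the path one dart of the side, the reverse
-- of the edge of arrival, is not in `lineLeft` and accounts for one. On the turning branch the two
-- others are the edge of departure and either one outgoing edge on the left, at a straight vertex,
-- or the left turn itself. On the reversed straight branch they are the reverse of the edge of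
-- arrival, which is outgoing, and one outgoing edge on the left.
lemma IsFork.count (hS : T.IsMaximalSchnyderWood S) (h : IsFork S P s k j) {v : V}
    (hv : v ∉ T.boundary) (hvj : v ≠ (s j).fst) {z : T.graph.Dart} (hz : z.fst = v)
    (hzX : z ∈ lineSide (forkLine s k j)) :
    ∑ x ∈ sideAt (forkLine s k j) v, outN S x +
      (({x ∈ sideAt (forkLine s k j) v | x ∉ lineLeft (forkLine s k j)}).card : ℤ) +
      leftAt S s j v ≤ 3 := by
  set γ := forkLine s k j with hγ
  have hl := h.isLine hS
  have hw : ∀ x : T.graph.Dart, x.fst = v → weight S x = outN S x := fun x hx =>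
    weight_of_notMem fun hc => hv ⟨x, hc, hx⟩
  by_cases hon : ∃ m, z.fst = (γ m).fst
  swap
  · push Not at hon
    have hleft : ∀ x : T.graph.Dart, x.fst = v → x ∈ lineLeft γ := fun x hx =>
      hl.mem_lineLeft_of_off hon hzX (hx.trans hz.symm)
    have h1 : sideAt γ v = T.dartsAt v := by
      ext x
      rw [mem_sideAt, mem_dartsAt]
      exact ⟨fun h => h.1, fun h => ⟨h, .inl (hleft x h)⟩⟩
    have h2 : {x ∈ sideAt γ v | x ∉ lineLeft γ} = ∅ := by
      rw [Finset.filter_eq_empty_iff]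
      exact fun x hx => not_not.2 (hleft x (mem_sideAt.1 hx).1)
    have h3 : leftAt S s j v = 0 := by
      refine if_neg ?_
      rintro ⟨i, hi, h3, -⟩
      obtain ⟨b, rfl⟩ := Nat.exists_eq_add_of_le hi
      exact hon (b + 1 : ℕ) (by rw [hz, h3, hγ, forkLine_natCast]; rfl)
    rw [h2, h3, h1, ← sum_weight hS.1 v, Finset.card_empty]
    rw [Finset.sum_congr rfl fun x hx => (hw x ((T.mem_dartsAt).1 hx)).symm]
    simp
  obtain ⟨m, hm⟩ := hon
  rw [hz] at hm
  have h1 : sideAt γ v = insert (γ (m - 1)).symm (T.fan (γ m) (γ (m - 1)).symm) := by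
    ext x
    rw [mem_sideAt, Finset.mem_insert]
    constructor
    · rintro ⟨hx, hx'⟩
      exact (hl.mem_lineSide_iff (hx.trans hm)).1 hx'
    · intro hx
      have : x.fst = v := by
        rcases hx with rfl | hx
        · rw [← hl.chain_sub, hm]
        · rw [fst_of_mem_fan hx, hm]
      exact ⟨this, (hl.mem_lineSide_iff (this.trans hm)).2 hx⟩
  have h2 : {x ∈ sideAt γ v | x ∉ lineLeft γ} = {(γ (m - 1)).symm} := by
    ext x
    rw [Finset.mem_filter, Finset.mem_singleton]
    constructor
    · rintro ⟨hx, hx'⟩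
      obtain ⟨hx1, hx2⟩ := mem_sideAt.1 hx
      exact ((hl.mem_lineSide_iff (hx1.trans hm)).1 hx2).resolve_right fun hc =>
        hx' ((hl.mem_lineLeft_iff (hx1.trans hm)).2 hc)
    · rintro rfl
      exact ⟨h1 ▸ Finset.mem_insert_self _ _, hl.symm_notMem_lineLeft _⟩
  have h3 : ∑ x ∈ T.fan (γ m) (γ (m - 1)).symm, outN S x =
      osum S (γ m) (γ (m - 1)).symm + outN S (γ m) := by
    rw [osum, sub_add_cancel]
    exact Finset.sum_congr rfl fun x hx => (hw x ((fst_of_mem_fan hx).trans hm.symm)).symm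
  rw [h2, h1, Finset.sum_insert (right_notMem_fan (hl.chain_sub m) (hl.ne m)), h3,
    Finset.card_singleton]
  have hcase : (∃ n : ℕ, m = ((n + 1 : ℕ) : ℤ)) ∨ ∃ n : ℕ, m = -(n : ℤ) := by
    obtain ⟨n, rfl | rfl⟩ := m.eq_nat_or_neg
    · cases n with
      | zero => exact .inr ⟨0, by simp⟩
      | succ n => exact .inl ⟨n, rfl⟩
    · exact .inr ⟨n, rfl⟩
  rcases hcase with ⟨n, rfl⟩ | ⟨n, rfl⟩
  · have e : ((n + 1 : ℕ) : ℤ) - 1 = (n : ℕ) := by push_cast; ring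
    rw [e, hγ, forkLine_natCast, forkLine_natCast, outN_of_true (h.ray.out _),
      outN_of_false (out_symm_of_true (h.ray.out _))]
    have hch := h.ray.chain (j + n)
    rcases h.ray.step (j + n) with hc | hc
    · have h4 := (osum_in_out hS.1 (x := s (j + n + 1)) (y := (s (j + n)).symm) hch.symm
        (h.ray.out _) (out_symm_of_true (h.ray.out _))).2.1 (by rw [S.colour_symm]; exact hc)
      have h5 : leftAt S s j v = 0 := by
        refine if_neg ?_
        rintro ⟨i, hi, h5, h6⟩
        rw [hm, hγ, forkLine_natCast] at h5
        have : j + (n + 1) = i + 1 := h.ray.injective hS h5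
        obtain rfl : i = j + n := by omega
        exact Colour.next_ne _ (h6.symm.trans hc)
      rw [h5]
      change 0 + (osum S (s (j + n + 1)) _ + 1) + _ + 0 ≤ (3 : ℤ)
      rw [h4]
      norm_num
    · have h4 := (osum_in_out hS.1 (x := s (j + n + 1)) (y := (s (j + n)).symm) hch.symm
        (h.ray.out _) (out_symm_of_true (h.ray.out _))).1 (by rw [S.colour_symm]; exact hc)
      have h5 : leftAt S s j v ≤ 1 := by unfold leftAt; split_ifs <;> norm_num
      change 0 + (osum S (s (j + n + 1)) _ + 1) + _ + _ ≤ (3 : ℤ)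
      rw [h4]
      push_cast
      linarith
  · have hn : n ≠ 0 := by
      rintro rfl
      exact hvj hm
    obtain ⟨n, rfl⟩ : ∃ b, n = b + 1 := ⟨n - 1, by omega⟩
    rw [hγ, forkLine_neg, show -((n + 1 : ℕ) : ℤ) = -(n : ℤ) - 1 by push_cast; ring, forkLine_neg,
      SimpleGraph.Dart.symm_symm, outN_of_true (h.branch.out _),
      outN_of_false (out_symm_of_true (h.branch.out _))]
    have hch := h.branch.chain n
    have h4 := (osum_in_out hS.1 (x := k (n + 1)) (y := (k n).symm) hch.symm
      (h.branch.out _) (out_symm_of_true (h.branch.out _))).2.1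
      (by rw [S.colour_symm, h.same, h.same])
    have hne : k (n + 1) ≠ (k n).symm := by
      intro hc
      have := h.branch.out (n + 1)
      rw [hc, out_symm_of_true (h.branch.out _)] at this
      cases this
    have h5 := osum_add_osum hS.1 (x := k (n + 1)) (y := (k n).symm) hch.symm hne
    rw [h4, outN_of_true (h.branch.out _), outN_of_false (out_symm_of_true (h.branch.out _))] at h5
    have h6 : leftAt S s j v = 0 := by
      refine if_neg ?_
      rintro ⟨i, hi, h6, h7⟩
      rw [hm, hγ, h.forkLine_fst_neg] at h6
      exact h.disjoint hS _ _ (by omega) h6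
    rw [h6]
    push_cast
    linarith

end InfiniteTriangulation

/-! ### Counting edges on the side of the stem of a fork -/

namespace InfiniteTriangulation

variable {V : Type*} {T : InfiniteTriangulation V} {S : ColouredOrientation T.graph}
  {s : ℕ → T.graph.Dart} {P : Finset V} {k : ℕ → T.graph.Dart} {j : ℕ}

lemma snd_faceNext {z : T.graph.Dart} (h : z ∉ T.exterior) :
    (T.faceNext z).snd = (T.rot z).snd := by
  have h1 := faceNext_three h
  have h2 := rot_faceNext (T := T) (T.faceNext (T.faceNext z))
  rw [h1] at h2
  rw [h2, ← faceNext_fst]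
  rfl

/-- The edges on or to the left of a fork that start off its stem. -/
def ForkStep (S : ColouredOrientation T.graph) (P : Finset V) (s k : ℕ → T.graph.Dart) (j : ℕ)
    (v w : V) : Prop :=
  (v ∉ P ∧ ∀ i ≤ j, v ≠ (s i).fst) ∧
    ∃ z ∈ lineSide (forkLine s k j), S.out z = true ∧ z.fst = v ∧ z.snd = w

lemma IsFork.mem_lineSide (hS : T.IsMaximalSchnyderWood S) (h : IsFork S P s k j) {i : ℕ}
    (hi : j ≤ i) : s i ∈ lineSide (forkLine s k j) := by
  obtain ⟨b, rfl⟩ := Nat.exists_eq_add_of_le hi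
  exact .inl ((h.isLine hS).mem_lineLeft (b : ℤ))

lemma IsFork.off_stem (hS : T.IsMaximalSchnyderWood S) (h : IsFork S P s k j) {i : ℕ}
    (hi : j < i) : (s i).fst ∉ P ∧ ∀ b ≤ j, (s i).fst ≠ (s b).fst := by
  refine ⟨h.off i (by omega), fun b hb hc => ?_⟩
  have : i = b := h.ray.injective hS hc
  omega

/-- Infinitely many vertices to the left of a fork lead to a late vertex of the branch with left
turns. -/
theorem IsFork.exists_infinite_back (hS : T.IsMaximalSchnyderWood S) (h : IsFork S P s k j)
    (hturn : ∀ N, ∃ i ≥ N, S.colour (s (i + 1)) = (S.colour (s i)).next) :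
    ∃ J > j, {v | Relation.ReflTransGen (ForkStep S P s k j) v (s J).fst}.Infinite := by
  classical
  have hinj := h.ray.injective hS
  -- The core and the stem, where backward paths are stopped. Their number of darts `A.card` bounds
  -- the edges that enter the set `D` below from outside.
  set Q : Finset V := P ∪ (Finset.range (j + 1)).image (fun i => (s i).fst) with hQ
  have hQ' : ∀ v, v ∉ Q ↔ (v ∉ P ∧ ∀ i ≤ j, v ≠ (s i).fst) := by
    intro v
    simp only [hQ, Finset.mem_union, Finset.mem_image, Finset.mem_range, not_or, not_exists, not_and]
    refine and_congr_right fun _ => ⟨fun h i hi hc => h i (by omega) hc.symm,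
      fun h i hi hc => h i (by omega) hc.symm⟩
  set A := Q.biUnion T.dartsAt with hA
  have hinf : {i | j ≤ i ∧ S.colour (s (i + 1)) = (S.colour (s i)).next}.Infinite := by
    rw [Set.infinite_iff_exists_gt]
    intro a
    obtain ⟨i, hi, hc⟩ := hturn (a + 1 + j)
    exact ⟨i, ⟨by omega, hc⟩, by omega⟩
  -- The count below allows at most `A.card + 3` left turns.
  obtain ⟨I, hI, hIc⟩ := hinf.exists_subset_card_eq (A.card + 4)
  obtain ⟨J, hJj, hJ⟩ : ∃ J > j, ∀ i ∈ I, i < J := by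
    refine ⟨max (j + 1) (I.sup id + 1), by omega, fun i hi => ?_⟩
    have : id i ≤ I.sup id := Finset.le_sup hi
    simp only [id] at this
    omega
  refine ⟨J, hJj, fun hfin => ?_⟩
  set b := (s J).fst with hb
  set γ := forkLine s k j with hγ
  have hl := h.isLine hS
  set D := hfin.toFinset with hD
  have hmD : ∀ v, v ∈ D ↔ Relation.ReflTransGen (ForkStep S P s k j) v b := by simp [hD]
  have hbD : b ∈ D := (hmD b).2 .refl
  have hDQ : ∀ v ∈ D, v ∉ Q := by
    intro v hv
    rw [hQ']
    rcases Relation.ReflTransGen.cases_head ((hmD v).1 hv) with rfl | ⟨w, hw, -⟩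
    · exact h.off_stem hS hJj
    · exact hw.1
  have hDb : ∀ v ∈ D, v ∉ T.boundary := fun v hv hc =>
    ((hQ' v).1 (hDQ v hv)).1 (h.core.boundary v hc)
  have hDx : ∀ v ∈ D, ∃ z : T.graph.Dart, z.fst = v ∧ z ∈ lineSide γ := by
    intro v hv
    rcases Relation.ReflTransGen.cases_head ((hmD v).1 hv) with rfl | ⟨w, ⟨-, z, hz, -, hzv, -⟩, -⟩
    · exact ⟨s J, rfl, h.mem_lineSide hS hJj.le⟩
    · exact ⟨z, hzv, hz⟩
  have hsD : ∀ n, j < J - n → (s (J - n)).fst ∈ D := by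
    intro n
    induction n with
    | zero => exact fun _ => hbD
    | succ n ih =>
      intro hn
      refine (hmD _).2 (.head ⟨h.off_stem hS hn, s (J - (n + 1)), h.mem_lineSide hS hn.le,
        h.ray.out _, rfl, ?_⟩ ((hmD _).1 (ih (by omega))))
      rw [h.ray.chain]
      congr 3
      omega
  set U := D.biUnion (sideAt γ) with hU
  have hmU : ∀ z, z ∈ U ↔ z.fst ∈ D ∧ z ∈ lineSide γ := by
    intro z
    simp only [hU, Finset.mem_biUnion, mem_sideAt]
    exact ⟨fun ⟨v, hv, h1, h2⟩ => ⟨h1 ▸ hv, h2⟩, fun ⟨h1, h2⟩ => ⟨_, h1, rfl, h2⟩⟩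
  have hdisj : ((D : Set V)).PairwiseDisjoint (sideAt γ) := by
    intro v _ w _ hvw
    refine Finset.disjoint_left.2 fun z hz hz' => hvw ?_
    rw [← (mem_sideAt.1 hz).1, (mem_sideAt.1 hz').1]
  -- The darts of the side at vertices of `D` are sorted by direction and by whether their head is
  -- in `D`. Reversal matches `E` with `E'`, so `E` holds each inner edge once.
  set E := {z ∈ U | S.out z = true ∧ z.snd ∈ D} with hE
  set O := {z ∈ U | S.out z = true ∧ z.snd ∉ D} with hO
  set E' := {z ∈ U | S.out z = false ∧ z.snd ∈ D} with hE'
  set O' := {z ∈ U | S.out z = false ∧ z.snd ∉ D} with hO'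
  set W := {z ∈ U | z ∉ lineLeft γ} with hW
  -- The darts of the triangles on the left whose three vertices all lie in `D`.
  set G := {z ∈ U | z ∈ lineLeft γ ∧ z.snd ∈ D ∧ (T.rot z).snd ∈ D} with hG
  set B := {z ∈ U | z.snd ∉ D} with hB
  set B' := {z ∈ U | z ∈ lineLeft γ ∧ (T.rot z).snd ∉ D} with hB'
  have h1 : ∑ z ∈ U, outN S z ≤ (E.card : ℤ) + O.card ∧ (E.card : ℤ) + O.card ≤ ∑ z ∈ U, outN S z := by
    have h2 : E.card + O.card = (U.filter fun z => S.out z = true).card := by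
      rw [← Finset.card_filter_add_card_filter_not (s := U.filter fun z => S.out z = true)
        (fun z => z.snd ∈ D), Finset.filter_filter, Finset.filter_filter]
    have h3 : ∑ z ∈ U, outN S z = ((U.filter fun z => S.out z = true).card : ℤ) := by
      rw [Finset.card_filter, Nat.cast_sum]
      refine Finset.sum_congr rfl fun z _ => ?_
      unfold outN
      split_ifs <;> rfl
    rw [h3, ← h2]
    push_cast
    exact ⟨le_rfl, le_rfl⟩
  have hUc : U.card = E.card + O.card + (E'.card + O'.card) := by
    rw [← Finset.card_filter_add_card_filter_not (s := U) (fun z => S.out z = true)]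
    congr 1
    · rw [← Finset.card_filter_add_card_filter_not (s := U.filter fun z => S.out z = true)
        (fun z => z.snd ∈ D), Finset.filter_filter, Finset.filter_filter]
    · simp only [Bool.not_eq_true]
      rw [← Finset.card_filter_add_card_filter_not (s := U.filter fun z => S.out z = false)
        (fun z => z.snd ∈ D), Finset.filter_filter, Finset.filter_filter]
  have hEE : E'.card ≤ E.card := by
    refine Finset.card_le_card_of_injOn SimpleGraph.Dart.symm (fun z hz => ?_)
      SimpleGraph.Dart.symm_involutive.injective.injOn
    obtain ⟨hz, ho, hd⟩ := Finset.mem_filter.1 hz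
    obtain ⟨hz1, hz2⟩ := (hmU z).1 hz
    exact Finset.mem_filter.2 ⟨(hmU _).2 ⟨hd, symm_mem_lineSide hz2⟩, out_symm_of_false ho, hz1⟩
  have hEE' : E.card ≤ E'.card := by
    refine Finset.card_le_card_of_injOn SimpleGraph.Dart.symm (fun z hz => ?_)
      SimpleGraph.Dart.symm_involutive.injective.injOn
    obtain ⟨hz, ho, hd⟩ := Finset.mem_filter.1 hz
    obtain ⟨hz1, hz2⟩ := (hmU z).1 hz
    exact Finset.mem_filter.2 ⟨(hmU _).2 ⟨hd, symm_mem_lineSide hz2⟩, out_symm_of_true ho, hz1⟩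
  -- An edge that enters `D` from a vertex outside must start in `Q`, since otherwise its tail would
  -- belong to `D` by definition.
  have hOA : O'.card ≤ A.card := by
    refine Finset.card_le_card_of_injOn SimpleGraph.Dart.symm (fun z hz => ?_)
      SimpleGraph.Dart.symm_involutive.injective.injOn
    obtain ⟨hz, ho, hd⟩ := Finset.mem_filter.1 hz
    obtain ⟨hz1, hz2⟩ := (hmU z).1 hz
    refine Finset.mem_biUnion.2 ⟨z.snd, ?_, T.mem_dartsAt.2 rfl⟩
    by_contra hc
    exact hd ((hmD _).2 (.head ⟨(hQ' _).1 hc, z.symm, symm_mem_lineSide hz2, out_symm_of_false ho,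
      rfl, rfl⟩ ((hmD _).1 hz1)))
  have hBc : B.card = O.card + O'.card := by
    rw [← Finset.card_filter_add_card_filter_not (s := B) (fun z => S.out z = true)]
    simp only [Bool.not_eq_true, hB, Finset.filter_filter, hO, hO']
    congr 2 <;> (ext z; simp only [Finset.mem_filter]; tauto)
  have hBB : B'.card ≤ B.card := by
    refine Finset.card_le_card_of_injOn T.rot (fun z hz => ?_) T.rot.injective.injOn
    obtain ⟨hz, ho, hd⟩ := Finset.mem_filter.1 hz
    exact Finset.mem_filter.2 ⟨(hmU _).2 ⟨by rw [T.rot_fst]; exact ((hmU z).1 hz).1,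
      rot_mem_lineSide ho⟩, hd⟩
  have hcover : U.card ≤ G.card + W.card + B.card + B'.card := by
    have : U ⊆ ((G ∪ W) ∪ B) ∪ B' := by
      intro z hz
      simp only [Finset.mem_union, hG, hW, hB, hB', Finset.mem_filter, hz, true_and]
      tauto
    have h2 := Finset.card_le_card this
    have h3 := Finset.card_union_le ((G ∪ W) ∪ B) B'
    have h4 := Finset.card_union_le (G ∪ W) B
    have h5 := Finset.card_union_le G W
    omega
  have hcount : ∑ z ∈ U, outN S z + (W.card : ℤ) + ∑ v ∈ D, leftAt S s j v ≤ 3 * D.card := by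
    have hWc : (W.card : ℤ) = ∑ v ∈ D, (({x ∈ sideAt γ v | x ∉ lineLeft γ}).card : ℤ) := by
      rw [hW, hU, Finset.filter_biUnion, Finset.card_biUnion]
      · push_cast; rfl
      · intro v hv w hw hvw
        exact (hdisj hv hw hvw).mono (Finset.filter_subset _ _) (Finset.filter_subset _ _)
    rw [hWc, hU, Finset.sum_biUnion hdisj, ← Finset.sum_add_distrib, ← Finset.sum_add_distrib]
    have h2 : (3 * D.card : ℤ) = ∑ v ∈ D, (3 : ℤ) := by rw [Finset.sum_const, nsmul_eq_mul]; ring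
    rw [h2]
    refine Finset.sum_le_sum fun v hv => ?_
    obtain ⟨z, hz, hzX⟩ := hDx v hv
    exact h.count hS (hDb v hv) (((hQ' v).1 (hDQ v hv)).2 j le_rfl) hz hzX
  have hleft : (A.card : ℤ) + 4 ≤ ∑ v ∈ D, leftAt S s j v := by
    have h2 : (I.image fun i => (s (i + 1)).fst) ⊆ D := by
      intro v hv
      obtain ⟨i, hi, rfl⟩ := Finset.mem_image.1 hv
      have h3 := hJ i hi
      have h4 := (hI hi).1
      have := hsD (J - (i + 1)) (by omega)
      rwa [show J - (J - (i + 1)) = i + 1 by omega] at this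
    have h3 : (I.image fun i => (s (i + 1)).fst).card = I.card :=
      Finset.card_image_of_injective _ fun x y hxy => by
        have := hinj hxy
        omega
    calc (A.card : ℤ) + 4 = ∑ v ∈ I.image fun i => (s (i + 1)).fst, (1 : ℤ) := by
          rw [Finset.sum_const, h3, hIc]; simp
      _ = ∑ v ∈ I.image fun i => (s (i + 1)).fst, leftAt S s j v := by
          refine Finset.sum_congr rfl fun v hv => ?_
          obtain ⟨i, hi, rfl⟩ := Finset.mem_image.1 hv
          exact (if_pos ⟨i, (hI hi).1, rfl, (hI hi).2⟩).symm
      _ ≤ _ := Finset.sum_le_sum_of_subset_of_nonneg h2 fun v _ _ => by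
          unfold leftAt; split_ifs <;> norm_num
  have heuler : 3 * D.card + G.card ≤ 3 * E.card + 3 := by
    refine euler_le hbD (E := E) (G := G) ?_ ?_ ?_ ?_ ?_
    · intro e he
      obtain ⟨he1, he2, he3⟩ := Finset.mem_filter.1 he
      refine ⟨((hmU e).1 he1).1, he3, fun hc => ?_⟩
      have := (Finset.mem_filter.1 hc).2.1
      rw [out_symm_of_true he2] at this
      cases this
    · intro z
      simp only [hG, Finset.mem_filter, hmU, rot_faceNext, faceNext_mem_lineLeft, faceNext_fst]
      constructor
      · rintro ⟨⟨h2, -⟩, h3, h4, h5⟩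
        have hz : z ∉ T.exterior := fun hc => hDb _ h2 ⟨z, hc, rfl⟩
        exact ⟨⟨h4, .inl (faceNext_mem_lineLeft.2 h3)⟩, h3, by rwa [snd_faceNext hz], h2⟩
      · rintro ⟨⟨h2, -⟩, h3, h4, h5⟩
        have hz : z ∉ T.exterior := fun hc => hDb _ h5 ⟨z, hc, rfl⟩
        exact ⟨⟨h5, .inl h3⟩, h3, h2, by rwa [snd_faceNext hz] at h4⟩
    · intro z hz hc
      exact hDb _ ((hmU z).1 (Finset.mem_filter.1 hz).1).1 ⟨z, hc, rfl⟩
    · intro z hz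
      obtain ⟨hz1, hz2, hz3, -⟩ := Finset.mem_filter.1 hz
      have hz4 := (hmU z).1 hz1
      cases ho : S.out z with
      | true => exact .inl (Finset.mem_filter.2 ⟨hz1, ho, hz3⟩)
      | false => exact .inr (Finset.mem_filter.2 ⟨(hmU _).2 ⟨hz3, symm_mem_lineSide hz4.2⟩,
          out_symm_of_false ho, hz4.1⟩)
    · intro f hf x hx
      have hx' := (hmD x).1 hx
      clear hx
      induction hx' using Relation.ReflTransGen.head_induction_on with
      | refl => rfl
      | head hvw hw ih =>
        rw [← ih]
        have hv := (hmD _).2 (Relation.ReflTransGen.head hvw hw)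
        obtain ⟨-, z, hz, ho, rfl, rfl⟩ := hvw
        exact hf z (Finset.mem_filter.2 ⟨(hmU _).2 ⟨hv, hz⟩, ho, (hmD _).2 hw⟩)
  -- The cover of `U` gives 2|E| ≤ |G| + |W| + |O| + |O'|. Together with the local count and the
  -- inequality of Euler, the number of left turns in `D` is at most |O'| + 3 ≤ |A| + 3, a
  -- contradiction.
  have h2 := h1.1
  have h3 := h1.2
  omega

end InfiniteTriangulation

/-! ### Infinite paths with infinitely many left turns -/

namespace InfiniteTriangulation

variable {V : Type*} {T : InfiniteTriangulation V} {S : ColouredOrientation T.graph}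
  {s : ℕ → T.graph.Dart} {P : Finset V} {k : ℕ → T.graph.Dart} {j : ℕ}

/-- An edge of the side that joins the turning branch does so from its left. Hence a path that
arrives by this edge and goes on along the branch has the earlier part of the branch on its right,
and with it the stem and the exterior face. -/
lemma IsFork.symm_mem_fan (hS : T.IsMaximalSchnyderWood S) (h : IsFork S P s k j) {a : ℕ}
    (ha : j ≤ a) {y : T.graph.Dart} (hy : y ∈ lineSide (forkLine s k j)) (hout : S.out y = true)
    (hys : y.snd = (s (a + 1)).fst) (hyf : y.fst ≠ (s a).fst) :
    (s a).symm ∈ T.fan y.symm (s (a + 1)) := by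
  obtain ⟨b, rfl⟩ := Nat.exists_eq_add_of_le ha
  have hl := h.isLine hS
  have e1 : forkLine s k j ((b + 1 : ℕ) : ℤ) = s (j + b + 1) := rfl
  have e2 : forkLine s k j (((b + 1 : ℕ) : ℤ) - 1) = s (j + b) := by
    rw [show ((b + 1 : ℕ) : ℤ) - 1 = b by push_cast; ring]; rfl
  have h1 := (hl.mem_lineSide_iff (z := y.symm) (m := ((b + 1 : ℕ) : ℤ)) (by rw [e1]; exact hys)).1
    (symm_mem_lineSide hy)
  rw [e1, e2] at h1
  have hch : (s (j + b + 1)).fst = (s (j + b)).symm.fst := (h.ray.chain _).symm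
  refine mem_fan_rotate hch ?_ (h1.resolve_left fun hc => ?_) fun hc => ?_
  · have := hl.ne ((b + 1 : ℕ) : ℤ)
    rwa [e1, e2] at this
  · exact hyf (congrArg (fun d : T.graph.Dart => d.snd) hc)
  · have := h.ray.out (j + b + 1)
    rw [← hc, out_symm_of_true hout] at this
    cases this

/-- In a maximal Schnyder wood there is no infinite directed path with infinitely many left turns
and without right turns. -/
theorem IsRay.eventually_straight (hS : T.IsMaximalSchnyderWood S) (hray : IsRay S s) :
    ∃ N, ∀ i ≥ N, S.colour (s (i + 1)) ≠ (S.colour (s i)).next := by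
  classical
  by_contra hturn
  push Not at hturn
  obtain ⟨P, s, k, j, h, hturn⟩ := exists_isFork hS hray hturn
  clear hray
  obtain ⟨J, hJj, hinf⟩ := h.exists_infinite_back hS hturn
  -- The backward path `q` from the late vertex `s J`, by König's lemma.
  obtain ⟨q, hq0, hqinj, hq⟩ := exists_backward_path (fun w => by
    refine ((T.dartsAt w).image fun d => d.snd).finite_toSet.subset ?_
    rintro v ⟨-, z, -, -, rfl, rfl⟩
    exact Finset.mem_coe.2 (Finset.mem_image.2 ⟨z.symm, T.mem_dartsAt.2 rfl, rfl⟩)) hinf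
  have hqoff : ∀ n, q (n + 1) ∉ P ∧ ∀ i ≤ j, q (n + 1) ≠ (s i).fst := fun n => (hq n).1
  choose y hyside hyout hyf hys using fun n => (hq n).2
  have hinj := h.ray.injective hS
  have hhit : ∀ n a, q n = (s a).fst → j < a := by
    intro n a hna
    cases n with
    | zero =>
      have : J = a := hinj (hq0.symm.trans hna)
      omega
    | succ n =>
      by_contra hc
      exact (hqoff n).2 a (by omega) hna
  -- If `q` meets the branch beyond `J`, a part of `q` and a stretch of the branch form a directed
  -- cycle. If not, then `q` leaves the branch for good, and its tail followed by the tail of the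
  -- branch is a two-ended directed path. Both have the exterior face on their right.
  by_cases hA : ∃ n, 1 ≤ n ∧ ∃ i > J, q n = (s i).fst
  · obtain ⟨hn, i, hiJ, hni⟩ := Nat.find_spec hA
    have hmin : ∀ m < Nat.find hA, 1 ≤ m → ∀ i > J, q m ≠ (s i).fst := fun m hm h1 i hi hc =>
      Nat.find_min hA hm ⟨h1, i, hi, hc⟩
    set n := Nat.find hA
    -- The last visit of `q` to the branch before `n`, so that between `n'` and `n` the path `q` is
    -- off the branch.
    set n' := Nat.findGreatest (fun m => ∃ a, q m = (s a).fst) (n - 1) with hn'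
    obtain ⟨a, ha⟩ : ∃ a, q n' = (s a).fst :=
      Nat.findGreatest_spec (P := fun m => ∃ a, q m = (s a).fst) (Nat.zero_le (n - 1)) ⟨J, hq0⟩
    have hn'n : n' ≤ n - 1 := Nat.findGreatest_le _
    have hoffs : ∀ m, n' < m → m < n → ∀ b, q m ≠ (s b).fst := fun m h1 h2 b hb =>
      Nat.findGreatest_is_greatest (P := fun m => ∃ a, q m = (s a).fst) h1 (by omega) ⟨b, hb⟩
    have haj := hhit _ _ ha
    have haJ : a ≤ J := by
      by_contra hc
      rcases Nat.eq_zero_or_pos n' with h0 | h0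
      · rw [h0] at ha
        have : J = a := hinj (hq0.symm.trans ha)
        omega
      · exact hmin n' (by omega) h0 a (by omega) ha
    obtain ⟨l, rfl⟩ := Nat.exists_eq_add_of_le (show a ≤ i by omega)
    obtain ⟨a, rfl⟩ : ∃ b, a = b + 1 := ⟨a - 1, by omega⟩
    set r : ℕ → T.graph.Dart := fun t => y (n - 1 - t) with hr
    have hseg1 := h.ray.isSeg (a + 1) (n := l) (by omega)
    have hseg2 : IsSeg (s (a + 1 + l)).fst (sl r 0 (n - n')) (s (a + 1)).fst := by
      have := isSeg_sl (s := r) (a := 0) (n := n - n') (fun t _ ht => by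
        simp only [hr, hys, hyf]
        congr 1
        omega) (by omega)
      simp only [hr, hyf, hys] at this
      rw [show n - 1 - 0 + 1 = n by omega, show n - 1 - (0 + (n - n') - 1) = n' by omega, ha, hni]
        at this
      exact this
    set c := sl s (a + 1) l ++ sl r 0 (n - n') with hc
    have hcf : ∀ x ∈ c, (∃ b, a < b ∧ x.fst = (s b).fst) ∨ ∃ m, n' < m ∧ m < n ∧ x.fst = q m := by
      intro x hx
      rcases List.mem_append.1 hx with hx | hx
      · obtain ⟨b, hb, -, rfl⟩ := mem_sl.1 hx
        exact .inl ⟨b, by omega, rfl⟩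
      · obtain ⟨t, -, ht, rfl⟩ := mem_sl.1 hx
        simp only [hr, hyf]
        rcases Nat.eq_zero_or_pos t with rfl | h0
        · rw [show n - 1 - 0 + 1 = n by omega]
          exact .inl ⟨_, by omega, hni⟩
        · exact .inr ⟨_, by omega, by omega, rfl⟩
    have hcyc : IsCyc c := by
      refine ⟨?_, ?_, _, hseg1.append hseg2⟩
      · rw [hc, List.length_append, length_sl, length_sl]
        by_contra hcl
        obtain ⟨rfl, hnn⟩ : l = 1 ∧ n' = n - 1 := by omega
        have h1 : y n' = (s (a + 1)).symm := T.dart_ext (by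
          rw [hyf, hnn, Nat.sub_add_cancel hn, hni, ← h.ray.chain]; rfl) (by rw [hys, ha]; rfl)
        have h2 := hyout n'
        rw [h1, out_symm_of_true (h.ray.out _)] at h2
        cases h2
      · rw [hc, List.map_append, List.nodup_append]
        refine ⟨?_, ?_, ?_⟩
        · rw [sl, List.map_map]
          refine List.Nodup.map ?_ List.nodup_range
          intro x z hxz
          have := hinj hxz
          simpa using this
        · rw [sl, List.map_map]
          refine List.Nodup.map_on ?_ List.nodup_range
          intro x hx z hz hxz
          rw [List.mem_range] at hx hz
          simp only [Function.comp_apply, hr, hyf] at hxz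
          have := hqinj hxz
          omega
        · rintro x hx z hz rfl
          obtain ⟨d, hd, rfl⟩ := List.mem_map.1 hx
          obtain ⟨e, he, hed⟩ := List.mem_map.1 hz
          obtain ⟨b, h1, h2, rfl⟩ := mem_sl.1 hd
          obtain ⟨t, -, h3, rfl⟩ := mem_sl.1 he
          simp only [hr, hyf] at hed
          rcases Nat.eq_zero_or_pos t with rfl | h0
          · rw [show n - 1 - (0 : ℕ) + 1 = n by omega, hni] at hed
            have := hinj hed
            omega
          · exact hoffs _ (by omega) (by omega) b hed
    have hcout : ∀ x ∈ c, S.out x = true := by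
      intro x hx
      rcases List.mem_append.1 hx with hx | hx
      · exact out_of_mem_sl h.ray.out x hx
      · exact out_of_mem_sl (fun t => hyout _) x hx
    have hleft := (directed_cycle hS hcyc hcout).1
    have hyc : y n' ∈ c := List.mem_append_right _ (mem_sl.2 ⟨n - 1 - n', by omega, by omega, by
      simp only [hr]; congr 1; omega⟩)
    have hfan := h.symm_mem_fan hS (a := a) (by omega) (hyside n') (hyout n')
      (by rw [hys, ha]) (by
        rw [hyf]
        intro hcc
        rcases Nat.lt_or_ge (n' + 1) n with h1 | h1
        · exact hoffs _ (by omega) h1 _ hcc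
        · rw [show n' + 1 = n by omega, hni] at hcc
          have := hinj hcc
          omega)
    have h8 := hcyc.sameRegion_right_fan hyc
      (List.mem_append_left _ (mem_sl.2 ⟨a + 1, le_rfl, by omega, rfl⟩)) ((hys n').trans ha) hfan
    have hF : ∀ d : T.graph.Dart, (∀ x ∈ c, x.fst ≠ d.fst) → d.edge ∉ edgesOf c := fun d hd =>
      edge_notMem_of_fst hcyc.seg hd
    have hoff2 : ∀ m ≤ a, ∀ d : T.graph.Dart, d.fst = (s m).fst → d.edge ∉ edgesOf c := by
      refine fun m hm d hd => hF d fun x hx hxd => ?_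
      rcases hcf x hx with ⟨b, hb, h1⟩ | ⟨b, hb, hb2, h1⟩
      · have := hinj (h1.symm.trans (hxd.trans hd))
        omega
      · exact hoffs b hb hb2 m (h1.symm.trans (hxd.trans hd))
    have hreg := h.sameRegion_root (F := edgesOf c) (i := a) (d := s a) (fun d hd =>
      hF d fun x hx hxd => by
        rcases hcf x hx with ⟨b, hb, h1⟩ | ⟨b, hb, hb2, h1⟩
        · exact h.off b (by omega) (h1 ▸ hxd ▸ hd)
        · obtain ⟨b, rfl⟩ : ∃ b', b = b' + 1 := ⟨b - 1, by omega⟩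
          exact (hqoff b).1 (h1 ▸ hxd ▸ hd)) (fun m hm _ d hd => hoff2 m hm d hd) rfl
    have hes := sameRegion_symm (hoff2 a le_rfl (s a) rfl)
    exact hcyc.disjoint hleft (right_of_sameRegion (symm_mem_right hyc)
      ((h8.trans hes.symm).trans hreg))
  · push Not at hA
    have hfin : {m | ∃ a, q m = (s a).fst}.Finite := by
      refine (((Finset.range (J + 1)).image fun i => (s i).fst).finite_toSet.preimage
        hqinj.injOn).subset ?_
      rintro m ⟨a, ha⟩
      refine Finset.mem_coe.2 (Finset.mem_image.2 ⟨a, Finset.mem_range.2 ?_, ha.symm⟩)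
      rcases Nat.eq_zero_or_pos m with rfl | h0
      · have : J = a := hinj (hq0.symm.trans ha)
        omega
      · by_contra hc
        exact hA m h0 a (by omega) ha
    -- The last visit of `q` to the branch.
    obtain ⟨n, ⟨a, ha⟩, hmax⟩ := hfin.exists_maximal ⟨0, J, hq0⟩
    have hoffs : ∀ m, n < m → ∀ b, q m ≠ (s b).fst := fun m h1 b hb =>
      absurd (hmax ⟨b, hb⟩ h1.le) (by simpa using h1)
    have haj := hhit _ _ ha
    obtain ⟨a, rfl⟩ : ∃ b, a = b + 1 := ⟨a - 1, by omega⟩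
    let p : ℤ → T.graph.Dart := fun i => match i with
      | .ofNat i => s (a + 1 + i)
      | .negSucc m => y (n + m)
    have hpl : IsLine p := by
      constructor
      · rintro (i | i)
        · exact h.ray.chain _
        · cases i with
          | zero => exact (hys n).trans ha
          | succ i => exact (hys _).trans (hyf _).symm
      · rintro (i | i) (i' | i') hii
        · have := hinj hii
          congr 1
          omega
        · exact absurd ((hyf _).symm.trans hii.symm) (hoffs _ (by omega) _)
        · exact absurd ((hyf _).symm.trans hii) (hoffs _ (by omega) _)
        · have := hqinj ((hyf _).symm.trans (hii.trans (hyf _)))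
          congr 1
          omega
    have hpf : ∀ d : T.graph.Dart, d.edge ∈ lineEdges p →
        (∃ b, a < b ∧ d.fst = (s b).fst) ∨ ∃ m, n < m ∧ d.fst = q m := by
      have h1 : ∀ i, (∃ b, a < b ∧ (p i).fst = (s b).fst) ∨ ∃ m, n < m ∧ (p i).fst = q m := by
        rintro (i | i)
        · exact .inl ⟨_, by omega, rfl⟩
        · exact .inr ⟨_, by omega, hyf _⟩
      rintro d ⟨i, hi⟩
      rcases SimpleGraph.dart_edge_eq_iff _ _ |>.1 hi with rfl | rfl
      · exact h1 i
      · rw [show (p i).symm.fst = (p (i + 1)).fst from hpl.chain i]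
        exact h1 (i + 1)
    have hfan := h.symm_mem_fan hS (a := a) (by omega) (hyside n) (hyout n)
      (by rw [hys, ha]) (by rw [hyf]; exact hoffs _ (by omega) _)
    have h8 := hpl.sameRegion_fan' (m := 0) (z := (s a).symm) hfan
    rw [show (0 : ℤ) - 1 = -1 from rfl] at h8
    have hoff2 : ∀ m ≤ a, ∀ d : T.graph.Dart, d.fst = (s m).fst → d.edge ∉ lineEdges p := by
      intro m hm d hd hF
      rcases hpf d hF with ⟨b, hb, h1⟩ | ⟨b, hb, h1⟩
      · have := hinj (h1.symm.trans hd)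
        omega
      · exact hoffs b hb m (h1.symm.trans hd)
    have hreg := h.sameRegion_root (F := lineEdges p) (i := a) (d := s a) (fun d hd hF => by
        rcases hpf d hF with ⟨b, hb, h1⟩ | ⟨b, hb, h1⟩
        · exact h.off b (by omega) (h1 ▸ hd)
        · obtain ⟨b, rfl⟩ : ∃ b', b = b' + 1 := ⟨b - 1, by omega⟩
          exact (hqoff b).1 (h1 ▸ hd)) (fun m hm _ d hd => hoff2 m hm d hd) rfl
    have hes := sameRegion_symm (hoff2 a le_rfl (s a) rfl)
    have h9 := (h8.trans hes.symm).trans hreg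
    refine hS.2.2 p ⟨hpl.chain, hpl.inj, ?_, -1, ?_⟩
    -- The index −1 is the edge of `q` by which the path joins the branch; its right side was just
    -- seen to contain the exterior face.
    swap
    · exact h9
    rintro (i | i)
    · exact h.ray.out _
    · exact hyout _

end InfiniteTriangulation

/-! ### Infinite monochromatic paths -/

namespace InfiniteTriangulation

variable {V : Type*} {T : InfiniteTriangulation V} {S : ColouredOrientation T.graph}
  {s : ℕ → T.graph.Dart}

lemma finite_ball (P : Finset V) (N : ℕ) :
    {v | ∃ (l : List T.graph.Dart) (w : V), w ∈ P ∧ IsSeg v l w ∧ l.length ≤ N}.Finite := by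
  classical
  induction N with
  | zero =>
    refine P.finite_toSet.subset ?_
    rintro v ⟨l, w, hw, hl, h⟩
    obtain rfl := List.length_eq_zero_iff.1 (Nat.le_zero.1 h)
    obtain rfl : v = w := hl
    exact hw
  | succ N ih =>
    refine (P.finite_toSet.union (ih.biUnion fun w _ =>
      ((T.dartsAt w).image fun d => d.snd).finite_toSet)).subset ?_
    rintro v ⟨l, w, hw, hl, h⟩
    cases l with
    | nil =>
      obtain rfl : v = w := hl
      exact .inl hw
    | cons a l =>
      obtain ⟨rfl, hl⟩ := hl
      refine .inr (Set.mem_biUnion (x := a.snd) ⟨l, w, hw, hl, ?_⟩ ?_)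
      · rw [List.length_cons] at h
        omega
      · exact Finset.mem_coe.2 (Finset.mem_image.2 ⟨a.symm, T.mem_dartsAt.2 rfl, rfl⟩)

lemma ts_sl_of_turn {a n : ℕ} {c : ℤ}
    (h : ∀ i, a ≤ i → i + 1 < a + n → turn S (s i) (s (i + 1)) = c) (hn : 0 < n) :
    ts S (sl s a n) = (n - 1) * c := by
  induction n with
  | zero => omega
  | succ n ih =>
    rcases Nat.eq_zero_or_pos n with rfl | h0
    · simp [sl]
    · have := h (a + n - 1) (by omega) (by omega)
      rw [show a + n - 1 + 1 = a + n by omega] at this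
      rw [ts_sl_succ h0, ih (fun i h1 h2 => h i h1 (by omega)) h0, this]
      push_cast
      ring

/-- In a maximal Schnyder wood there is no infinite monochromatic directed path. -/
theorem IsRay.not_monochromatic (hS : T.IsMaximalSchnyderWood S) (h : IsRay S s)
    (hc : ∀ i, S.colour (s (i + 1)) = S.colour (s i)) : False := by
  classical
  obtain ⟨P, hP, hs0⟩ := T.exists_core {(s 0).fst} (Set.finite_singleton _)
  have hfin : {i | (s i).fst ∈ P}.Finite := P.finite_toSet.preimage (h.injective hS).injOn
  obtain ⟨a, haP, hmax⟩ := hfin.exists_maximal ⟨0, hs0 _ rfl⟩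
  have hoff : ∀ i, a < i → (s i).fst ∉ P := fun i hi hc => by
    have := hmax hc hi.le
    omega
  -- Infinitely many distinct vertices of the path will be placed in a finite ball around the core.
  refine Set.infinite_of_injective_forall_mem (f := fun i => (s (a + i + 1)).fst) (fun x y hxy => ?_)
    (fun i => ?_) (finite_ball (T := T) P (2 * P.card + 7))
  · have : a + x + 1 = a + y + 1 := h.injective hS hxy
    omega
  · set k := walkSeq S Colour.next (s (a + i)) with hk
    -- The path that always turns left cannot be infinite, so it must come to the core; elsewhere it
    -- could be continued.
    have hex : ∃ n, (k n).snd ∈ P := by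
      by_contra hcon
      push Not at hcon
      have hsp : ∀ n, S.out (k n) = true ∧ ∀ m < n, (k (m + 1)).fst = (k m).snd ∧
          S.colour (k (m + 1)) = (S.colour (k m)).next := fun n =>
        walkSeq_spec hS.1 (h.out _) fun m _ hb => hcon m (hP.boundary _ hb)
      have hkr : IsRay S k := ⟨fun n => ((hsp (n + 1)).2 n (by omega)).1.symm,
        fun n => (hsp n).1, fun n => .inr ((hsp (n + 1)).2 n (by omega)).2⟩
      obtain ⟨N, hN⟩ := hkr.eventually_straight hS
      exact hN N le_rfl ((hsp (N + 1)).2 N (by omega)).2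
    have hn := Nat.find_spec hex
    have hmin : ∀ m < Nat.find hex, (k m).snd ∉ P := fun m hm => Nat.find_min hex hm
    set n := Nat.find hex
    have hn0 : 0 < n := by
      refine Nat.pos_of_ne_zero fun h0 => ?_
      rw [h0] at hn
      refine hoff (a + i + 1) (by omega) ?_
      rw [← h.chain]
      exact hn
    have hsp : ∀ b ≤ n, S.out (k b) = true ∧ ∀ m < b, (k (m + 1)).fst = (k m).snd ∧
        S.colour (k (m + 1)) = (S.colour (k m)).next := fun b hb =>
      walkSeq_spec hS.1 (h.out _) fun m hm hbd => hmin m (by omega) (hP.boundary _ hbd)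
    have hout : ∀ b ≤ n, S.out (k b) = true := fun b hb => (hsp b hb).1
    have hst := (hsp n le_rfl).2
    have hk1 : (k 1).fst = (s (a + i + 1)).fst := (hst 0 hn0).1.trans (h.chain _)
    have hseg1 := h.isSeg a (n := i + 1) (by omega)
    rw [← add_assoc, ← hk1] at hseg1
    have hseg2 : IsSeg (k 1).fst (sl k 1 n) (k n).snd := by
      have := isSeg_sl (s := k) (a := 1) (n := n) (fun m _ hm => (hst m (by omega)).1.symm) hn0
      rwa [Nat.add_sub_cancel_left] at this
    have hout2 : ∀ x ∈ sl k 1 n, S.out x = true := by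
      intro x hx
      obtain ⟨m, hm1, hm2, rfl⟩ := mem_sl.1 hx
      exact hout m (by omega)
    have hne1 : sl s a (i + 1) ≠ [] := sl_ne_nil (by omega)
    have hne2 : sl k 1 n ≠ [] := sl_ne_nil hn0
    have hch2 : (sl k 1 n).IsChain (NoRight S) :=
      isChain_sl fun m _ hm => .inr (hst m (by omega)).2
    have hjoin : a + (i + 1) - 1 = a + i := by omega
    have hch : (sl s a (i + 1) ++ sl k 1 n).IsChain (NoRight S) := by
      refine List.IsChain.append (h.isChain _ _) hch2 ?_
      intro x hx y hy
      rw [List.getLast?_eq_some_getLast hne1, getLast_sl, hjoin] at hx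
      rw [List.head?_eq_some_head hne2, head_sl] at hy
      obtain rfl := (Option.mem_some.1 hx).symm
      obtain rfl := (Option.mem_some.1 hy).symm
      exact .inr (hst 0 hn0).2
    -- The straight part has turn zero and every step after it adds one. So the bound on the turn is
    -- a bound on the length of the way back to the core.
    have hle := hP.ts_le hS (hseg1.append hseg2) (fun x hx => (List.mem_append.1 hx).elim
      (out_of_mem_sl h.out x) (hout2 x)) hch haP hn
      (by rw [List.length_append, length_sl, length_sl]; omega) (fun x hx hx0 => by
        rcases List.mem_append.1 hx with hx | hx
        · obtain ⟨m, hm, -, rfl⟩ := mem_sl.1 hx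
          refine hoff m (lt_of_le_of_ne hm ?_)
          rintro rfl
          exact hx0 rfl
        · obtain ⟨m, hm1, hm2, rfl⟩ := mem_sl.1 hx
          obtain ⟨m, rfl⟩ : ∃ k, m = k + 1 := ⟨m - 1, by omega⟩
          rw [(hst m (by omega)).1]
          exact hmin m (by omega))
    rw [ts_append hne1 hne2, getLast_sl, head_sl, hjoin,
      ts_sl_of_turn (c := 1) (fun m _ hm => turn_next hS.1 (hst m (by omega)).1.symm
        (hout m (by omega)) (hout _ (by omega)) (hst m (by omega)).2) hn0,
      ts_sl_of_turn (c := 0) (fun m _ _ => turn_same hS.1 (h.chain m) (h.out _) (h.out _) (hc m))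
        (by omega),
      turn_next hS.1 (d := s (a + i)) (d' := k 1) (hst 0 hn0).1.symm (h.out _) (hout 1 hn0)
        (hst 0 hn0).2] at hle
    refine ⟨sl k 1 n, (k n).snd, hn, hk1 ▸ hseg2, ?_⟩
    rw [length_sl]
    omega

end InfiniteTriangulation

namespace InfiniteTriangulation

variable {V : Type*} {T : InfiniteTriangulation V} {S : ColouredOrientation T.graph}
  {l : List T.graph.Dart}

/-! ### Outgoing edges in fans -/

lemma mem_fan_of_rot {e x y : T.graph.Dart} (h : x.fst = y.fst) (he : T.rot e ∈ T.fan x y)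
    (hne : T.rot e ≠ x) : e ∈ T.fan x y := by
  have h1 := rot_symm_mem_fan (fst_of_mem_fan he).symm
  rw [Equiv.symm_apply_apply] at h1
  exact (fan_trans_mem h he hne).2 (.inl h1)

/-- No outgoing edge lies between `w` and `y`. If `w` were outside the fan, the whole fan, including
the outgoing edge `z`, would lie between them. -/
lemma mem_fan_of_osum_zero {w x y z : T.graph.Dart} (hw : osum S w y = 0) (hwy : w.fst = y.fst)
    (hxy : x.fst = y.fst) (hz : z ∈ T.fan x y) (hzo : S.out z = true) (hne : w ≠ y)
    (hne' : x ≠ y) : w ∈ T.fan x y := by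
  by_contra hc
  have h1 := (mem_fan_or hxy hne' (hwy.trans hxy.symm)).resolve_left hc
  have h2 := mem_fan_rotate hxy.symm hne'.symm h1 hne
  have hxw : x ≠ w := by rintro rfl; exact hc (left_mem_fan hxy)
  refine notMem_fan_of_osum hw hwy hzo ?_ ((fan_trans_mem hwy h2 hxw).2 (.inr hz))
  rintro rfl
  exact hc hz

lemma notMem_fan_of_osum_exterior {x y z : T.graph.Dart} (h : osum S x y = 0)
    (hxy : x.fst = y.fst) (hz : z ∈ T.exterior) : z ∉ T.fan x y := by
  classical
  intro hm
  have h1 := Finset.add_sum_erase (T.fan x y) (weight S) (left_mem_fan hxy)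
  have hv := virt_pos (T := T) z.fst
  have hwz : weight S z = outN S z + T.virt z.fst := by rw [weight, if_pos hz]
  have h0 := outN_nonneg (S := S) z
  have h3 : outN S x ≤ weight S x := by
    have := virt_pos (T := T) x.fst
    unfold weight; split_ifs <;> omega
  unfold osum at h
  by_cases hzx : z = x
  · subst hzx
    have h2 := Finset.sum_nonneg (s := (T.fan z y).erase z) fun a _ => weight_nonneg (S := S) a
    linarith
  · have h2 := Finset.single_le_sum (f := weight S) (fun z _ => weight_nonneg z)
      (Finset.mem_erase.2 ⟨hzx, hm⟩)
    linarith

lemma exists_of_osum_pos {x y : T.graph.Dart} (h : 0 < osum S x y) (hx : S.out x = false) :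
    ∃ z ∈ T.fan x y, S.out z = true ∨ z ∈ T.exterior := by
  by_contra hc
  push Not at hc
  rw [osum, outN_of_false hx, sub_zero, Finset.sum_eq_zero] at h
  · exact lt_irrefl _ h
  · intro z hz
    rw [weight_of_notMem (hc z hz).2, outN_of_false (by simpa using (hc z hz).1)]

/-- With the exterior face on the right, at least one virtual edge lies on the right, which leaves
fewer outgoing edges for the left. -/
lemma neg_outN_le_turn_exterior (hS : T.IsSchnyderWood S) {e : T.graph.Dart} (he : e ∈ T.exterior) :
    outN S (T.rot e) - outN S e.symm ≤ turn S e.symm (T.rot e) := by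
  have h1 := osum_add_osum hS (x := T.rot e) (y := e) (T.rot_fst e) (rot_ne e)
  have h2 : osum S e (T.rot e) = T.virt e.fst := by
    rw [osum, fan_rot, weight, if_pos he]
    ring
  have h3 := virt_pos (T := T) e.fst
  rw [turn, SimpleGraph.Dart.symm_symm, outN_symm]
  linarith

/-- If no left turn is possible at the end of an edge, then this edge is yellow. -/
lemma yellow_of_stuck (hS : T.IsSchnyderWood S) {y : T.graph.Dart} (hout : S.out y = true)
    (hstuck : ∀ x : T.graph.Dart, x.fst = y.snd → S.out x = true →
      S.colour x ≠ (S.colour y).next) : S.colour y = .yellow := by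
  by_cases hy : y.snd = T.vy
  · rw [← S.colour_symm]
    exact in_at_vy hS hy
  by_cases hr : y.snd = T.vr
  · exfalso
    refine hstuck T.root hr.symm (out_root hS) ?_
    rw [colour_root hS, ← S.colour_symm y, in_at_vr hS hr (out_symm_of_true hout)]
    rfl
  obtain ⟨x, hx1, hx2, hx3⟩ := exists_out_red hS hr hy
  obtain ⟨x', hx1', hx2', hx3'⟩ := exists_out_yellow hS hy
  have h1 := hstuck x hx1 hx2
  have h2 := hstuck x' hx1' hx2'
  rw [hx3] at h1
  rw [hx3'] at h2
  cases hc : S.colour y <;> rw [hc] at h1 h2 <;> simp_all [Colour.next]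

/-- A path that stays on the left of a cycle and ends at a boundary vertex off the cycle shows that
the exterior face is on the left. -/
lemma root_symm_mem_left (hl : IsCyc l) {q : List T.graph.Dart} {a : T.graph.Dart} {u w : V}
    (hq : IsSeg u (a :: q) w) (ha : a ∈ T.left l) (hoff : ∀ x ∈ q, ∀ d ∈ l, d.fst ≠ x.fst)
    (hw : ∀ d ∈ l, d.fst ≠ w) (hb : w ∈ T.boundary) : T.root.symm ∈ T.left l := by
  induction q generalizing a u with
  | nil =>
    obtain ⟨-, rfl⟩ := hq
    obtain ⟨e, he, hew⟩ := hb
    have h1 : a.edge ∉ edgesOf l := by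
      rw [← SimpleGraph.Dart.edge_symm]
      exact edge_notMem_of_fst hl.seg hw
    have h2 := left_of_sameRegion ha (InfiniteTriangulation.sameRegion_symm h1)
    have h3 := left_of_sameRegion h2 (sameRegion_of_off hl.seg (y := e) hew.symm hw)
    exact left_of_sameRegion h3 (sameRegion_of_exterior _ he root_symm_mem_exterior)
  | cons b q ih =>
    have hba : b.fst = a.snd := hq.2.1
    have hoffb := hoff b (by simp)
    have h1 : a.edge ∉ edgesOf l := by
      rw [← SimpleGraph.Dart.edge_symm]
      exact edge_notMem_of_fst hl.seg fun d hd => by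
        have := hoffb d hd
        rwa [hba] at this
    have h2 := left_of_sameRegion ha (InfiniteTriangulation.sameRegion_symm h1)
    have h3 := left_of_sameRegion h2 (sameRegion_of_off hl.seg (x := a.symm) (y := b) hba.symm
      fun d hd => by
        have := hoffb d hd
        rwa [hba] at this)
    exact ih hq.2 h3 fun x hx => hoff x (by simp [hx])

/-! ### Finite directed paths -/

/-- A directed path with `n` edges, given by its vertices and its darts. -/
structure IsDiPath (S : ColouredOrientation T.graph) (m : ℕ → V) (s : ℕ → T.graph.Dart) (n : ℕ) :
    Prop where
  fst : ∀ i < n, (s i).fst = m i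
  snd : ∀ i < n, (s i).snd = m (i + 1)
  out : ∀ i < n, S.out (s i) = true
  inj : ∀ i ≤ n, ∀ j ≤ n, m i = m j → i = j

variable {m : ℕ → V} {s : ℕ → T.graph.Dart} {n : ℕ}

lemma IsDiPath.isSeg (h : IsDiPath S m s n) {a k : ℕ} (hk : a + k ≤ n) :
    IsSeg (m a) (sl s a k) (m (a + k)) := by
  induction k with
  | zero => simp [sl]
  | succ k ih =>
    rw [sl_succ]
    refine (ih (by omega)).append ⟨h.fst _ (by omega), ?_⟩
    rw [h.snd _ (by omega)]
    rfl

lemma IsDiPath.nodup (h : IsDiPath S m s n) {a k : ℕ} (hk : a + k ≤ n) :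
    ((sl s a k).map fun d => d.fst).Nodup := by
  rw [sl, List.map_map]
  refine List.Nodup.map_on ?_ List.nodup_range
  intro x hx y hy hxy
  rw [List.mem_range] at hx hy
  simp only [Function.comp_apply, h.fst _ (show a + x < n by omega),
    h.fst _ (show a + y < n by omega)] at hxy
  have := h.inj _ (by omega) _ (by omega) hxy
  omega

lemma IsDiPath.nodup_snd (h : IsDiPath S m s n) {a k : ℕ} (hk : a + k ≤ n) :
    ((sl s a k).map fun d => d.snd).Nodup := by
  rw [sl, List.map_map]
  refine List.Nodup.map_on ?_ List.nodup_range
  intro x hx y hy hxy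
  rw [List.mem_range] at hx hy
  simp only [Function.comp_apply, h.snd _ (show a + x < n by omega),
    h.snd _ (show a + y < n by omega)] at hxy
  have := h.inj _ (by omega) _ (by omega) hxy
  omega

/-- In a maximal Schnyder wood, a path that always goes straight on, or always turns left, ends. -/
lemma exists_isDiPath (hS : T.IsMaximalSchnyderWood S) {f : Colour → Colour}
    (hf : (∀ c, f c = c) ∨ ∀ c, f c = c.next) {z : T.graph.Dart} (hz : S.out z = true) :
    ∃ m s n, IsDiPath S m s (n + 1) ∧ s 0 = z ∧
      (∀ i < n, S.colour (s (i + 1)) = f (S.colour (s i))) ∧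
      ∀ x : T.graph.Dart, x.fst = m (n + 1) → S.out x = true → S.colour x ≠ f (S.colour (s n)) := by
  classical
  have hfR : ∀ a b : T.graph.Dart, S.colour b = f (S.colour a) → NoRight S a b := by
    intro a b hab
    rcases hf with hf | hf
    · exact .inl (hab.trans (hf _))
    · exact .inr (hab.trans (hf _))
  set s := walkSeq S f z with hs
  -- If the walk never got stuck it would be a ray, either monochromatic or with left turns only.
  have hex : ∃ n, ¬ ∃ x : T.graph.Dart, x.fst = (s n).snd ∧ S.out x = true ∧
      S.colour x = f (S.colour (s n)) := by
    by_contra hc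
    push Not at hc
    have hst : ∀ n, (s (n + 1)).fst = (s n).snd ∧ S.out (s (n + 1)) = true ∧
        S.colour (s (n + 1)) = f (S.colour (s n)) := fun n => walkSeq_succ (hc n)
    have hray : IsRay S s := ⟨fun i => (hst i).1.symm, fun i => by
      cases i with
      | zero => exact hz
      | succ i => exact (hst i).2.1, fun i => hfR _ _ (hst i).2.2⟩
    rcases hf with hf | hf
    · exact hray.not_monochromatic hS fun i => (hst i).2.2.trans (hf _)
    · obtain ⟨N, hN⟩ := hray.eventually_straight hS
      exact hN N le_rfl ((hst N).2.2.trans (hf _))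
  have hn := Nat.find_spec hex
  have hst : ∀ i < Nat.find hex, (s (i + 1)).fst = (s i).snd ∧ S.out (s (i + 1)) = true ∧
      S.colour (s (i + 1)) = f (S.colour (s i)) := fun i hi =>
    walkSeq_succ (not_not.1 (Nat.find_min hex hi))
  set n := Nat.find hex
  have hout : ∀ i < n + 1, S.out (s i) = true := by
    intro i hi
    cases i with
    | zero => exact hz
    | succ i => exact (hst i (by omega)).2.1
  set m : ℕ → V := fun i => if i = 0 then z.fst else (s (i - 1)).snd with hm
  have hm1 : ∀ i, m (i + 1) = (s i).snd := fun i => by simp [hm]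
  have hfst : ∀ i < n + 1, (s i).fst = m i := by
    intro i hi
    cases i with
    | zero => simp [hm, hs, walkSeq]
    | succ i => rw [hm1, (hst i (by omega)).1]
  have hinj : ∀ i j, i < j → j ≤ n + 1 → m i ≠ m j := by
    intro i j hij hj hc
    have h1 := isSeg_sl (s := s) (a := i) (n := j - i)
      (fun k _ hk => ((hst k (by omega)).1).symm) (by omega)
    have h2 := nodup_of_noRight hS h1 (fun x hx => by
      obtain ⟨k, -, hk, rfl⟩ := mem_sl.1 hx
      exact hout k (by omega)) (isChain_sl fun k _ hk => hfR _ _ (hst k (by omega)).2.2)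
    rw [List.nodup_append] at h2
    refine h2.2.2 (s i).fst (List.mem_map.2 ⟨s i, mem_sl.2 ⟨i, le_rfl, by omega, rfl⟩, rfl⟩) _
      (List.mem_singleton_self _) ?_
    rw [hfst i (by omega), hc, ← hm1]
    congr 1
    omega
  refine ⟨m, s, n, ⟨hfst, fun i _ => (hm1 i).symm, hout, fun i hi j hj hij => ?_⟩, rfl,
    fun i hi => (hst i hi).2.2, fun x hx ho hc => hn ⟨x, hx.trans (hm1 n), ho, hc⟩⟩
  rcases lt_trichotomy i j with h1 | h1 | h1
  · exact absurd hij (hinj i j h1 hj)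
  · exact h1
  · exact absurd hij.symm (hinj j i h1 hi)

lemma head_rev {l : List T.graph.Dart} (h : rev l ≠ []) (h' : l ≠ []) :
    (rev l).head h = (l.getLast h').symm := by
  simp only [rev]
  rw [List.head_reverse, List.getLast_map]

lemma getLast_rev {l : List T.graph.Dart} (h : rev l ≠ []) (h' : l ≠ []) :
    (rev l).getLast h = (l.head h').symm := by
  simp only [rev]
  rw [List.getLast_reverse, List.head_map]

lemma rev_ne_nil (h : l ≠ []) : rev l ≠ [] := by
  intro hc
  rw [← List.length_eq_zero_iff, length_rev] at hc
  exact h (List.length_eq_zero_iff.1 hc)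

/-- A path that always turns left and a monochromatic path with the same start, where the first two
vertices of the first path are not on the second one, neither path can be continued, and the second
path starts next to the left of the first one. -/
structure IsDivergent (S : ColouredOrientation T.graph) (m p : ℕ → V) (s t : ℕ → T.graph.Dart)
    (A B : ℕ) : Prop where
  path_left : IsDiPath S m s A
  path_straight : IsDiPath S p t B
  two_le : 2 ≤ A
  start : m 0 = p 0
  turn_left : ∀ i, i + 1 < A → S.colour (s (i + 1)) = (S.colour (s i)).next
  colour_straight : ∀ i < B, S.colour (t i) = (S.colour (s 0)).next
  end_left : ∀ x : T.graph.Dart, x.fst = m A → S.out x = true →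
    S.colour x ≠ (S.colour (s (A - 1))).next
  end_straight : ∀ x : T.graph.Dart, x.fst = p B → S.out x = true →
    S.colour x ≠ (S.colour (s 0)).next
  one_ne : ∀ b ≤ B, m 1 ≠ p b
  two_ne : ∀ b ≤ B, m 2 ≠ p b

variable {p : ℕ → V} {t : ℕ → T.graph.Dart} {A B : ℕ}

lemma IsDivergent.end_left_mem (hS : T.IsSchnyderWood S) (h : IsDivergent S m p s t A B) :
    m A ∈ T.boundary := by
  by_contra hc
  obtain ⟨x, h1, h2, h3⟩ := exists_out hS hc (S.colour (s (A - 1))).next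
  exact h.end_left x h1 h2 h3

lemma IsDivergent.end_straight_mem (hS : T.IsSchnyderWood S) (h : IsDivergent S m p s t A B) :
    p B ∈ T.boundary := by
  by_contra hc
  obtain ⟨x, h1, h2, h3⟩ := exists_out hS hc (S.colour (s 0)).next
  exact h.end_straight x h1 h2 h3

lemma IsDivergent.snd_last (h : IsDivergent S m p s t A B) : (s (A - 1)).snd = m A := by
  have := h.two_le
  rw [h.path_left.snd _ (by omega), Nat.sub_add_cancel (by omega)]

lemma IsDivergent.end_yellow (hS : T.IsSchnyderWood S) (h : IsDivergent S m p s t A B) :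
    S.colour (s (A - 1)) = .yellow := by
  have h2 := h.two_le
  refine yellow_of_stuck hS (h.path_left.out _ (by omega))
    fun x hx => h.end_left x (hx.trans h.snd_last)

lemma IsDivergent.ts_left (hS : T.IsSchnyderWood S) (h : IsDivergent S m p s t A B) {a : ℕ}
    (ha : 0 < a) (haA : a ≤ A) : ts S (sl s 0 a) = a - 1 := by
  rw [ts_sl_of_turn (c := 1) (fun i _ hi => turn_next hS
    ((h.path_left.snd i (by omega)).trans (h.path_left.fst _ (by omega)).symm)
    (h.path_left.out _ (by omega)) (h.path_left.out _ (by omega)) (h.turn_left i (by omega))) ha,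
    mul_one]

lemma IsDivergent.ts_rev_straight (hS : T.IsSchnyderWood S) (h : IsDivergent S m p s t A B) {b : ℕ}
    (hb : 0 < b) (hbB : b ≤ B) : ts S (rev (sl t 0 b)) = 0 := by
  have hout : ∀ x ∈ sl t 0 b, S.out x = true := by
    intro x hx
    obtain ⟨i, -, hi, rfl⟩ := mem_sl.1 hx
    exact h.path_straight.out i (by omega)
  rw [ts_rev hS (h.path_straight.isSeg (a := 0) (k := b) (by omega)) (sl_ne_nil hb)
    (fun x hx y hy hxy => symm_notMem_of_out hout x hx (hxy ▸ hy)), getLast_sl, head_sl,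
    ts_sl_of_turn (c := 0) (fun i _ hi => turn_same hS
      ((h.path_straight.snd i (by omega)).trans (h.path_straight.fst _ (by omega)).symm)
      (h.path_straight.out _ (by omega)) (h.path_straight.out _ (by omega))
      ((h.colour_straight _ (by omega)).trans (h.colour_straight _ (by omega)).symm)) hb,
    outN_of_true (h.path_straight.out _ (by omega)),
    outN_of_true (h.path_straight.out _ (by omega))]
  simp

lemma IsDivergent.turn_start (hS : T.IsSchnyderWood S) (h : IsDivergent S m p s t A B)
    (hB : 0 < B) : turn S (t 0).symm (s 0) = 1 := by
  have h2 := h.two_le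
  rw [turn, SimpleGraph.Dart.symm_symm, osum_out_next hS
    ((h.path_left.fst 0 (by omega)).trans (h.start.trans (h.path_straight.fst 0 hB).symm))
    (h.path_left.out 0 (by omega)) (h.path_straight.out 0 hB) (h.colour_straight 0 hB), sub_zero]

lemma IsDivergent.fst_rev_straight (h : IsDivergent S m p s t A B) {b : ℕ} (hbB : b ≤ B) :
    ∀ x ∈ rev (sl t 0 b), ∃ i, 1 ≤ i ∧ i ≤ b ∧ x.fst = p i := by
  intro x hx
  obtain ⟨i, -, hi, hix⟩ := mem_sl.1 (mem_rev.1 hx)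
  refine ⟨i + 1, by omega, by omega, ?_⟩
  rw [← h.path_straight.snd i (by omega), hix]
  rfl

lemma IsDivergent.fst_left (h : IsDivergent S m p s t A B) {a k : ℕ} (hk : a + k ≤ A) :
    ∀ x ∈ sl s a k, ∃ i, a ≤ i ∧ i < a + k ∧ x.fst = m i := by
  intro x hx
  obtain ⟨i, h1, h2, rfl⟩ := mem_sl.1 hx
  exact ⟨i, h1, h2, h.path_left.fst i (by omega)⟩

/-- The two paths have only their start in common. -/
lemma IsDivergent.disjoint (hS : T.IsMaximalSchnyderWood S) (h : IsDivergent S m p s t A B)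
    {a b : ℕ} (ha : 1 ≤ a) (haA : a ≤ A) (hbB : b ≤ B) : m a ≠ p b := by
  classical
  intro hab
  have hex : ∃ b, b ≤ B ∧ ∃ a, 1 ≤ a ∧ a ≤ A ∧ m a = p b := ⟨b, hbB, a, ha, haA, hab⟩
  obtain ⟨hbB, a, ha, haA, hab⟩ := Nat.find_spec hex
  have hmin : ∀ b' < Nat.find hex, ∀ a', 1 ≤ a' → a' ≤ A → m a' ≠ p b' := fun b' hb' a' h1 h2 hc =>
    Nat.find_min hex hb' ⟨by omega, a', h1, h2, hc⟩
  set b := Nat.find hex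
  have hA2 := h.two_le
  have hμ := h.path_left
  have hP := h.path_straight
  have hb : 0 < b := by
    refine Nat.pos_of_ne_zero fun h0 => ?_
    rw [h0, ← h.start] at hab
    have := hμ.inj a haA 0 (by omega) hab
    omega
  -- This is the use of the hypothesis that the first two vertices are off the straight path.
  have ha3 : 3 ≤ a := by
    by_contra hc
    obtain rfl | rfl : a = 1 ∨ a = 2 := by omega
    · exact h.one_ne b hbB hab
    · exact h.two_ne b hbB hab
  set X := sl s 0 a with hX
  set Y := rev (sl t 0 b) with hY
  have hXn : X ≠ [] := sl_ne_nil (by omega)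
  have hYn' : sl t 0 b ≠ [] := sl_ne_nil hb
  have hYn : Y ≠ [] := rev_ne_nil hYn'
  have hsX : IsSeg (m 0) X (m a) := by
    have := hμ.isSeg (a := 0) (k := a) (by omega)
    rwa [zero_add] at this
  have hsY : IsSeg (m a) Y (m 0) := by
    have := (hP.isSeg (a := 0) (k := b) (by omega)).rev
    rwa [zero_add, ← h.start, ← hab] at this
  have hfX := h.fst_left (a := 0) (k := a) (by omega)
  have hfY := h.fst_rev_straight hbB
  have hcyc : IsCyc (X ++ Y) := by
    refine ⟨?_, ?_, _, hsX.append hsY⟩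
    · rw [List.length_append, length_sl]
      omega
    · rw [List.map_append, List.nodup_append]
      refine ⟨hμ.nodup (by omega), ?_, ?_⟩
      · rw [hY, map_fst_rev, List.nodup_reverse]
        exact hP.nodup_snd (by omega)
      · rintro x hx y hy rfl
        obtain ⟨d, hd, rfl⟩ := List.mem_map.1 hx
        obtain ⟨e, he, hed⟩ := List.mem_map.1 hy
        obtain ⟨i, -, hi, h1⟩ := hfX d hd
        obtain ⟨j, hj1, hj2, h2⟩ := hfY e he
        have h3 : m i = p j := by rw [← h1, ← h2]; exact hed.symm
        rcases Nat.eq_zero_or_pos i with rfl | h0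
        · rw [h.start] at h3
          have := hP.inj 0 (by omega) j (by omega) h3
          omega
        · rcases hj2.lt_or_eq with h4 | rfl
          · exact hmin j h4 i h0 (by omega) h3
          · have := hμ.inj i (by omega) a haA (h3.trans hab.symm)
            omega
  set y := (s (a - 1)).symm with hy
  set x := (t (b - 1)).symm with hx
  have hys : (s (a - 1)).snd = m a := by
    rw [hμ.snd _ (by omega), Nat.sub_add_cancel ha]
  have hxs : (t (b - 1)).snd = m a := by
    rw [hP.snd _ (by omega), Nat.sub_add_cancel hb, hab]
  have hxy : x.fst = y.fst := hxs.trans hys.symm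
  have hsum := cturn_append (S := S) hXn hYn
  rw [h.ts_left hS.1 (by omega) haA, h.ts_rev_straight hS.1 hb hbB] at hsum
  simp only [hX, hY, head_rev _ hYn', getLast_rev _ hYn', getLast_sl, head_sl] at hsum
  rw [h.turn_start hS.1 (by omega), zero_add, zero_add, ← hX, ← hY, ← hx] at hsum
  have h1 := neg_two_le_turn (S := S) hS.1 (d := s (a - 1)) (d' := x) hxy.symm
  -- The total turn is `a` plus the turn at the meeting point, hence at least `a - 2 > -3`.
  have hnl : T.root.symm ∉ T.left (X ++ Y) := by
    intro hc
    have := (cturn_eq hS.1 hcyc).1 hc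
    have : (3 : ℤ) ≤ a := by exact_mod_cast ha3
    omega
  -- As the total turn is 3, there are exactly `a - 2` outgoing edges in the corner at the meeting
  -- point, inside the cycle.
  have hos : 0 < osum S x y := by
    have h2 := (cturn_eq hS.1 hcyc).2 hnl
    have : (3 : ℤ) ≤ a := by exact_mod_cast ha3
    unfold turn at hsum
    rw [h2, ← hy] at hsum
    linarith
  have hsX' : s (a - 1) ∈ X ++ Y :=
    List.mem_append_left _ (mem_sl.2 ⟨a - 1, by omega, by omega, rfl⟩)
  have hxY : x ∈ X ++ Y := List.mem_append_right _ (mem_rev.2 (mem_sl.2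
    ⟨b - 1, by omega, by omega, by rw [hx, SimpleGraph.Dart.symm_symm]⟩))
  have hfan : ∀ z ∈ T.fan x y, z ∈ T.left (X ++ Y) := fun z hz =>
    left_of_sameRegion (mem_left hxY) (hcyc.sameRegion_left_fan hsX' hxY hxy.symm hz)
  have hext : ∀ z ∈ T.fan x y, z ∉ T.exterior := fun z hz hc =>
    hnl (left_of_sameRegion (hfan z hz) (sameRegion_of_exterior _ hc root_symm_mem_exterior))
  obtain ⟨z, hz, hzo⟩ := exists_of_osum_pos hos (out_symm_of_true (hP.out _ (by omega)))
  replace hzo := hzo.resolve_right (hext z hz)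
  have hyo : S.out y = false := out_symm_of_true (hμ.out _ (by omega))
  have hne : x ≠ y := by
    intro hc
    have h2 := congrArg (fun d : T.graph.Dart => d.snd) hc
    have h3 : (t (b - 1)).fst = (s (a - 1)).fst := h2
    rw [hP.fst _ (by omega), hμ.fst _ (by omega)] at h3
    exact hmin (b - 1) (by omega) (a - 1) (by omega) (by omega) h3.symm
  -- If the turning path goes on, its next edge is the first outgoing one on the left and so lies
  -- inside; the path is then trapped, although it has to end on the boundary. If it ends here, its
  -- last edge is yellow and the exterior corner comes just before it, which puts the exterior face
  -- inside.
  rcases haA.lt_or_eq with haA' | rfl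
  · have hcol := h.turn_left (a - 1) (by omega)
    rw [Nat.sub_add_cancel ha] at hcol
    have hsy : (s a).fst = y.fst := (hμ.fst a haA').trans hys.symm
    have h2 := (osum_in_out hS.1 hsy (hμ.out a haA') hyo).1 (by rw [hy, S.colour_symm]; exact hcol)
    have h3 := mem_fan_of_osum_zero h2 hsy hxy hz hzo (by
      intro hc
      rw [← hc, hμ.out a haA'] at hyo
      cases hyo) hne
    have hseg := hμ.isSeg (a := a) (k := A - a) (by omega)
    obtain ⟨k, hk⟩ : ∃ k, A - a = k + 1 := ⟨A - a - 1, by omega⟩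
    rw [hk, sl_succ'] at hseg
    have hoff : ∀ i, a < i → i ≤ A → ∀ d ∈ X ++ Y, d.fst ≠ m i := by
      intro i hi hiA d hd hdi
      rcases List.mem_append.1 hd with hd | hd
      · obtain ⟨j, -, hj, h4⟩ := hfX d hd
        have := hμ.inj j (by omega) i hiA (h4.symm.trans hdi)
        omega
      · obtain ⟨j, hj1, hj2, h4⟩ := hfY d hd
        have h5 : m i = p j := hdi.symm.trans h4
        rcases hj2.lt_or_eq with h6 | rfl
        · exact hmin j h6 i (by omega) hiA h5
        · have := hμ.inj i hiA a haA (h5.trans hab.symm)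
          omega
    refine hnl (root_symm_mem_left hcyc hseg (hfan _ h3) (fun q hq d hd => ?_)
      (hoff _ (by omega) (by omega)) ?_)
    · obtain ⟨i, hi1, hi2, h4⟩ := h.fst_left (a := a + 1) (k := k) (by omega) q hq
      rw [h4]
      exact hoff i (by omega) (by omega) d hd
    · rw [show a + (k + 1) = A by omega]
      exact h.end_left_mem hS.1
  · obtain ⟨e, he, hem⟩ := h.end_left_mem hS.1
    have hey : y.fst = e.fst := hys.trans hem.symm
    have hre : (T.rot e).fst = y.fst := (T.rot_fst e).trans hey.symm
    have hee : e ∉ T.fan x y := fun hc => hext e hc he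
    by_cases hry : y = T.rot e
    · have := rot_symm_mem_fan hxy
      rw [hry, Equiv.symm_apply_apply, ← hry] at this
      exact hee this
    · have h2 := osum_first_in_yellow hS.1 he hey hyo
        (by rw [hy, S.colour_symm]; exact h.end_yellow hS.1) hry
      have h3 := mem_fan_of_osum_zero h2.1 hre hxy hz hzo (Ne.symm hry) hne
      by_cases hrx : T.rot e = x
      · refine notMem_fan_of_osum h2.1 hre hzo ?_ (hrx ▸ hz)
        rintro rfl
        rw [h2.2] at hzo
        cases hzo
      · exact hee (mem_fan_of_rot hxy h3 hrx)

end InfiniteTriangulation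

/-! ### The arc of the exterior face between the ends of two divergent paths -/

namespace InfiniteTriangulation

variable {V : Type*} {T : InfiniteTriangulation V} {S : ColouredOrientation T.graph}
  {m p : ℕ → V} {s t : ℕ → T.graph.Dart} {A B : ℕ}

/-- The darts of the exterior face, starting with `e`. -/
def extSeq (e : T.graph.Dart) (n : ℕ) : T.graph.Dart := T.faceNext^[n] e

lemma extSeq_succ (e : T.graph.Dart) (n : ℕ) : extSeq e (n + 1) = T.faceNext (extSeq e n) :=
  Function.iterate_succ_apply' _ _ _

lemma extSeq_add (e : T.graph.Dart) (n k : ℕ) : extSeq e (n + k) = T.faceNext^[n] (extSeq e k) :=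
  Function.iterate_add_apply _ _ _ _

lemma extSeq_mem {e : T.graph.Dart} (he : e ∈ T.exterior) (n : ℕ) : extSeq e n ∈ T.exterior := by
  induction n with
  | zero => exact he
  | succ n ih => rw [extSeq_succ]; exact faceNext_mem_exterior.2 ih

lemma extSeq_chain (e : T.graph.Dart) (n : ℕ) : (extSeq e n).snd = (extSeq e (n + 1)).fst := by
  rw [extSeq_succ, faceNext_fst]

lemma rot_extSeq_succ (e : T.graph.Dart) (n : ℕ) :
    T.rot (extSeq e (n + 1)) = (extSeq e n).symm := by
  rw [extSeq_succ, rot_faceNext]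

/-- The face is finite and `faceNext` is injective, so the sequence is periodic. The index is
required to be positive so that the walk always leaves `e`. -/
lemma exists_extSeq {e e' : T.graph.Dart} (he : e ∈ T.exterior) (he' : e' ∈ T.exterior) :
    ∃ n ≥ 1, extSeq e n = e' := by
  obtain ⟨a, b, hab, h⟩ : ∃ a b, a < b ∧ extSeq e a = extSeq e b := by
    obtain ⟨a, -, b, -, hne, h⟩ := Set.infinite_univ.exists_ne_map_eq_of_mapsTo
      (f := extSeq e) (t := T.exterior) (fun n _ => extSeq_mem he n) T.exterior_finite
    rcases lt_or_gt_of_ne hne with h1 | h1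
    · exact ⟨a, b, h1, h⟩
    · exact ⟨b, a, h1, h.symm⟩
  have hper : extSeq e (b - a) = e := by
    have h1 : extSeq e b = T.faceNext^[a] (extSeq e (b - a)) := by
      rw [← extSeq_add, Nat.add_sub_cancel' hab.le]
    exact (faceNext_injective.iterate a (h.trans h1)).symm
  have hmem : ∀ z, z ∈ {z | ∃ n ≥ 1, extSeq e n = z} ↔
      T.faceNext z ∈ {z | ∃ n ≥ 1, extSeq e n = z} := by
    intro z
    constructor
    · rintro ⟨n, hn, rfl⟩
      exact ⟨n + 1, by omega, extSeq_succ e n⟩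
    · rintro ⟨n, hn, h1⟩
      obtain ⟨n, rfl⟩ : ∃ k, n = k + 1 := ⟨n - 1, by omega⟩
      rw [extSeq_succ] at h1
      refine ⟨n + (b - a), by omega, ?_⟩
      rw [extSeq_add, hper]
      exact faceNext_injective h1
  have h0 : e ∈ {z | ∃ n ≥ 1, extSeq e n = z} := ⟨b - a, by omega, hper⟩
  exact mem_of_mem_face hmem h0 (by rw [face_eq_of_mem he]; exact he')

/-- A telescoping sum of the bounds in `neg_outN_le_turn_exterior`. -/
lemma le_ts_rev_extSeq (hS : T.IsSchnyderWood S) {e : T.graph.Dart} (he : e ∈ T.exterior)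
    (j n : ℕ) : outN S (extSeq e j).symm - outN S (extSeq e (j + n)).symm ≤
      ts S (rev (sl (extSeq e) j (n + 1))) := by
  induction n with
  | zero => simp [sl, rev]
  | succ n ih =>
    have hne : sl (extSeq e) j (n + 1) ≠ [] := sl_ne_nil (by omega)
    have h1 : rev (sl (extSeq e) j (n + 1 + 1)) =
        (extSeq e (j + (n + 1))).symm :: rev (sl (extSeq e) j (n + 1)) := by
      rw [sl_succ, rev_append]
      simp [rev]
    rw [h1, ts_cons _ (rev_ne_nil hne), head_rev _ hne, getLast_sl,
      show j + (n + 1) - 1 = j + n by omega, ← rot_extSeq_succ, ← add_assoc]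
    have h2 := neg_outN_le_turn_exterior hS (extSeq_mem he (j + n + 1))
    rw [rot_extSeq_succ] at h2 ⊢
    linarith

lemma eq_of_mem_fan_rot {w z : T.graph.Dart} (h : w ∈ T.fan z (T.rot z)) : w = z := by
  have h1 : T.gap z (T.rot z) = 1 := le_antisymm (gap_le one_pos (by simp))
    (gap_pos (T.rot_fst z).symm)
  obtain ⟨k, hk, rfl⟩ := mem_fan.1 h
  obtain rfl : k = 0 := by omega
  rfl

/-- In a maximal Schnyder wood the two paths of a divergent pair do not exist. -/
theorem not_isDivergent (hS : T.IsMaximalSchnyderWood S) (h : IsDivergent S m p s t A B) :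
    False := by
  classical
  have hA2 := h.two_le
  have hμ := h.path_left
  have hP := h.path_straight
  obtain ⟨e, he, hep⟩ := h.end_straight_mem hS.1
  obtain ⟨e', he', hem⟩ := h.end_left_mem hS.1
  set g := extSeq e with hg
  have hgx : ∀ i, g i ∈ T.exterior := extSeq_mem he
  have hgc : ∀ i, (g i).snd = (g (i + 1)).fst := extSeq_chain e
  have hg0 : (g 0).fst = p B := hep
  -- Follow the exterior face from the end of the straight path. `i` is the first time at which the
  -- turning path is met, apart from the common start, and `j` the last time before `i` at the
  -- straight path; between them the arc avoids both paths.
  have hex : ∃ i, 1 ≤ i ∧ ∃ a, 1 ≤ a ∧ a ≤ A ∧ (g i).fst = m a := by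
    obtain ⟨n, hn, hne⟩ := exists_extSeq he he'
    exact ⟨n, hn, A, by omega, le_rfl, by rw [hg, hne, hem]⟩
  obtain ⟨hi1, a, ha1, haA, hia⟩ := Nat.find_spec hex
  have himin : ∀ k < Nat.find hex, 1 ≤ k → ∀ a, 1 ≤ a → a ≤ A → (g k).fst ≠ m a :=
    fun k hk h1 a h2 h3 hc => Nat.find_min hex hk ⟨h1, a, h2, h3, hc⟩
  set i := Nat.find hex
  set j := Nat.findGreatest (fun j => ∃ b ≤ B, (g j).fst = p b) (i - 1) with hj
  obtain ⟨b, hbB, hjb⟩ : ∃ b ≤ B, (g j).fst = p b :=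
    Nat.findGreatest_spec (P := fun j => ∃ b ≤ B, (g j).fst = p b) (Nat.zero_le (i - 1))
      ⟨B, le_rfl, hg0⟩
  have hji : j ≤ i - 1 := Nat.findGreatest_le _
  have hPoff : ∀ k, j < k → k < i → ∀ b ≤ B, (g k).fst ≠ p b := fun k h1 h2 b hb hc =>
    Nat.findGreatest_is_greatest (P := fun j => ∃ b ≤ B, (g j).fst = p b) h1 (by omega) ⟨b, hb, hc⟩
  have hPoff' : ∀ k, j < k → k ≤ i → ∀ b ≤ B, (g k).fst ≠ p b := by
    intro k h1 h2 b hb hc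
    rcases h2.lt_or_eq with h3 | rfl
    · exact hPoff k h1 h3 b hb hc
    · exact h.disjoint hS ha1 haA hb (hia.symm.trans hc)
  have hμoff : ∀ k, j < k → k < i → ∀ a ≤ A, (g k).fst ≠ m a := by
    intro k h1 h2 a ha hc
    rcases Nat.eq_zero_or_pos a with rfl | h0
    · exact hPoff k h1 h2 0 (by omega) (hc.trans h.start)
    · exact himin k h2 (by omega) a h0 ha hc
  have hgi : ∀ k k', k < k' → k' ≤ i → (g k).fst ≠ (g k').fst := by
    intro k k' hkk hk' hc
    have h1 := eq_of_mem_exterior (hgx k) (hgx k') hc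
    have h2 : g (i - k' + k) = g i := by
      rw [hg, extSeq_add]
      change T.faceNext^[i - k'] (g k) = _
      rw [h1, hg, ← extSeq_add, Nat.sub_add_cancel hk']
    rcases Nat.eq_zero_or_pos (i - k' + k) with h3 | h3
    · rw [h3] at h2
      rw [← h2, hg0] at hia
      exact h.disjoint hS ha1 haA le_rfl hia.symm
    · exact himin _ (by omega) h3 a ha1 haA (h2 ▸ hia)
  -- The first edge of the turning path cannot be the last edge of the arc. No blue edge leaves the
  -- boundary; a red edge with the exterior face on its left would leave no place for the outgoing
  -- yellow one; and after a yellow edge the turning path would have to leave the boundary vertex by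
  -- a blue edge.
  have hρ1 : a = 1 → g (i - 1) ≠ s (a - 1) := by
    rintro rfl hc
    have hx : s 0 ∈ T.exterior := hc ▸ hgx _
    have hs0 := hμ.out 0 (by omega)
    have hsb : (s 0).fst ∈ T.boundary := ⟨_, hx, rfl⟩
    have hst : p 0 = (s 0).fst := h.start.symm.trans (hμ.fst 0 (by omega)).symm
    cases hcol : S.colour (s 0) with
    | blue => exact no_blue_out hS.1 hsb hs0 hcol
    | red =>
      rcases Nat.eq_zero_or_pos B with hB | hB
      · have hvy : (s 0).fst ≠ T.vy := by
          intro hc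
          have := hS.1.2.2.2.1 _ hc
          rw [hs0] at this
          cases this
        obtain ⟨x, h1, h2, h3⟩ := exists_out_yellow hS.1 hvy
        refine h.end_straight x (by rw [hB, hst, h1]) h2 ?_
        rw [h3, hcol]
        rfl
      · have hct := h.colour_straight 0 hB
        rw [hcol] at hct
        have := (osum_out_yellow_last hS.1 hx (x := t 0) ((hP.fst 0 hB).trans hst)
          (hP.out 0 hB) hct (by
            intro hc
            rw [hc, hcol] at hct
            cases hct)).2
        rw [hs0] at this
        cases this
    | yellow =>
      have h1 := h.turn_left 0 (by omega)
      rw [hcol] at h1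
      refine no_blue_out hS.1 (x := s 1) ⟨g i, hgx i, ?_⟩ (hμ.out 1 (by omega)) h1
      rw [hia, hμ.fst 1 (by omega)]
  have hρ : g (i - 1) ≠ s (a - 1) := by
    intro hc
    have h1 : a ≠ 1 := fun h1 => hρ1 h1 hc
    have h2 : (g (i - 1)).fst = m (a - 1) := by rw [hc, hμ.fst _ (by omega)]
    rcases Nat.eq_zero_or_pos (i - 1) with h3 | h3
    · rw [h3, hg0] at h2
      exact h.disjoint hS (by omega) (by omega) le_rfl h2.symm
    · exact himin _ (by omega) h3 (a - 1) (by omega) (by omega) h2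
  set X := sl s 0 a with hX
  set R := rev (sl g j (i - j)) with hR
  set Y := rev (sl t 0 b) with hY
  have hXn : X ≠ [] := sl_ne_nil (by omega)
  have hRn' : sl g j (i - j) ≠ [] := sl_ne_nil (by omega)
  have hRn : R ≠ [] := rev_ne_nil hRn'
  have hsX : IsSeg (m 0) X (m a) := by
    have := hμ.isSeg (a := 0) (k := a) (by omega)
    rwa [zero_add] at this
  have hsR : IsSeg (m a) R (p b) := by
    have := (isSeg_sl (s := g) (a := j) (n := i - j) (fun k _ _ => hgc k) (by omega)).rev
    rwa [hgc, show j + (i - j) - 1 + 1 = i by omega, hia, hjb] at this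
  have hsY : IsSeg (p b) Y (m 0) := by
    have := (hP.isSeg (a := 0) (k := b) (by omega)).rev
    rwa [zero_add, ← h.start] at this
  have hfX := h.fst_left (a := 0) (k := a) (by omega)
  have hfY := h.fst_rev_straight hbB
  have hfR : ∀ x ∈ R, ∃ k, j < k ∧ k ≤ i ∧ x.fst = (g k).fst := by
    intro x hx
    obtain ⟨k, h1, h2, h3⟩ := mem_sl.1 (mem_rev.1 hx)
    refine ⟨k + 1, by omega, by omega, ?_⟩
    rw [← hgc, h3]
    rfl
  have hcyc : IsCyc (X ++ (R ++ Y)) := by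
    refine ⟨?_, ?_, _, hsX.append (hsR.append hsY)⟩
    · simp only [List.length_append, hX, hR, hY, length_rev, length_sl]
      by_contra hc
      obtain ⟨rfl, hij, rfl⟩ : a = 1 ∧ j = i - 1 ∧ b = 0 := by omega
      refine hρ (T.dart_ext ?_ ?_)
      · rw [← hij, hjb, ← h.start, hμ.fst _ (by omega)]
      · rw [hgc, Nat.sub_add_cancel hi1, hia, hμ.snd _ (by omega)]
    · rw [List.map_append, List.map_append, List.nodup_append, List.nodup_append]
      refine ⟨hμ.nodup (by omega), ⟨?_, ?_, ?_⟩, ?_⟩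
      · rw [hR, map_fst_rev, List.nodup_reverse, sl, List.map_map]
        refine List.Nodup.map_on ?_ List.nodup_range
        intro x hx y hy hxy
        rw [List.mem_range] at hx hy
        simp only [Function.comp_apply, hgc] at hxy
        rcases lt_trichotomy x y with h1 | h1 | h1
        · exact absurd hxy (hgi _ _ (by omega) (by omega))
        · exact h1
        · exact absurd hxy.symm (hgi _ _ (by omega) (by omega))
      · rw [hY, map_fst_rev, List.nodup_reverse]
        exact hP.nodup_snd (by omega)
      · rintro x hx y hy rfl
        obtain ⟨d, hd, rfl⟩ := List.mem_map.1 hx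
        obtain ⟨d', hd', hdd⟩ := List.mem_map.1 hy
        obtain ⟨k, hk1, hk2, h1⟩ := hfR d hd
        obtain ⟨b', hb1, hb2, h2⟩ := hfY d' hd'
        exact hPoff' k hk1 hk2 b' (by omega) (h1.symm.trans (hdd.symm.trans h2))
      · rintro x hx y hy rfl
        obtain ⟨d, hd, rfl⟩ := List.mem_map.1 hx
        obtain ⟨a', -, ha2, h1⟩ := hfX d hd
        rcases List.mem_append.1 hy with hy | hy
        · obtain ⟨d', hd', hdd⟩ := List.mem_map.1 hy
          obtain ⟨k, hk1, hk2, h2⟩ := hfR d' hd'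
          have h3 : (g k).fst = m a' := by rw [← h1, ← h2]; exact hdd
          rcases hk2.lt_or_eq with h4 | rfl
          · exact hμoff k hk1 h4 a' (by omega) h3
          · have := hμ.inj _ haA _ (by omega) (hia.symm.trans h3)
            omega
        · obtain ⟨d', hd', hdd⟩ := List.mem_map.1 hy
          obtain ⟨b', hb1, hb2, h2⟩ := hfY d' hd'
          have h3 : m a' = p b' := by rw [← h1, ← h2]; exact hdd.symm
          rcases Nat.eq_zero_or_pos a' with rfl | h0
          · rw [h.start] at h3
            have := hP.inj 0 (by omega) b' (by omega) h3
            omega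
          · exact h.disjoint hS h0 (by omega) (by omega) h3
  set c := X ++ (R ++ Y) with hc
  have hgc' : ∀ k, j ≤ k → k < i → (g k).symm ∈ c := fun k h1 h2 =>
    List.mem_append_right _ (List.mem_append_left _ (mem_rev.2 (mem_sl.2 ⟨k, h1, by omega, by
      rw [SimpleGraph.Dart.symm_symm]⟩)))
  -- The arc is traversed backwards, so the exterior face is on the right.
  have hnl : T.root.symm ∉ T.left c := fun hcl => by
    refine hcyc.disjoint hcl ?_
    have h1 := symm_mem_right (hgc' j le_rfl (by omega))
    rw [SimpleGraph.Dart.symm_symm] at h1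
    exact right_of_sameRegion h1 (sameRegion_of_exterior _ (hgx j) root_symm_mem_exterior)
  have hsc : s (a - 1) ∈ c := List.mem_append_left _ (mem_sl.2 ⟨a - 1, by omega, by omega, rfl⟩)
  set y := (s (a - 1)).symm with hy
  set x := (g (i - 1)).symm with hx
  have hxc : x ∈ c := hgc' _ hji (by omega)
  have hrx : T.rot (g i) = x := by
    have := rot_extSeq_succ e (i - 1)
    rwa [Nat.sub_add_cancel hi1] at this
  have hys : (s (a - 1)).snd = m a := by
    rw [hμ.snd _ (by omega), Nat.sub_add_cancel ha1]
  have hxf : x.fst = (g i).fst := by rw [← hrx, T.rot_fst]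
  have hxy : x.fst = y.fst := hxf.trans (hia.trans hys.symm)
  have hyo : S.out y = false := out_symm_of_true (hμ.out _ (by omega))
  have hne : x ≠ y := fun hc => hρ (SimpleGraph.Dart.symm_involutive.injective hc)
  -- Otherwise the next edge of the turning path would enter the inside of the cycle, where the path
  -- would be trapped before reaching the boundary.
  have haA' : a = A := by
    refine haA.eq_of_not_lt fun hlt => ?_
    have hcol := h.turn_left (a - 1) (by omega)
    rw [Nat.sub_add_cancel ha1] at hcol
    have hsy : (s a).fst = y.fst := (hμ.fst a hlt).trans hys.symm
    have h2 := (osum_in_out hS.1 hsy (hμ.out a hlt) hyo).1 (by rw [hy, S.colour_symm]; exact hcol)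
    have hsy' : s a ≠ y := by
      intro hc
      rw [← hc, hμ.out a hlt] at hyo
      cases hyo
    have h3 : s a ∈ T.fan x y := by
      by_contra hcon
      have h4 := (mem_fan_or hxy hne (hsy.trans hxy.symm)).resolve_left hcon
      have h5 := mem_fan_rotate hxy.symm hne.symm h4 hsy'
      have hxs : x ≠ s a := by
        intro hc
        exact hcon (hc ▸ left_mem_fan hxy)
      rw [← hrx] at h5 hxs
      exact notMem_fan_of_osum_exterior h2 hsy (hgx i) (mem_fan_of_rot hsy h5 hxs)
    have hseg := hμ.isSeg (a := a) (k := A - a) (by omega)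
    obtain ⟨k, hk⟩ : ∃ k, A - a = k + 1 := ⟨A - a - 1, by omega⟩
    rw [hk, sl_succ'] at hseg
    have hoff : ∀ a', a < a' → a' ≤ A → ∀ d ∈ c, d.fst ≠ m a' := by
      intro a' ha' haA' d hd hda
      rcases List.mem_append.1 hd with hd | hd
      · obtain ⟨b', -, hb, h4⟩ := hfX d hd
        have := hμ.inj b' (by omega) a' haA' (h4.symm.trans hda)
        omega
      rcases List.mem_append.1 hd with hd | hd
      · obtain ⟨k', hk1, hk2, h4⟩ := hfR d hd
        rcases hk2.lt_or_eq with h5 | rfl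
        · exact hμoff k' hk1 h5 a' haA' (h4.symm.trans hda)
        · have := hμ.inj _ haA _ haA' (hia.symm.trans (h4.symm.trans hda))
          omega
      · obtain ⟨b', hb1, hb2, h4⟩ := hfY d hd
        exact h.disjoint hS (by omega) haA' (by omega) (hda.symm.trans h4)
    refine hnl (root_symm_mem_left hcyc hseg (left_of_sameRegion (mem_left hxc)
      (hcyc.sameRegion_left_fan hsc hxc hxy.symm h3)) (fun q hq d hd => ?_)
      (hoff _ (by omega) (by omega)) ?_)
    · obtain ⟨k', hk1, hk2, h4⟩ := h.fst_left (a := a + 1) (k := k) (by omega) q hq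
      rw [h4]
      exact hoff k' (by omega) (by omega) d hd
    · rw [show a + (k + 1) = A by omega]
      exact h.end_left_mem hS.1
  clear_value i j
  subst haA'
  have hx1 := osum_first_in_yellow hS.1 (hgx i) (y := y) (hxy.symm.trans hxf) hyo
    (by rw [hy, S.colour_symm]; exact h.end_yellow hS.1) (by rw [hrx]; exact hne.symm)
  rw [hrx] at hx1
  have hturn1 : turn S (s (a - 1)) x = 1 := by rw [turn, ← hy, hx1.1, sub_zero]
  have hgs : ∀ b' ≤ B, (g j).snd ≠ p b' := fun b' hb' hc =>
    hPoff' (j + 1) (by omega) (by omega) b' hb' ((hgc j).symm.trans hc)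
  -- For a yellow straight path the arc starts at its very end: no outgoing edge separates the
  -- outgoing yellow edge from the exterior corner, so a further yellow edge would lead inside.
  have hyellow : S.colour (s 0) = .red → b = B := by
    intro hred
    refine hbB.eq_of_not_lt fun hlt => ?_
    have hct : S.colour (t b) = .yellow := by rw [h.colour_straight b hlt, hred]; rfl
    have htf : (t b).fst = (g j).fst := (hP.fst b hlt).trans hjb.symm
    have htg : t b ≠ g j := fun hc => hgs (b + 1) (by omega) (by rw [← hc, hP.snd b hlt])
    have h1 := (osum_out_yellow_last hS.1 (hgx j) htf (hP.out b hlt) hct htg).1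
    obtain ⟨d, hd, hdf, htd⟩ : ∃ d ∈ c, d.fst = (g j).fst ∧ t b ∈ T.fan d (g j) := by
      rcases Nat.eq_zero_or_pos b with hb0 | hb0
      · have hs0 : (s 0).fst = (g j).fst := by
          rw [hμ.fst 0 (by omega), h.start, hjb, hb0]
        have hs0g : s 0 ≠ g j := by
          intro hc
          have := (osum_out_yellow_last hS.1 (hgx j) htf (hP.out b hlt) hct htg).2
          rw [← hc, hμ.out 0 (by omega)] at this
          cases this
        have hst : s 0 ≠ t b := fun hc => by rw [← hc, hred] at hct; cases hct
        refine ⟨s 0, List.mem_append_left _ (mem_sl.2 ⟨0, le_rfl, by omega, rfl⟩), hs0, ?_⟩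
        by_contra hcon
        have h2 := (mem_fan_or hs0 hs0g (htf.trans hs0.symm)).resolve_left hcon
        exact notMem_fan_of_osum h1 htf (hμ.out 0 (by omega)) hst
          (mem_fan_rotate hs0.symm hs0g.symm h2 htg)
      · have hdo : S.out (t (b - 1)).symm = false := out_symm_of_true (hP.out _ (by omega))
        have hdf : (t (b - 1)).symm.fst = (g j).fst := by
          rw [hjb]
          change (t (b - 1)).snd = _
          rw [hP.snd _ (by omega), Nat.sub_add_cancel hb0]
        have hdg : (t (b - 1)).symm ≠ g j := fun hc => hgs (b - 1) (by omega) (by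
          rw [← hc, ← hP.fst _ (by omega)]; rfl)
        have hdc : S.colour (t (b - 1)).symm = .yellow := by
          rw [S.colour_symm, h.colour_straight _ (by omega), hred]; rfl
        refine ⟨(t (b - 1)).symm, List.mem_append_right _ (List.mem_append_right _ (mem_rev.2
          (mem_sl.2 ⟨b - 1, by omega, by omega, by rw [SimpleGraph.Dart.symm_symm]⟩))), hdf, ?_⟩
        by_contra hcon
        have h2 := (mem_fan_or hdf hdg (htf.trans hdf.symm)).resolve_left hcon
        by_cases hrd : (t (b - 1)).symm = T.rot (g j)
        · have h3 := mem_fan_rotate hdf.symm hdg.symm h2 htg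
          rw [hrd] at h3
          have h4 : T.rot (g j) ≠ t b := by
            intro hc
            rw [← hrd] at hc
            rw [hc, hP.out b hlt] at hdo
            cases hdo
          exact notMem_fan_of_osum_exterior h1 htf (hgx j) (mem_fan_of_rot htf h3 h4)
        · have h3 := osum_first_in_yellow hS.1 (hgx j) hdf hdo hdc hrd
          have h4 : T.rot (g j) ∈ T.fan (g j) (t (b - 1)).symm :=
            rot_mem_fan hdf.symm (left_mem_fan hdf.symm) (Ne.symm hrd)
          have h5 : t b ≠ T.rot (g j) := by
            intro hc
            rw [← hc, hP.out b hlt] at h3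
            cases h3.2
          rcases (fan_trans_mem hdf.symm h4 (rot_ne _)).1 h2 with h6 | h6
          · exact htg (eq_of_mem_fan_rot h6)
          · exact notMem_fan_of_osum h3.1 ((T.rot_fst _).trans hdf.symm) (hP.out b hlt) h5 h6
    have hseg := hP.isSeg (a := b) (k := B - b) (by omega)
    obtain ⟨k, hk⟩ : ∃ k, B - b = k + 1 := ⟨B - b - 1, by omega⟩
    rw [hk, sl_succ'] at hseg
    have hoff : ∀ b', b < b' → b' ≤ B → ∀ d ∈ c, d.fst ≠ p b' := by
      intro b' hb' hbB' d hd hdb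
      rcases List.mem_append.1 hd with hd | hd
      · obtain ⟨a', -, ha', h4⟩ := hfX d hd
        have h5 : m a' = p b' := h4.symm.trans hdb
        rcases Nat.eq_zero_or_pos a' with rfl | h0
        · rw [h.start] at h5
          have := hP.inj 0 (by omega) b' hbB' h5
          omega
        · exact h.disjoint hS h0 (by omega) hbB' h5
      rcases List.mem_append.1 hd with hd | hd
      · obtain ⟨k', hk1, hk2, h4⟩ := hfR d hd
        exact hPoff' k' hk1 hk2 b' hbB' (h4.symm.trans hdb)
      · obtain ⟨b'', hb1, hb2, h4⟩ := hfY d hd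
        have := hP.inj b'' (by omega) b' hbB' (h4.symm.trans hdb)
        omega
    have hgj := hgc' j le_rfl (by omega)
    refine hnl (root_symm_mem_left hcyc hseg (left_of_sameRegion (mem_left hd)
      (hcyc.sameRegion_left_fan hgj hd hdf.symm (by
        rw [SimpleGraph.Dart.symm_symm]; exact htd))) (fun q hq d hd => ?_)
      (hoff _ (by omega) (by omega)) ?_)
    · obtain ⟨k', hk1, hk2, rfl⟩ := mem_sl.1 hq
      rw [hP.fst k' (by omega)]
      exact hoff k' (by omega) (by omega) d hd
    · rw [show b + (k + 1) = B by omega]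
      exact h.end_straight_mem hS.1
  -- The first edge of the reversed arc is not outgoing at the end of the turning path, so only the
  -- term of the last edge remains.
  have harc : outN S (g j).symm ≤ ts S R := by
    have h1 := le_ts_rev_extSeq hS.1 he j (i - j - 1)
    rw [show j + (i - j - 1) = i - 1 by omega, show i - j - 1 + 1 = i - j by omega] at h1
    change outN S (g j).symm - outN S x ≤ ts S R at h1
    rw [outN_of_false hx1.2, sub_zero] at h1
    exact h1
  have hon := outN_symm (S := S) (g j)
  have hsum : cturn S c = 3 := (cturn_eq hS.1 hcyc).2 hnl
  have hRhead : R.head hRn = x := by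
    simp only [hR]
    rw [head_rev _ hRn', getLast_sl, show j + (i - j) - 1 = i - 1 by omega]
  have hRlast : R.getLast hRn = (g j).symm := by
    simp only [hR]
    rw [getLast_rev _ hRn', head_sl]
  have hXlast : X.getLast hXn = s (a - 1) := by
    simp only [hX]
    rw [getLast_sl, zero_add]
  have hXhead : X.head hXn = s 0 := by
    simp only [hX]
    rw [head_sl]
  have haZ : (2 : ℤ) ≤ a := by exact_mod_cast hA2
  -- In both cases the total turn comes out as at least `a + 2`, hence at least 4 instead of 3. If
  -- `b = 0`, the straight path contributes no dart to the cycle.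
  rcases Nat.eq_zero_or_pos b with hb0 | hb0
  · have hYe : Y = [] := by rw [hY, hb0]; rfl
    have hs0 : (s 0).fst = (g j).fst := by rw [hμ.fst 0 (by omega), h.start, hjb, hb0]
    have hs0o := hμ.out 0 (by omega)
    have hcol : S.colour (s 0) = .yellow := by
      cases hcc : S.colour (s 0) with
      | blue => exact absurd hcc (no_blue_out hS.1 ⟨_, hgx j, hs0.symm⟩ hs0o)
      | red =>
        have hB := hyellow hcc
        have hvy : (s 0).fst ≠ T.vy := by
          intro hc
          have := hS.1.2.2.2.1 _ hc
          rw [hs0o] at this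
          cases this
        obtain ⟨z, h1, h2, h3⟩ := exists_out_yellow hS.1 hvy
        refine absurd ?_ (h.end_straight z (by
          rw [← hB, hb0, ← h.start, ← hμ.fst 0 (by omega), h1]) h2)
        rw [h3, hcc]
        rfl
      | yellow => rfl
    have hs0g : s 0 ≠ g j := by
      intro hc
      have h1 : (g (j + 1)).fst = m 1 := by rw [← hgc, ← hc, hμ.snd 0 (by omega)]
      rcases (show j + 1 ≤ i by omega).lt_or_eq with h2 | h2
      · exact himin _ h2 (by omega) 1 le_rfl (by omega) h1
      · rw [h2, hia] at h1
        have := hμ.inj _ le_rfl _ (by omega) h1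
        omega
    have h1 := osum_out_yellow_last hS.1 (hgx j) hs0 hs0o hcol hs0g
    rw [outN_of_false h1.2] at hon
    rw [hc, hYe, List.append_nil, cturn_append hXn hRn, hRhead, hRlast, hXlast, hXhead, hturn1,
      h.ts_left hS.1 (by omega) le_rfl, turn, SimpleGraph.Dart.symm_symm, h1.1] at hsum
    linarith
  · have hYn' : sl t 0 b ≠ [] := sl_ne_nil hb0
    have hYn : Y ≠ [] := rev_ne_nil hYn'
    set d := (t (b - 1)).symm with hd
    have hdo : S.out d = false := out_symm_of_true (hP.out _ (by omega))
    have hdf : d.fst = (g j).fst := by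
      rw [hjb]
      change (t (b - 1)).snd = _
      rw [hP.snd _ (by omega), Nat.sub_add_cancel hb0]
    have hdg : d ≠ g j := fun hc => hgs (b - 1) (by omega) (by
      rw [← hc, ← hP.fst _ (by omega)]; rfl)
    have hdc : S.colour d = (S.colour (s 0)).next := by
      rw [hd, S.colour_symm, h.colour_straight _ (by omega)]
    -- The straight path arrives by a red edge, by a yellow edge at its end, which must then be
    -- `v_y`, or by a blue edge; the order of the colours at the boundary leaves at most one
    -- outgoing edge on the left in each case.
    have hcorner : osum S d (g j) + outN S (g j) ≤ 1 := by
      cases hcc : S.colour (s 0) with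
      | blue =>
        have h1 := osum_in_red_last hS.1 (hgx j) hdf hdo (by rw [hdc, hcc]; rfl) hdg
        rw [h1.1, outN_of_false h1.2]
        norm_num
      | red =>
        have hvy : (g j).fst = T.vy := by
          by_contra hvy
          obtain ⟨z, h1, h2, h3⟩ := exists_out_yellow hS.1 hvy
          refine h.end_straight z (by rw [← hyellow hcc, h1, hjb]) h2 ?_
          rw [h3, hcc]
          rfl
        have h1 := osum_at_vy_last hS.1 (hgx j) hdf hvy hdg
        rw [h1.1, outN_of_false h1.2]
        norm_num
      | yellow =>
        exact (osum_in_blue_last hS.1 (hgx j) hdf hdo (by rw [hdc, hcc]; rfl)).le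
    have hYhead : Y.head hYn = d := by
      simp only [hY]
      rw [head_rev _ hYn', getLast_sl, zero_add]
    have hYlast : Y.getLast hYn = (t 0).symm := by
      simp only [hY]
      rw [getLast_rev _ hYn', head_sl]
    rw [hc, cturn_append hXn (by simp [hRn]), ts_append hRn hYn, List.head_append_of_ne_nil hRn,
      List.getLast_append_of_ne_nil _ hYn, hRhead, hRlast, hYhead, hYlast, hXlast, hXhead, hturn1,
      h.ts_left hS.1 (by omega) le_rfl, h.ts_rev_straight hS.1 hb0 hbB,
      h.turn_start hS.1 (by omega), turn, SimpleGraph.Dart.symm_symm] at hsum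
    linarith

end InfiniteTriangulation

/-! ### From one colour to the next along a path -/

namespace InfiniteTriangulation

variable {V : Type*} {T : InfiniteTriangulation V} {S : ColouredOrientation T.graph}

/-- If `v → u` has colour `c` and `u → x` has the next colour, then `x` lies on the path of the next
colour that starts at `v`. -/
theorem mem_path_of_arc (hS : T.IsMaximalSchnyderWood S) {c : Colour} {v u x : V}
    (hvu : S.Arc c v u) (hux : S.Arc c.next u x) : x ∈ S.path c.next v := by
  by_contra hx
  have hu : u ∉ S.path c.next v := fun hu => hx (Relation.ReflTransGen.tail hu hux)
  obtain ⟨d, rfl, rfl, hd, hdc⟩ := hvu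
  obtain ⟨d', hd'f, rfl, hd', hd'c⟩ := hux
  obtain ⟨m, s, n, hm, rfl, hturn, hend⟩ := exists_isDiPath hS (f := Colour.next) (.inr fun _ => rfl) hd
  have hm0 : m 0 = (s 0).fst := (hm.fst 0 (by omega)).symm
  have hm1 : m 1 = (s 0).snd := (hm.snd 0 (by omega)).symm
  have hn : 0 < n := by
    refine Nat.pos_of_ne_zero fun h0 => ?_
    subst h0
    exact hend d' (hd'f.trans hm1.symm) hd' (by rw [hd'c, hdc])
  have hs1 : s 1 = d' := out_unique hS.1 (by rw [hm.fst 1 (by omega), hm1, hd'f])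
    (hm.out 1 (by omega)) hd' (by rw [hturn 0 hn, hdc, hd'c])
  have hm2 : m 2 = d'.snd := by rw [← hs1, hm.snd 1 (by omega)]
  -- At a boundary vertex there may be no edge of the next colour; then the straight path is
  -- trivial, with `B = 0`.
  obtain ⟨p, t, B, hp, hp0, hcol, hpend⟩ : ∃ p t B, IsDiPath S p t B ∧ p 0 = (s 0).fst ∧
      (∀ i < B, S.colour (t i) = (S.colour (s 0)).next) ∧
      ∀ x : T.graph.Dart, x.fst = p B → S.out x = true → S.colour x ≠ (S.colour (s 0)).next := by
    by_cases hex : ∃ z : T.graph.Dart, z.fst = (s 0).fst ∧ S.out z = true ∧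
        S.colour z = (S.colour (s 0)).next
    · obtain ⟨z, hzf, hz, hzc⟩ := hex
      obtain ⟨p, t, n', hp, rfl, hst, hpe⟩ := exists_isDiPath hS (f := id) (.inl fun _ => rfl) hz
      have hcol : ∀ i < n' + 1, S.colour (t i) = (S.colour (s 0)).next := by
        intro i hi
        induction i with
        | zero => exact hzc
        | succ i ih => exact (hst i (by omega)).trans (ih (by omega))
      refine ⟨p, t, n' + 1, hp, by rw [← hp.fst 0 (by omega), hzf], hcol, fun y h1 h2 => ?_⟩
      rw [← hcol n' (by omega)]
      exact hpe y h1 h2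
    · push Not at hex
      exact ⟨fun _ => (s 0).fst, s, 0, ⟨fun i hi => absurd hi (Nat.not_lt_zero i),
        fun i hi => absurd hi (Nat.not_lt_zero i), fun i hi => absurd hi (Nat.not_lt_zero i),
        fun i hi j hj _ => by omega⟩, rfl, fun i hi => absurd hi (Nat.not_lt_zero i), hex⟩
  have hpath : ∀ b ≤ B, p b ∈ S.path c.next (s 0).fst := by
    intro b hb
    induction b with
    | zero => rw [hp0]; exact .refl
    | succ b ih => exact .tail (ih (by omega)) ⟨t b, hp.fst b hb, hp.snd b hb, hp.out b hb, by
        rw [hcol b hb, hdc]⟩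
  exact not_isDivergent hS ⟨hm, hp, by omega, hm0.trans hp0.symm, fun i hi => hturn i (by omega),
    hcol, hend, hpend, fun b hb hc => hu (by rw [← hm1, hc]; exact hpath b hb),
    fun b hb hc => hx (by rw [← hm2, hc]; exact hpath b hb)⟩

lemma arc_unique (hS : T.IsSchnyderWood S) {c : Colour} {u w w' : V} (h : S.Arc c u w)
    (h' : S.Arc c u w') : w = w' := by
  obtain ⟨d, rfl, rfl, h1, h2⟩ := h
  obtain ⟨d', h0, rfl, h1', h2'⟩ := h'
  rw [out_unique hS h0.symm h1 h1' (h2.trans h2'.symm)]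

/-- The head `w'` of the edge of the next colour at `u'` is reached from `u` in at least one step. -/
lemma exists_arc_of_arc (hS : T.IsMaximalSchnyderWood S) {c : Colour} {u u' w' : V}
    (huu : S.Arc c u u') (hw : S.Arc c.next u' w') :
    ∃ w, S.Arc c.next u w ∧ w' ∈ S.path c.next w := by
  rcases Relation.ReflTransGen.cases_head (mem_path_of_arc hS huu hw) with rfl | ⟨w, h1, h2⟩
  · exfalso
    obtain ⟨d, rfl, rfl, h1, -⟩ := huu
    obtain ⟨d', h2, h3, h4, -⟩ := hw
    have : d' = d.symm := T.dart_ext h2 h3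
    rw [this, out_symm_of_true h1] at h4
    cases h4
  · exact ⟨w, h1, h2⟩

/-- `w'` is reached from `u` in at least one step, hence from the successor `w` of `u`. This matters
because `u` itself need not lie on the path of the next colour from `v`. -/
lemma exists_arc_step (hS : T.IsMaximalSchnyderWood S) {c : Colour} {v u u' w' : V}
    (hu : ∃ w ∈ S.path c.next v, S.Arc c.next u w) (huu : S.Arc c u u')
    (hw : S.Arc c.next u' w') : w' ∈ S.path c.next v := by
  obtain ⟨w, hwv, huw⟩ := hu
  obtain ⟨w₁, h1, h2⟩ := exists_arc_of_arc hS huu hw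
  rw [arc_unique hS.1 h1 huw] at h2
  exact Relation.ReflTransGen.trans hwv h2

/-- The predicate `p` singles out vertices that surely have an outgoing edge of the next colour and
is inherited along the path; it serves to keep away from `v_r` and `v_y`. -/
lemma exists_arc_of_path (hS : T.IsMaximalSchnyderWood S) {c : Colour} {v : V} {p : V → Prop}
    (hv : p v) (hp : ∀ u u', p u → S.Arc c u u' → p u')
    (hout : ∀ u, p u → ∃ w, S.Arc c.next u w) :
    ∀ u ∈ S.path c v, ∃ w ∈ S.path c.next v, S.Arc c.next u w := by
  intro u hu
  have key : p u ∧ ∃ w ∈ S.path c.next v, S.Arc c.next u w := by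
    induction hu with
    | refl =>
      obtain ⟨w, hw⟩ := hout v hv
      exact ⟨hv, w, .single hw, hw⟩
    | tail _ huu ih =>
      have h1 := hp _ _ ih.1 huu
      obtain ⟨w, hw⟩ := hout _ h1
      exact ⟨h1, w, exists_arc_step hS ih.2 huu hw, hw⟩
  exact key.2

end InfiniteTriangulation

theorem theorem4 {V : Type*} (T : InfiniteTriangulation V) (S : ColouredOrientation T.graph)
    (hS : T.IsMaximalSchnyderWood S) (v : V) :
    (v ≠ T.vr → v ≠ T.vy →
      ∀ u ∈ S.path Colour.blue v, ∃ w ∈ S.path Colour.red v, S.Arc Colour.red u w) ∧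
    (v ≠ T.vy →
      ∀ u ∈ S.path Colour.red v, ∃ w ∈ S.path Colour.yellow v, S.Arc Colour.yellow u w) ∧
    (∀ u ∈ S.path Colour.yellow v, u ∈ T.boundary ∨
      ∃ w ∈ S.path Colour.blue v, S.Arc Colour.blue u w) := by
  have hsnd : ∀ {c : Colour} {u w : V}, S.Arc c u w → (w = T.vr → c = .red) ∧
      (w = T.vy → c = .yellow) := by
    rintro c u w ⟨d, rfl, rfl, h1, rfl⟩
    exact ⟨fun h => hS.1.2.2.2.2.1 d h h1, fun h => hS.1.2.2.2.2.2 d h h1⟩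
  refine ⟨fun hr hy => ?_, fun hy => ?_, fun u hu => ?_⟩
  · refine InfiniteTriangulation.exists_arc_of_path (c := .blue) hS (p := fun u => u ≠ T.vr ∧ u ≠ T.vy) ⟨hr, hy⟩
      (fun u u' _ h => ⟨fun hc => ?_, fun hc => ?_⟩) fun u hu => ?_
    · cases (hsnd h).1 hc
    · cases (hsnd h).2 hc
    · obtain ⟨d, h1, h2, h3⟩ := InfiniteTriangulation.exists_out_red hS.1 hu.1 hu.2
      exact ⟨d.snd, d, h1, rfl, h2, h3⟩
  · refine InfiniteTriangulation.exists_arc_of_path (c := .red) hS (p := fun u => u ≠ T.vy) hy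
      (fun u u' _ h hc => ?_) fun u hu => ?_
    · cases (hsnd h).2 hc
    · obtain ⟨d, h1, h2, h3⟩ := InfiniteTriangulation.exists_out_yellow hS.1 hu
      exact ⟨d.snd, d, h1, rfl, h2, h3⟩
  · have hblue : ∀ u, u ∉ T.boundary → ∃ w, S.Arc .blue u w := by
      intro u hu
      obtain ⟨d, h1, h2, h3⟩ := InfiniteTriangulation.exists_out_blue hS.1 hu
      exact ⟨d.snd, d, h1, rfl, h2, h3⟩
    induction hu with
    | refl =>
      refine or_iff_not_imp_left.2 fun hv => ?_
      obtain ⟨w, hw⟩ := hblue v hv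
      exact ⟨w, .single hw, hw⟩
    | @tail u u' _ huu ih =>
      refine or_iff_not_imp_left.2 fun hu' => ?_
      obtain ⟨w, hw⟩ := hblue u' hu'
      -- Since `u'` has an outgoing blue edge, so has its predecessor `u`. Thus `u` is not on the
      -- boundary and the induction hypothesis provides its blue edge.
      obtain ⟨w₁, ⟨d, rfl, -, h1, h2⟩, -⟩ := InfiniteTriangulation.exists_arc_of_arc (c := .yellow) hS huu hw
      have hu : d.fst ∉ T.boundary := fun hb => InfiniteTriangulation.no_blue_out hS.1 hb h1 h2
      exact ⟨w, InfiniteTriangulation.exists_arc_step (c := .yellow) hS (ih.resolve_left hu) huu hw, hw⟩
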